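/- **Theorem 5.1.** Let $n\ge 2$. Let $A$ be a commutative $\mathbb Q$-algebra ("functions of $x_1,x_2,\dots$") with pairwise commuting derivations $\partial_1,\partial_2,\dots$, and put $\partial=\partial_1$. A solution of the $n$-Gelfand–Dikii hierarchy in $A$ is an operator $L=\partial^n+u_{n-2}\partial^{n-2}+\dots+u_1\partial+u_0$ with $u_j\in A$ such that $\partial_iL=[(L^{i/n})_+,L]$ for all $i\ge1$, where $L^{1/n}=\partial+q_0+q_1\partial^{-1}+\cdots$ is the monic $n$-th root of $L$ among formal pseudo-differential operators and $(\cdot)_+$ is the differential part. For $v\in A$ define $\eta_r,\xi_j$ by $$\eta_r=\sum_{m\ge1}\ \sum_{i_1+\dots+i_m=r}\frac{(-1)^{m+1}}{m!\,i_1\cdots i_m}\,\partial_{i_1}\cdots\partial_{i_m}v,\qquad 1+\sum_{j\ge1}\xi_jk^{-j}=\exp\Big(\sum_{r\ge1}\eta_rk^{-r}\Big),$$ so that $\psi=\exp\big(\sum_j x_jk^j\big)\big(1+\sum_j\xi_jk^{-j}\big)$ is the Baker–Akhiezer function with $\tau=e^{-v}$, and put $W=1+\sum_j\xi_j\partial^{-j}$.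 We say that $v$ generates $L$ if $L\psi=k^n\psi$ and $\partial_i\psi=(L^{i/n})_+\psi$ for all $i\ge 1$, that is, $LW=W\partial^n$ and $\partial_iW=(L^{i/n})_+W-W\partial^i$ for all $i\ge 1$. There exist rational coefficients $N^m_{i_1\dots i_k}\begin{pmatrix}s_1&\cdots&s_m\\t_1&\cdots&t_m\end{pmatrix}$, depending only on $n$ and the displayed indices (in particular not on $A$), only finitely many nonzero for given $i_1,\dots,i_k$, and vanishing for $k\ge2$ unless $$m\ge1,\quad 1\le s_j<n,\quad t_j\ge1,\quad \sum_{j=1}^k i_j=\sum_{j=1}^m(s_j+t_j),\quad \sum_{j=1}^m t_j\ge m+k-2,\quad k+m+\sum_{j=1}^m t_j\equiv0\pmod 2,$$ such that the $n$-Gelfand–Dikii hierarchy is equivalent to the system $$\partial_{i_1}\cdots\partial_{i_k}v=\sum_{m\ge1}\ \sum_{s,t} N^m_{i_1\dots i_k}\begin{pmatrix}s_1&\cdots&s_m\\t_1&\cdots&t_m\end{pmatrix}\partial_{s_1}\partial^{t_1}v\cdots\partial_{s_m}\partial^{t_m}v\qquad(k\ge2,\ i_1,\dots,i_k\ge1)$$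 in the following sense, for every $A$ and $(\partial_i)$ as above. 1. An element $v\in A$ satisfies the system if and only if it generates some solution $L$ of the $n$-Gelfand–Dikii hierarchy, and $v$ generates at most one operator $L$. 2. If $v$ generates a solution $L$, then $v'\in A$ generates $L$ if and only if $\partial_i\partial_jv'=\partial_i\partial_jv$ for all $i,j\ge1$. 3. If every family $(w_i)_{i\ge1}$ in $A$ with $\partial_iw_j=\partial_jw_i$ for all $i,j$ has the form $w_i=\partial_iv$ with $v\in A$, then every solution $L$ of the hierarchy is generated by some $v\in A$ with $\partial_nv=0$. In particular, if $K$ is a field of characteristic $0$, every solution $L$ over the ring of formal power series in $x_1,x_2,\dots$ over $K$, with $\partial_i=\partial/\partial x_i$, is generated by a formal power series $v$ with $\partial_nv=0$. -/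

import Mathlib

universe u

namespace GelfandDikii

variable {A : Type u} [CommRing A] [Algebra ℚ A]

/-- A formal pseudo-differential operator `∑_{k ≤ N} a_k ∂^k` with coefficients in `A`;
`coeff k` is the coefficient `a_k`, written to the left of `∂^k`. -/
@[ext]
structure PsiDO (A : Type u) [CommRing A] where
  coeff : ℤ → A
  bddAbove : ∃ N : ℤ, ∀ k, N < k → coeff k = 0

namespace PsiDO

/-- The operator `∂^d`. -/
def dPow (A : Type u) [CommRing A] (d : ℤ) : PsiDO A where
  coeff k := if k = d then 1 else 0
  bddAbove := ⟨d, fun _ hk => if_neg (ne_of_gt hk)⟩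

/-- The composition of pseudo-differential operators, determined by the Leibniz rule
`(a ∂^p) ∘ (b ∂^q) = ∑_{l ≥ 0} (p choose l) a b^{(l)} ∂^{p + q - l}`, where `b' = ∂ b`.
The coefficient of `∂^k` is a sum over `(p, l)`, with `q = k - p + l`; only finitely many
summands are nonzero. -/
noncomputable def comp (d : Derivation ℚ A A) (P R : PsiDO A) : PsiDO A where
  coeff k := ∑ᶠ pl : ℤ × ℕ,
    ((Ring.choose pl.1 pl.2 : ℤ) : A) * (P.coeff pl.1 * d^[pl.2] (R.coeff (k - pl.1 + pl.2)))
  bddAbove := by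
    obtain ⟨N, hN⟩ := P.bddAbove
    obtain ⟨M, hM⟩ := R.bddAbove
    refine ⟨N + M, fun k hk => ?_⟩
    refine finsum_eq_zero_of_forall_eq_zero fun pl => ?_
    rcases lt_or_ge N pl.1 with h | h
    · simp [hN _ h]
    · have h0 : R.coeff (k - pl.1 + pl.2) = 0 := hM _ (by omega)
      have h1 : d^[pl.2] (0 : A) = 0 := Function.iterate_fixed (map_zero d) _
      rw [h0, h1, mul_zero, mul_zero]

/-- The powers `P^i` with respect to the composition. -/
noncomputable def pow (d : Derivation ℚ A A) (P : PsiDO A) : ℕ → PsiDO A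
  | 0 => dPow A 0
  | i + 1 => comp d (pow d P i) P

/-- The differential part `P_+`. -/
def plus (P : PsiDO A) : PsiDO A where
  coeff k := if 0 ≤ k then P.coeff k else 0
  bddAbove := by
    obtain ⟨N, hN⟩ := P.bddAbove
    exact ⟨N, fun k hk => by simp [hN k hk]⟩

/-- The operator whose coefficients are the images of those of `P` under a derivation. -/
def deriv (d : Derivation ℚ A A) (P : PsiDO A) : PsiDO A where
  coeff k := d (P.coeff k)
  bddAbove := by
    obtain ⟨N, hN⟩ := P.bddAbove
    exact ⟨N, fun k hk => by simp [hN k hk]⟩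

/-- The difference of two pseudo-differential operators. -/
def sub (P R : PsiDO A) : PsiDO A where
  coeff k := P.coeff k - R.coeff k
  bddAbove := by
    obtain ⟨N, hN⟩ := P.bddAbove
    obtain ⟨M, hM⟩ := R.bddAbove
    exact ⟨max N M, fun k hk => by
      rw [hN k (lt_of_le_of_lt (le_max_left _ _) hk),
        hM k (lt_of_le_of_lt (le_max_right _ _) hk), sub_zero]⟩

/-- `L = ∂^n + u_{n-2} ∂^{n-2} + ⋯ + u_1 ∂ + u_0`. -/
structure IsGDOperator (n : ℕ) (L : PsiDO A) : Prop where
  lead : L.coeff n = 1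
  sublead : L.coeff (n - 1) = 0
  above : ∀ k : ℤ, (n : ℤ) < k → L.coeff k = 0
  below : ∀ k : ℤ, k < 0 → L.coeff k = 0

/-- `Q = ∂ + q_0 + q_1 ∂^{-1} + ⋯` and `Q^n = L`, that is, `Q = L^{1/n}`. -/
structure IsRoot (d : Derivation ℚ A A) (n : ℕ) (L Q : PsiDO A) : Prop where
  lead : Q.coeff 1 = 1
  above : ∀ k : ℤ, 1 < k → Q.coeff k = 0
  pow_eq : pow d Q n = L

end PsiDO

open PsiDO

/-- `L` is a solution of the `n`-Gelfand–Dikii hierarchy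
`∂_i L = [(L^{i/n})_+, L]`, `i = 1, 2, …`, where `∂_i = D i` and `∂ = D 1`. -/
def IsGDSolution (D : ℕ+ → Derivation ℚ A A) (n : ℕ) (L : PsiDO A) : Prop :=
  IsGDOperator n L ∧ ∃ Q : PsiDO A, IsRoot (D 1) n L Q ∧
    ∀ i : ℕ+, PsiDO.deriv (D i) L =
      PsiDO.sub (comp (D 1) (plus (pow (D 1) Q i)) L) (comp (D 1) L (plus (pow (D 1) Q i)))

/-- `∂_{i_1} ⋯ ∂_{i_k} v` for `I = [i_1, …, i_k]`. -/
def iterD (D : ℕ+ → Derivation ℚ A A) (I : List ℕ+) (v : A) : A :=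
  I.foldr (fun i a => D i a) v

/-- The coefficient of `k^{-r}` in `v(x) - v(x_1 - k^{-1}, x_2 - k^{-2}/2, x_3 - k^{-3}/3, …)`:
`η_r = ∑_{i_1 + ⋯ + i_m = r} (-1)^{m+1} / (m! i_1 ⋯ i_m) ∂_{i_1} ⋯ ∂_{i_m} v`,
the sum being over all compositions of `r` into positive parts. -/
noncomputable def eta (D : ℕ+ → Derivation ℚ A A) (v : A) (r : ℕ) : A :=
  ∑ c : Composition r, ((-1 : ℚ) ^ (c.length + 1) / (c.length.factorial * c.blocks.prod : ℕ)) •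
    iterD D (c.blocks.map Nat.toPNat') v

/-- The coefficient of `k^{-j}` in `exp (∑_{r ≥ 1} η_r k^{-r})`:
`ξ_j = ∑_{r_1 + ⋯ + r_m = j} (1 / m!) η_{r_1} ⋯ η_{r_m}`. -/
noncomputable def xi (D : ℕ+ → Derivation ℚ A A) (v : A) (j : ℕ) : A :=
  ∑ c : Composition j, (1 / (c.length.factorial : ℚ)) • (c.blocks.map (eta D v)).prod

/-- The operator `W = 1 + ξ_1 ∂^{-1} + ξ_2 ∂^{-2} + ⋯`. The formal Baker–Akhiezer function with
`τ = exp (-v)`, namely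
`ψ = exp (∑ x_j k^j) τ(x_1 - k^{-1}, x_2 - k^{-2}/2, …) / τ(x) = exp (∑ x_j k^j) (1 + ∑ ξ_j k^{-j})`,
is the result of applying `W` to `exp (∑ x_j k^j)`. -/
noncomputable def waveOp (D : ℕ+ → Derivation ℚ A A) (v : A) : PsiDO A where
  coeff k := if k ≤ 0 then xi D v (-k).toNat else 0
  bddAbove := ⟨0, fun _ hk => if_neg (not_le.mpr hk)⟩

/-- The solution `L` of the hierarchy is generated by `v = -ln τ`: the Baker–Akhiezer function
`ψ = W exp (∑ x_j k^j)` of `v` satisfies `L ψ = k^n ψ` and `∂_i ψ = (L^{i/n})_+ ψ` for all `i`.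
In terms of `W` this reads `L W = W ∂^n` and `∂_i W = (L^{i/n})_+ W - W ∂^i`. -/
def IsGeneratedBy (D : ℕ+ → Derivation ℚ A A) (n : ℕ) (L : PsiDO A) (v : A) : Prop :=
  comp (D 1) L (waveOp D v) = comp (D 1) (waveOp D v) (dPow A n) ∧
  ∃ Q : PsiDO A, IsRoot (D 1) n L Q ∧
    ∀ i : ℕ+, PsiDO.deriv (D i) (waveOp D v) =
      PsiDO.sub (comp (D 1) (plus (pow (D 1) Q i)) (waveOp D v))
        (comp (D 1) (waveOp D v) (dPow A (i : ℕ)))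

/-- A family of rational coefficients `N_{i_1 … i_k}^m (s_1 … s_m; t_1 … t_m)`: the first argument
is the list `[i_1, …, i_k]`, the second one the list of columns `[(s_1, t_1), …, (s_m, t_m)]`.
For given `i_1, …, i_k` only finitely many coefficients are nonzero. -/
abbrev Coefficients : Type := List ℕ+ → (List (ℕ+ × ℕ+) →₀ ℚ)

/-- The restrictions on the monomials that occur in the system. -/
def Coefficients.Admissible (n : ℕ) (N : Coefficients) : Prop :=
  ∀ I : List ℕ+, 2 ≤ I.length → ∀ M : List (ℕ+ × ℕ+), N I M ≠ 0 →
    1 ≤ M.length ∧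
    (∀ p ∈ M, (p.1 : ℕ) < n) ∧
    (I.map (fun i => (i : ℕ))).sum = (M.map (fun p => (p.1 : ℕ) + (p.2 : ℕ))).sum ∧
    M.length + I.length ≤ (M.map (fun p => (p.2 : ℕ))).sum + 2 ∧
    I.length + M.length + (M.map (fun p => (p.2 : ℕ))).sum ≡ 0 [MOD 2]

/-- `v` satisfies, for all `k ≥ 2` and all `i_1, …, i_k ≥ 1`, the equation
`∂_{i_1} ⋯ ∂_{i_k} v
  = ∑_m ∑ N_{i_1 … i_k}^m (s_1 … s_m; t_1 … t_m) ∂_{s_1} ∂^{t_1} v ⋯ ∂_{s_m} ∂^{t_m} v`. -/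
def SatisfiesSystem (D : ℕ+ → Derivation ℚ A A) (N : Coefficients) (v : A) : Prop :=
  ∀ I : List ℕ+, 2 ≤ I.length →
    iterD D I v = (N I).sum fun M c => c • (M.map fun p => D p.1 ((D 1)^[(p.2 : ℕ)] v)).prod

/-- Every family `(w_i)` with `∂_i w_j = ∂_j w_i` is of the form `w_i = ∂_i v`. -/
def ClosedFormsExact (D : ℕ+ → Derivation ℚ A A) : Prop :=
  ∀ w : ℕ+ → A, (∀ i j, D i (w j) = D j (w i)) → ∃ v : A, ∀ i, D i v = w i

/-- The partial derivatives `∂ / ∂ x_i` on formal power series in `x_1, x_2, …`. -/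
noncomputable def partialD (K : Type u) [Field K] [CharZero K] (i : ℕ+) :
    Derivation ℚ (MvPowerSeries ℕ+ K) (MvPowerSeries ℕ+ K) :=
  (MvPowerSeries.pderiv K i).restrictScalars ℚ

end GelfandDikii

/-!
Let `W = 1 + ξ_1 ∂^{-1} + ⋯` be the wave operator of `v`. That `v` generates a solution means that
`W` satisfies the Sato equations (each `∂_i W + W ∂^i` is a left multiple `B_i W` of `W` by a
differential operator) and that `W ∂^n W^{-1}` is a differential operator. For `W` as in the Sato
equations the latter says `∂_n W = 0`, that is, `∂_n ∂_j v = 0` for all `j`; the Lax equations for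
`L = W ∂^n W^{-1}` follow by differentiating `L W = W ∂^n` (`exists_solution_of_sato`,
`der_eq_zero_of_isGeneratedBy`). So the theorem is about the Sato equations together with this
constraint.

*From the Sato equations to the Fay identity.* Let `T_s = exp (-∑ (s^i / i) ∂_i)`, a ring
homomorphism `A → A⟦s⟧`. The wave function is `w(κ) = 1 + ∑ ξ_j κ^j = exp (v - T_κ v)`. The Sato
equations say that the left multiples of `W` by differential operators are stable under all
`X ↦ ∂_i X + X ∂^i`, hence that they contain the coefficients of `(T_s W) (1 - s ∂)`; for reasons of
order this becomes `(T_s W) (1 - s ∂) = (α_s - s ∂) W` (`sato_iff_discreteKP`). Division by `w`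
turns it into the differential Fay identity: the coefficient of `s^i κ^j` in `exp (T_s η - η)`,
where `η = v - T_κ v`, depends on `i + j` only, for `i, j ≥ 1` (`discreteKP_iff_fay`).

*From the Fay identity to the system.* The shift by `(T_s T_κ)^{-1/2}` makes the identity
symmetric under reversal of the signs of all `∂_i` (`fay_iff_symmetric`); this is where the parity
condition on the coefficients comes from. Its coefficients have the form
`∂_i ∂_j v = (i j / (i + j - 1)) ∂ ∂_{i + j - 1} v + H_{ij}`, where `H_{ij}` is a polynomial in
derivatives of order at least three and in second derivatives of lower degree
(`fay_iff_jets`, `jetRemainder_mem`). The case `i = n`, in which the left-hand side vanishes,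
expresses `∂ ∂_r v` for `r > n` by lower terms. By recursion on the degree every `∂_i ∂_j v` becomes
a polynomial in the `∂_s ∂^t v` with `s < n` and `t ≥ 1`, and differentiation yields such normal
forms for all higher derivatives; each derivation raises `∑ (t_j - 1)` by at least one, which gives
the lower bound on `∑ t_j`. The equations for the second derivatives are equivalent to the Fay
identity and the constraint (`secondForm_iff`), and they imply those for the higher ones
(`iterD_eq_of_lt`).

*Uniqueness of `v`.* The equation `∂_i W = -(L^{i/n})_- W` shows that `∂_i ∂ v` is minus the residue
of `L^{i/n}`, and by the system these functions determine all second derivatives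
(`der_der_unique`). Conversely, a change of `v` with constant first derivatives multiplies `W` from
the right by an operator with constant coefficients (`isGeneratedBy_of_der_eq`).

*Existence of `v`.* The Lax equations for `L` imply that the connection formed by the `(L^{i/n})_-`
is flat, so that `∂_i W = -(L^{i/n})_- W` can be solved one coefficient at a time
(`exists_unip_of_isGDSolution`). The Fay identity makes `T_s η - η` symmetric in `s` and `κ`, which
is the integrability condition for `η = v - T_κ v` (`exists_potential`).
-/

universe v

set_option linter.unusedSectionVars false

open Finset.HasAntidiagonal

namespace GelfandDikii

section

variable {A : Type u} [CommRing A] [Algebra ℚ A]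

namespace PsiDO

/-! ### The ring of formal pseudo-differential operators -/

theorem coeff_injective : Function.Injective (coeff : PsiDO A → ℤ → A) :=
  fun _ _ h => PsiDO.ext h

instance : Zero (PsiDO A) := ⟨⟨fun _ => 0, 0, fun _ _ => rfl⟩⟩

instance : Add (PsiDO A) := ⟨fun P R => ⟨fun k => P.coeff k + R.coeff k, by
  obtain ⟨N, hN⟩ := P.bddAbove
  obtain ⟨M, hM⟩ := R.bddAbove
  exact ⟨max N M, fun k hk => by
    rw [hN k (lt_of_le_of_lt (le_max_left _ _) hk),
      hM k (lt_of_le_of_lt (le_max_right _ _) hk), add_zero]⟩⟩⟩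

instance : Neg (PsiDO A) := ⟨fun P => ⟨fun k => -P.coeff k, by
  obtain ⟨N, hN⟩ := P.bddAbove
  exact ⟨N, fun k hk => by rw [hN k hk, neg_zero]⟩⟩⟩

instance : Sub (PsiDO A) := ⟨PsiDO.sub⟩

instance : SMul ℕ (PsiDO A) := ⟨fun n P => ⟨fun k => n • P.coeff k, by
  obtain ⟨N, hN⟩ := P.bddAbove
  exact ⟨N, fun k hk => by rw [hN k hk, smul_zero]⟩⟩⟩

instance : SMul ℤ (PsiDO A) := ⟨fun n P => ⟨fun k => n • P.coeff k, by
  obtain ⟨N, hN⟩ := P.bddAbove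
  exact ⟨N, fun k hk => by rw [hN k hk, smul_zero]⟩⟩⟩

instance : AddCommGroup (PsiDO A) :=
  coeff_injective.addCommGroup _ rfl (fun _ _ => rfl) (fun _ => rfl) (fun _ _ => rfl)
    (fun _ _ => rfl) (fun _ _ => rfl)

@[simp] theorem coeff_add (P R : PsiDO A) (k : ℤ) :
    (P + R).coeff k = P.coeff k + R.coeff k := rfl
@[simp] theorem coeff_neg (P : PsiDO A) (k : ℤ) : (-P).coeff k = -P.coeff k := rfl
@[simp] theorem coeff_sub (P R : PsiDO A) (k : ℤ) :
    (P - R).coeff k = P.coeff k - R.coeff k := rfl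

/-- Taking the coefficient of `∂^k`, as a homomorphism of additive groups. -/
def coeffHom (k : ℤ) : PsiDO A →+ A where
  toFun P := P.coeff k
  map_zero' := rfl
  map_add' _ _ := rfl

theorem coeff_sum {ι : Type*} (s : Finset ι) (f : ι → PsiDO A) (k : ℤ) :
    (∑ i ∈ s, f i).coeff k = ∑ i ∈ s, (f i).coeff k :=
  map_sum (coeffHom k) f s

/-- `P` has order at most `N`: all coefficients above `∂^N` vanish. -/
def OrdLE (P : PsiDO A) (N : ℤ) : Prop := ∀ k, N < k → P.coeff k = 0

theorem exists_ordLE (P : PsiDO A) : ∃ N, OrdLE P N := P.bddAbove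

theorem OrdLE.mono {P : PsiDO A} {N M : ℤ} (h : OrdLE P N) (hNM : N ≤ M) : OrdLE P M :=
  fun k hk => h k (lt_of_le_of_lt hNM hk)

theorem OrdLE.add {P R : PsiDO A} {N : ℤ} (hP : OrdLE P N) (hR : OrdLE R N) :
    OrdLE (P + R) N := fun k hk => by rw [coeff_add, hP k hk, hR k hk, add_zero]

theorem OrdLE.sub {P R : PsiDO A} {N : ℤ} (hP : OrdLE P N) (hR : OrdLE R N) :
    OrdLE (P - R) N := fun k hk => by rw [coeff_sub, hP k hk, hR k hk, sub_zero]

theorem OrdLE.neg {P : PsiDO A} {N : ℤ} (hP : OrdLE P N) :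
    OrdLE (-P) N := fun k hk => by rw [coeff_neg, hP k hk, neg_zero]

theorem OrdLE.pred {P : PsiDO A} {N : ℤ} (hP : OrdLE P N) (h0 : P.coeff N = 0) :
    OrdLE P (N - 1) := fun k hk => by
  rcases eq_or_lt_of_le (show N ≤ k by omega) with rfl | h
  exacts [h0, hP k h]

/-- An operator whose order is at most `N - j` for all `j` vanishes. -/
theorem eq_zero_of_ordLE {P : PsiDO A} (N : ℤ) (h : ∀ j : ℕ, OrdLE P (N - j)) : P = 0 := by
  ext k
  exact h ((N - k).toNat + 1) k (by have := Int.self_le_toNat (N - k); push_cast; omega)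

theorem iterate_zero_of_derivation (d : Derivation ℚ A A) (l : ℕ) : d^[l] (0 : A) = 0 :=
  Function.iterate_fixed (map_zero d) _

theorem iterate_add_of_derivation (d : Derivation ℚ A A) (l : ℕ) (a b : A) :
    d^[l] (a + b) = d^[l] a + d^[l] b := by
  induction l generalizing a b with
  | zero => rfl
  | succ l ih => simp [Function.iterate_succ_apply, ih]

theorem iterate_one_of_derivation (d : Derivation ℚ A A) {l : ℕ} (hl : l ≠ 0) :
    d^[l] (1 : A) = 0 := by
  obtain ⟨m, rfl⟩ := Nat.exists_eq_succ_of_ne_zero hl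
  rw [Function.iterate_succ_apply, Derivation.map_one_eq_zero, iterate_zero_of_derivation]

theorem iterate_intCast_mul (d : Derivation ℚ A A) (l : ℕ) (m : ℤ) (b : A) :
    d^[l] ((m : A) * b) = m * d^[l] b := by
  induction l generalizing b with
  | zero => rfl
  | succ l ih => simp [Function.iterate_succ_apply, ih]

theorem iterate_mul_of_derivation (d : Derivation ℚ A A) (l : ℕ) (a b : A) :
    d^[l] (a * b) = ∑ x ∈ antidiagonal l,
      ((l.choose x.1 : ℤ) : A) * (d^[x.1] a * d^[x.2] b) := by
  simp only [Int.cast_natCast]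
  induction l with
  | zero => simp
  | succ l ih =>
    rw [Function.iterate_succ_apply', ih, map_sum,
      Finset.sum_antidiagonal_choose_succ_mul fun i j => d^[i] a * d^[j] b,
      ← Finset.sum_add_distrib]
    refine Finset.sum_congr rfl fun x hx => ?_
    rw [← mem_antidiagonal.mp hx, Nat.choose_symm_add]
    simp only [Derivation.leibniz, smul_eq_mul, Derivation.map_natCast, mul_zero, add_zero,
      Function.iterate_succ_apply']
    ring

/-- The finite box outside which the terms of a coefficient of a composition vanish. -/
theorem comp_support_subset (d : Derivation ℚ A A) {P R : PsiDO A} {N M : ℤ} (hP : OrdLE P N)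
    (hR : OrdLE R M) (k : ℤ) :
    (Function.support fun pl : ℤ × ℕ =>
      ((Ring.choose pl.1 pl.2 : ℤ) : A) * (P.coeff pl.1 * d^[pl.2] (R.coeff (k - pl.1 + pl.2)))) ⊆
    ((Finset.Icc (k - M) N ×ˢ Finset.range ((N + M - k).toNat + 1) : Finset (ℤ × ℕ)) :
      Set (ℤ × ℕ)) := by
  rintro ⟨p, l⟩ h
  have h1 : p ≤ N := by
    by_contra hp
    exact h (by simp [hP p (not_le.mp hp)])
  have h2 : k - p + l ≤ M := by
    by_contra hp
    exact h (by simp [hR _ (not_le.mp hp)])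
  simp only [Finset.coe_product, Finset.coe_Icc, Finset.coe_range, Set.mem_prod, Set.mem_Icc,
    Set.mem_Iio]
  refine ⟨⟨by omega, h1⟩, by omega⟩

theorem comp_support_finite (d : Derivation ℚ A A) (P R : PsiDO A) (k : ℤ) :
    (Function.support fun pl : ℤ × ℕ =>
      ((Ring.choose pl.1 pl.2 : ℤ) : A) *
        (P.coeff pl.1 * d^[pl.2] (R.coeff (k - pl.1 + pl.2)))).Finite := by
  obtain ⟨N, hN⟩ := P.exists_ordLE
  obtain ⟨M, hM⟩ := R.exists_ordLE
  exact (Finset.finite_toSet _).subset (comp_support_subset d hN hM k)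

theorem comp_coeff_eq_zero (d : Derivation ℚ A A) {P R : PsiDO A} {N M : ℤ} (hP : OrdLE P N)
    (hR : OrdLE R M) : OrdLE (comp d P R) (N + M) := by
  intro k hk
  refine finsum_eq_zero_of_forall_eq_zero fun pl => ?_
  rcases lt_or_ge N pl.1 with h | h
  · simp [hP _ h]
  · rw [hR _ (by omega), iterate_zero_of_derivation, mul_zero, mul_zero]

/-- The coefficients of a composition as finite sums: `a` and `l` count from the top. -/
theorem comp_coeff_eq_sum (d : Derivation ℚ A A) {P R : PsiDO A} {N M : ℤ} (hP : OrdLE P N)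
    (hR : OrdLE R M) (t : ℕ) :
    (comp d P R).coeff (N + M - t) = ∑ x ∈ antidiagonal t, ∑ y ∈ antidiagonal x.2,
      ((Ring.choose (N - x.1) y.1 : ℤ) : A) *
        (P.coeff (N - x.1) * d^[y.1] (R.coeff (M - y.2))) := by
  rw [Finset.sum_sigma']
  refine (finsum_eq_sum_of_support_subset (s := Finset.image
    (fun z : (_ : ℕ × ℕ) × ℕ × ℕ => ((N - z.1.1, z.2.1) : ℤ × ℕ))
    ((antidiagonal t).sigma fun x => antidiagonal x.2)) _ ?_).trans ?_
  · rintro ⟨p, l⟩ h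
    have h1 : p ≤ N := by
      by_contra hp
      exact h (by simp [hP p (not_le.mp hp)])
    have h2 : N + M - t - p + l ≤ M := by
      by_contra hp
      exact h (by simp only; rw [hR _ (not_le.mp hp), iterate_zero_of_derivation, mul_zero,
        mul_zero])
    simp only [Finset.coe_image, Set.mem_image, Finset.mem_coe, Finset.mem_sigma,
      mem_antidiagonal, Prod.mk.injEq]
    exact ⟨⟨((N - p).toNat, t - (N - p).toNat), (l, t - (N - p).toNat - l)⟩,
      ⟨by dsimp; omega, by dsimp; omega⟩, by dsimp; omega, rfl⟩
  · rw [Finset.sum_image]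
    · refine Finset.sum_congr rfl fun z hz => ?_
      simp only [Finset.mem_sigma, mem_antidiagonal] at hz
      dsimp only
      rw [show N + M - t - (N - (z.1.1 : ℤ)) + z.2.1 = M - z.2.2 by omega]
    · rintro ⟨⟨a, b⟩, ⟨e, f⟩⟩ hz ⟨⟨a', b'⟩, ⟨e', f'⟩⟩ hz' h
      simp only [Finset.coe_sigma, Set.mem_sigma_iff, Finset.mem_coe,
        mem_antidiagonal] at hz hz'
      simp only [Prod.mk.injEq] at h
      obtain rfl : a = a' := by omega
      obtain rfl : b = b' := by omega
      obtain rfl : e = e' := by omega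
      obtain rfl : f = f' := by omega
      rfl

theorem comp_add_left (d : Derivation ℚ A A) (P P' R : PsiDO A) :
    comp d (P + P') R = comp d P R + comp d P' R := by
  ext k
  rw [coeff_add]
  refine Eq.trans ?_ (finsum_add_distrib (comp_support_finite d P R k)
    (comp_support_finite d P' R k))
  exact finsum_congr fun pl => by rw [coeff_add]; ring

theorem comp_add_right (d : Derivation ℚ A A) (P R R' : PsiDO A) :
    comp d P (R + R') = comp d P R + comp d P R' := by
  ext k
  rw [coeff_add]
  refine Eq.trans ?_ (finsum_add_distrib (comp_support_finite d P R k)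
    (comp_support_finite d P R' k))
  exact finsum_congr fun pl => by rw [coeff_add, iterate_add_of_derivation]; ring

/-- The monomial `a ∂^p`. -/
def mono (a : A) (p : ℤ) : PsiDO A where
  coeff k := if k = p then a else 0
  bddAbove := ⟨p, fun _ hk => if_neg (ne_of_gt hk)⟩

theorem mono_coeff_self (a : A) (p : ℤ) : (mono a p).coeff p = a := if_pos rfl

theorem mono_coeff_of_ne (a : A) {p k : ℤ} (h : k ≠ p) : (mono a p).coeff k = 0 := if_neg h

theorem ordLE_mono (a : A) (p : ℤ) : OrdLE (mono a p) p :=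
  fun _ hk => if_neg (ne_of_gt hk)

theorem comp_mono_coeff (d : Derivation ℚ A A) {P : PsiDO A} {N : ℤ} (hP : OrdLE P N) (b : A)
    (q : ℤ) (t : ℕ) :
    (comp d P (mono b q)).coeff (N + q - t) = ∑ x ∈ antidiagonal t,
      ((Ring.choose (N - x.1) x.2 : ℤ) : A) * (P.coeff (N - x.1) * d^[x.2] b) := by
  rw [comp_coeff_eq_sum d hP (ordLE_mono b q)]
  refine Finset.sum_congr rfl fun x _ => ?_
  rw [Finset.sum_eq_single (x.2, 0)]
  · simp [mono]
  · rintro ⟨u, v⟩ hy hne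
    rw [mem_antidiagonal] at hy
    have hv : v ≠ 0 := by
      rintro rfl
      exact hne (by simp_all)
    rw [mono_coeff_of_ne _ (by dsimp; omega), iterate_zero_of_derivation, mul_zero, mul_zero]
  · intro h
    simp at h

theorem mono_comp_coeff (d : Derivation ℚ A A) {R : PsiDO A} {M : ℤ} (hR : OrdLE R M) (a : A)
    (p : ℤ) (t : ℕ) :
    (comp d (mono a p) R).coeff (p + M - t) = ∑ y ∈ antidiagonal t,
      ((Ring.choose p y.1 : ℤ) : A) * (a * d^[y.1] (R.coeff (M - y.2))) := by
  rw [comp_coeff_eq_sum d (ordLE_mono a p) hR, Finset.sum_eq_single (0, t)]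
  · simp [mono]
  · rintro ⟨u, v⟩ hy hne
    rw [mem_antidiagonal] at hy
    have hv : u ≠ 0 := by
      rintro rfl
      exact hne (by simp_all)
    refine Finset.sum_eq_zero fun y _ => ?_
    rw [mono_coeff_of_ne _ (by dsimp; omega), zero_mul, mul_zero]
  · intro h
    simp at h

theorem mono_comp_mono_coeff (d : Derivation ℚ A A) (a b : A) (p q : ℤ) (t : ℕ) :
    (comp d (mono a p) (mono b q)).coeff (p + q - t) =
      ((Ring.choose p t : ℤ) : A) * (a * d^[t] b) := by
  rw [mono_comp_coeff d (ordLE_mono b q), Finset.sum_eq_single (t, 0)]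
  · simp [mono]
  · rintro ⟨u, v⟩ hy hne
    rw [mem_antidiagonal] at hy
    have hv : v ≠ 0 := by
      rintro rfl
      exact hne (by simp_all)
    rw [mono_coeff_of_ne _ (by dsimp; omega), iterate_zero_of_derivation, mul_zero, mul_zero]
  · intro h
    simp at h

/-- Regrouping a sum over triples `(u, v, w)` with `u + v + w = t`. -/
theorem sum_antidiagonal_assoc {B : Type*} [AddCommMonoid B] (t : ℕ) (f : ℕ → ℕ → ℕ → B) :
    ∑ x ∈ antidiagonal t, ∑ y ∈ antidiagonal x.2, f x.1 y.1 y.2 =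
      ∑ x ∈ antidiagonal t, ∑ y ∈ antidiagonal x.1, f y.1 y.2 x.2 := by
  rw [Finset.sum_sigma', Finset.sum_sigma']
  refine Finset.sum_nbij' (fun z => ⟨(z.1.1 + z.2.1, z.2.2), (z.1.1, z.2.1)⟩)
    (fun z => ⟨(z.2.1, z.2.2 + z.1.2), (z.2.2, z.1.2)⟩) ?_ ?_ ?_ ?_ ?_
  · rintro ⟨⟨a, b⟩, ⟨e, f⟩⟩ h
    simp only [Finset.mem_sigma, mem_antidiagonal, and_true] at h ⊢
    omega
  · rintro ⟨⟨a, b⟩, ⟨e, f⟩⟩ h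
    simp only [Finset.mem_sigma, mem_antidiagonal, and_true] at h ⊢
    omega
  · rintro ⟨⟨a, b⟩, ⟨e, f⟩⟩ h
    simp only [Finset.mem_sigma, mem_antidiagonal] at h
    obtain ⟨h1, rfl⟩ := h
    rfl
  · rintro ⟨⟨a, b⟩, ⟨e, f⟩⟩ h
    simp only [Finset.mem_sigma, mem_antidiagonal] at h
    obtain ⟨h1, rfl⟩ := h
    rfl
  · rintro ⟨⟨a, b⟩, ⟨e, f⟩⟩ h
    rfl

/-- Associativity on monomials amounts to the Chu–Vandermonde identity. -/
theorem comp_assoc_mono (d : Derivation ℚ A A) (a b c : A) (p q r : ℤ) :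
    comp d (comp d (mono a p) (mono b q)) (mono c r) =
      comp d (mono a p) (comp d (mono b q) (mono c r)) := by
  have h1 := comp_coeff_eq_zero d (ordLE_mono a p) (ordLE_mono b q)
  have h2 := comp_coeff_eq_zero d (ordLE_mono b q) (ordLE_mono c r)
  ext k
  rcases lt_or_ge (p + q + r) k with hk | hk
  · rw [comp_coeff_eq_zero d h1 (ordLE_mono c r) k hk,
      comp_coeff_eq_zero d (ordLE_mono a p) h2 k (by omega)]
  obtain ⟨t, rfl⟩ : ∃ t : ℕ, k = p + q + r - t := ⟨(p + q + r - k).toNat, by omega⟩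
  rw [comp_mono_coeff d h1, show p + q + r - t = p + (q + r) - t by ring, mono_comp_coeff d h2]
  have hL : ∀ x ∈ antidiagonal t,
      ((Ring.choose (p + q - (x.1 : ℤ)) x.2 : ℤ) : A) *
        ((comp d (mono a p) (mono b q)).coeff (p + q - x.1) * d^[x.2] c) =
      ∑ y ∈ antidiagonal x.2, ((Ring.choose p x.1 * (Ring.choose (p - x.1) y.1 *
        Ring.choose q y.2) : ℤ) : A) * (a * d^[x.1] b * d^[y.1 + y.2] c) := by
    intro x _
    rw [mono_comp_mono_coeff, show p + q - (x.1 : ℤ) = (p - x.1) + q by ring,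
      Ring.add_choose_eq _ (Commute.all _ _), Int.cast_sum, Finset.sum_mul]
    refine Finset.sum_congr rfl fun y hy => ?_
    rw [mem_antidiagonal.mp hy]
    push_cast
    ring
  have hR : ∀ y ∈ antidiagonal t,
      ((Ring.choose p y.1 : ℤ) : A) *
        (a * d^[y.1] ((comp d (mono b q) (mono c r)).coeff (q + r - y.2))) =
      ∑ x ∈ antidiagonal y.1, ((Ring.choose p x.1 * (Ring.choose (p - x.1) x.2 *
        Ring.choose q y.2) : ℤ) : A) * (a * d^[x.1] b * d^[x.2 + y.2] c) := by
    intro y _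
    rw [mono_comp_mono_coeff, iterate_intCast_mul, iterate_mul_of_derivation, Finset.mul_sum,
      Finset.mul_sum, Finset.mul_sum]
    refine Finset.sum_congr rfl fun x hx => ?_
    rw [mem_antidiagonal] at hx
    have key := Ring.choose_smul_choose p (show x.1 ≤ y.1 by omega)
    rw [show y.1 - x.1 = x.2 by omega, nsmul_eq_mul] at key
    rw [← mul_assoc (Ring.choose p x.1), ← key, Function.iterate_add_apply]
    push_cast
    ring
  rw [Finset.sum_congr rfl hL, Finset.sum_congr rfl hR]
  exact sum_antidiagonal_assoc t fun u v w => ((Ring.choose p u * (Ring.choose (p - u) v *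
        Ring.choose q w) : ℤ) : A) * (a * d^[u] b * d^[v + w] c)

/-- Every operator is a finite sum of monomials up to an operator of small order. -/
theorem exists_truncation (P : PsiDO A) (m : ℤ) : ∃ (s : Finset ℤ) (R : PsiDO A),
    OrdLE R m ∧ P = ∑ p ∈ s, mono (P.coeff p) p + R := by
  obtain ⟨N, hN⟩ := P.exists_ordLE
  refine ⟨Finset.Ioc m N, P - ∑ p ∈ Finset.Ioc m N, mono (P.coeff p) p, fun k hk => ?_,
    by abel⟩
  rw [coeff_sub, coeff_sum]
  rcases lt_or_ge N k with h | h
  · rw [hN k h, Finset.sum_eq_zero, sub_zero]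
    intro p hp
    exact mono_coeff_of_ne _ (by have := (Finset.mem_Ioc.mp hp).2; omega)
  · rw [Finset.sum_eq_single k, mono_coeff_self, sub_self]
    · exact fun p _ hp => mono_coeff_of_ne _ (Ne.symm hp)
    · exact fun hn => absurd (Finset.mem_Ioc.mpr ⟨hk, h⟩) hn

theorem comp_zero_left (d : Derivation ℚ A A) (R : PsiDO A) : comp d 0 R = 0 := by
  simpa using comp_add_left d 0 0 R

theorem comp_zero_right (d : Derivation ℚ A A) (P : PsiDO A) : comp d P 0 = 0 := by
  simpa using comp_add_right d P 0 0

theorem comp_assoc (d : Derivation ℚ A A) (P Q R : PsiDO A) :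
    comp d (comp d P Q) R = comp d P (comp d Q R) := by
  -- The associator is additive in each argument and vanishes on monomials.
  let assoc : PsiDO A → PsiDO A → PsiDO A → PsiDO A := fun P Q R =>
    comp d (comp d P Q) R - comp d P (comp d Q R)
  have a1 : ∀ P P' Q R, assoc (P + P') Q R = assoc P Q R + assoc P' Q R := by
    intro P P' Q R
    simp only [assoc, comp_add_left]
    abel
  have a2 : ∀ P Q Q' R, assoc P (Q + Q') R = assoc P Q R + assoc P Q' R := by
    intro P Q Q' R
    simp only [assoc, comp_add_left, comp_add_right]
    abel
  have a3 : ∀ P Q R R', assoc P Q (R + R') = assoc P Q R + assoc P Q R' := by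
    intro P Q R R'
    simp only [assoc, comp_add_right]
    abel
  have z1 : ∀ Q R, assoc 0 Q R = 0 := fun Q R => by simpa using a1 0 0 Q R
  have z2 : ∀ P R, assoc P 0 R = 0 := fun P R => by simpa using a2 P 0 0 R
  have z3 : ∀ P Q, assoc P Q 0 = 0 := fun P Q => by simpa using a3 P Q 0 0
  have s1 : ∀ (s : Finset ℤ) (f : ℤ → PsiDO A) Q R, (∀ p ∈ s, assoc (f p) Q R = 0) →
      assoc (∑ p ∈ s, f p) Q R = 0 := fun s f Q R h =>
    Finset.sum_induction f (fun X => assoc X Q R = 0)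
      (fun X Y hX hY => by rw [a1, hX, hY, add_zero]) (z1 Q R) h
  have s2 : ∀ (s : Finset ℤ) (f : ℤ → PsiDO A) P R, (∀ p ∈ s, assoc P (f p) R = 0) →
      assoc P (∑ p ∈ s, f p) R = 0 := fun s f P R h =>
    Finset.sum_induction f (fun X => assoc P X R = 0)
      (fun X Y hX hY => by rw [a2, hX, hY, add_zero]) (z2 P R) h
  have s3 : ∀ (s : Finset ℤ) (f : ℤ → PsiDO A) P Q, (∀ p ∈ s, assoc P Q (f p) = 0) →
      assoc P Q (∑ p ∈ s, f p) = 0 := fun s f P Q h =>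
    Finset.sum_induction f (fun X => assoc P Q X = 0)
      (fun X Y hX hY => by rw [a3, hX, hY, add_zero]) (z3 P Q) h
  have ord : ∀ {P Q R : PsiDO A} {N M K : ℤ}, OrdLE P N → OrdLE Q M → OrdLE R K →
      OrdLE (assoc P Q R) (N + M + K) := fun hP hQ hR =>
    (comp_coeff_eq_zero d (comp_coeff_eq_zero d hP hQ) hR).sub
      ((comp_coeff_eq_zero d hP (comp_coeff_eq_zero d hQ hR)).mono (by omega))
  have b3 : ∀ a p b q R, assoc (mono a p) (mono b q) R = 0 := by
    intro a p b q R
    refine eq_zero_of_ordLE 0 fun j => ?_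
    obtain ⟨s, R', hR', hRe⟩ := exists_truncation R (-j - p - q)
    rw [hRe, a3, s3 _ _ _ _ fun r _ => sub_eq_zero.mpr (comp_assoc_mono d _ _ _ _ _ _), zero_add]
    exact (ord (ordLE_mono a p) (ordLE_mono b q) hR').mono (by omega)
  have b2 : ∀ a p Q R, assoc (mono a p) Q R = 0 := by
    intro a p Q R
    obtain ⟨K, hK⟩ := R.exists_ordLE
    refine eq_zero_of_ordLE 0 fun j => ?_
    obtain ⟨s, Q', hQ', hQe⟩ := exists_truncation Q (-j - p - K)
    rw [hQe, a2, s2 _ _ _ _ fun q _ => b3 _ _ _ _ _, zero_add]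
    exact (ord (ordLE_mono a p) hQ' hK).mono (by omega)
  obtain ⟨M, hM⟩ := Q.exists_ordLE
  obtain ⟨K, hK⟩ := R.exists_ordLE
  refine sub_eq_zero.mp (?_ : assoc P Q R = 0)
  refine eq_zero_of_ordLE 0 fun j => ?_
  obtain ⟨s, P', hP', hPe⟩ := exists_truncation P (-j - M - K)
  rw [hPe, a1, s1 _ _ _ _ fun p _ => b2 _ _ _ _, zero_add]
  exact (ord hP' hM hK).mono (by omega)

end PsiDO

end

section

variable {A : Type u} [CommRing A] [Algebra ℚ A]

namespace PsiDO

theorem ordLE_dPow (q : ℤ) : OrdLE (dPow A q) q := ordLE_mono 1 q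

theorem one_comp (d : Derivation ℚ A A) (R : PsiDO A) : comp d (dPow A 0) R = R := by
  obtain ⟨M, hM⟩ := R.exists_ordLE
  ext k
  rcases lt_or_ge M k with hk | hk
  · rw [hM k hk, comp_coeff_eq_zero d (ordLE_dPow 0) hM k (by omega)]
  obtain ⟨t, rfl⟩ : ∃ t : ℕ, k = 0 + M - t := ⟨(M - k).toNat, by omega⟩
  change (comp d (mono 1 0) R).coeff _ = _
  rw [mono_comp_coeff d hM, Finset.sum_eq_single (0, t)]
  · simp
  · rintro ⟨u, v⟩ hy hne
    rw [mem_antidiagonal] at hy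
    have hu : 0 < u := by
      rcases Nat.eq_zero_or_pos u with rfl | h
      · exact absurd (by simp_all) hne
      · exact h
    rw [Ring.choose_zero_pos ℤ hu]
    simp
  · intro h
    simp at h

theorem comp_dPow_coeff (d : Derivation ℚ A A) (P : PsiDO A) (q k : ℤ) :
    (comp d P (dPow A q)).coeff k = P.coeff (k - q) := by
  obtain ⟨N, hN⟩ := P.exists_ordLE
  rcases lt_or_ge (N + q) k with hk | hk
  · rw [hN _ (by omega), comp_coeff_eq_zero d hN (ordLE_dPow q) k hk]
  obtain ⟨t, rfl⟩ : ∃ t : ℕ, k = N + q - t := ⟨(N + q - k).toNat, by omega⟩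
  change (comp d P (mono 1 q)).coeff _ = _
  rw [comp_mono_coeff d hN, Finset.sum_eq_single (t, 0)]
  · simp only [Ring.choose_zero_right, Int.cast_one, Function.iterate_zero, id, mul_one, one_mul]
    congr 1
    ring
  · rintro ⟨u, v⟩ hy hne
    rw [mem_antidiagonal] at hy
    have hv : v ≠ 0 := by
      rintro rfl
      exact hne (by simp_all)
    rw [iterate_one_of_derivation d hv, mul_zero, mul_zero]
  · intro h
    simp at h

theorem comp_one (d : Derivation ℚ A A) (P : PsiDO A) : comp d P (dPow A 0) = P := by
  ext k
  rw [comp_dPow_coeff, sub_zero]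

end PsiDO

open PsiDO

/-! ### The ring of operators attached to a derivation -/

/-- The type of pseudo-differential operators, as a ring under the composition
determined by the derivation `d`. -/
def Psi (_ : Derivation ℚ A A) : Type u := PsiDO A

namespace Psi

variable {d : Derivation ℚ A A}

noncomputable instance : Ring (Psi d) :=
  { (inferInstance : AddCommGroup (PsiDO A)) with
    mul := comp d
    one := dPow A 0
    left_distrib := comp_add_right d
    right_distrib := comp_add_left d
    zero_mul := comp_zero_left d
    mul_zero := comp_zero_right d
    mul_assoc := comp_assoc d
    one_mul := one_comp d
    mul_one := comp_one d }

/-- An operator as an element of the ring `Psi d`. -/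
def of (d : Derivation ℚ A A) (P : PsiDO A) : Psi d := P

/-- The power `∂^q` as an element of the ring `Psi d`. -/
def dp (d : Derivation ℚ A A) (q : ℤ) : Psi d := dPow A q

/-- The monomial `a ∂^p` as an element of the ring `Psi d`. -/
def mon (d : Derivation ℚ A A) (a : A) (p : ℤ) : Psi d := PsiDO.mono a p

/-- The operator of multiplication by `a`. -/
def const (d : Derivation ℚ A A) (a : A) : Psi d := mono a 0

/-- The coefficient of `∂^k`. -/
def coeff (P : Psi d) (k : ℤ) : A := PsiDO.coeff P k

/-- `P` has order at most `N`. -/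
def OrdLE (P : Psi d) (N : ℤ) : Prop := PsiDO.OrdLE P N

@[ext] theorem ext {P R : Psi d} (h : ∀ k, coeff P k = coeff R k) : P = R :=
  PsiDO.ext (funext h)

@[simp] theorem coeff_zero (k : ℤ) : coeff (0 : Psi d) k = 0 := rfl
@[simp] theorem coeff_add (P R : Psi d) (k : ℤ) : coeff (P + R) k = coeff P k + coeff R k := rfl
@[simp] theorem coeff_neg (P : Psi d) (k : ℤ) : coeff (-P) k = -coeff P k := rfl
@[simp] theorem coeff_sub (P R : Psi d) (k : ℤ) : coeff (P - R) k = coeff P k - coeff R k := rfl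
theorem coeff_dp (q k : ℤ) : coeff (dp d q) k = if k = q then 1 else 0 := rfl
theorem coeff_one (k : ℤ) : coeff (1 : Psi d) k = if k = 0 then 1 else 0 := rfl
theorem coeff_mon (a : A) (p k : ℤ) : coeff (mon d a p) k = if k = p then a else 0 := rfl
theorem dp_zero : dp d 0 = 1 := rfl

theorem coeff_sum {ι : Type*} (s : Finset ι) (f : ι → Psi d) (k : ℤ) :
    coeff (∑ i ∈ s, f i) k = ∑ i ∈ s, coeff (f i) k :=
  map_sum (coeffHom k : PsiDO A →+ A) f s

theorem coeff_nsmul (n : ℕ) (P : Psi d) (k : ℤ) : coeff (n • P) k = n • coeff P k :=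
  map_nsmul (coeffHom k : PsiDO A →+ A) n P

theorem exists_ordLE (P : Psi d) : ∃ N, OrdLE P N := P.bddAbove

theorem OrdLE.mono {P : Psi d} {N M : ℤ} (h : OrdLE P N) (hNM : N ≤ M) : OrdLE P M :=
  PsiDO.OrdLE.mono h hNM

theorem OrdLE.add {P R : Psi d} {N : ℤ} (hP : OrdLE P N) (hR : OrdLE R N) : OrdLE (P + R) N :=
  PsiDO.OrdLE.add hP hR

theorem OrdLE.sub {P R : Psi d} {N : ℤ} (hP : OrdLE P N) (hR : OrdLE R N) : OrdLE (P - R) N :=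
  PsiDO.OrdLE.sub hP hR

theorem OrdLE.neg {P : Psi d} {N : ℤ} (hP : OrdLE P N) : OrdLE (-P) N :=
  PsiDO.OrdLE.neg hP

theorem ordLE_zero (N : ℤ) : OrdLE (0 : Psi d) N := fun _ _ => rfl

theorem ordLE_dp (q : ℤ) : OrdLE (dp d q) q := ordLE_mono 1 q

theorem ordLE_mon (a : A) (p : ℤ) : OrdLE (mon d a p) p := ordLE_mono a p

theorem ordLE_one : OrdLE (1 : Psi d) 0 := ordLE_mono 1 0

theorem OrdLE.coeff_eq_zero {P : Psi d} {N : ℤ} (h : OrdLE P N) {k : ℤ} (hk : N < k) :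
    coeff P k = 0 := h k hk

theorem OrdLE.pred {P : Psi d} {N : ℤ} (hP : OrdLE P N) (h0 : coeff P N = 0) :
    OrdLE P (N - 1) := PsiDO.OrdLE.pred hP h0

theorem eq_zero_of_ordLE {P : Psi d} (N : ℤ) (h : ∀ j : ℕ, OrdLE P (N - j)) : P = 0 :=
  PsiDO.eq_zero_of_ordLE N h

theorem OrdLE.mul {P R : Psi d} {N M : ℤ} (hP : OrdLE P N) (hR : OrdLE R M) :
    OrdLE (P * R) (N + M) := comp_coeff_eq_zero d hP hR

theorem coeff_mul_sub {P R : Psi d} {N M : ℤ} (hP : OrdLE P N) (hR : OrdLE R M) (t : ℕ) :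
    coeff (P * R) (N + M - t) =
      ∑ x ∈ antidiagonal t, ∑ y ∈ antidiagonal x.2, ((Ring.choose (N - x.1) y.1 : ℤ) : A) *
        (coeff P (N - x.1) * d^[y.1] (coeff R (M - y.2))) :=
  comp_coeff_eq_sum d hP hR t

theorem coeff_mul_top {P R : Psi d} {N M : ℤ} (hP : OrdLE P N) (hR : OrdLE R M) :
    coeff (P * R) (N + M) = coeff P N * coeff R M := by
  simpa using coeff_mul_sub hP hR 0

theorem coeff_mul_dp (P : Psi d) (q k : ℤ) : coeff (P * dp d q) k = coeff P (k - q) :=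
  comp_dPow_coeff d P q k

theorem dp_mul_dp (p q : ℤ) : dp d p * dp d q = dp d (p + q) := by
  ext k
  rw [coeff_mul_dp, coeff_dp, coeff_dp]
  exact if_congr (by omega) rfl rfl

theorem dp_one_pow (i : ℕ) : dp d 1 ^ i = dp d i := by
  induction i with
  | zero => rfl
  | succ i ih => rw [pow_succ, ih, dp_mul_dp]; push_cast; rfl

theorem ordLE_const (a : A) : OrdLE (const d a) 0 := ordLE_mono a 0

theorem coeff_const_mul (a : A) (R : Psi d) (k : ℤ) : coeff (const d a * R) k = a * coeff R k := by
  obtain ⟨M, hM⟩ := R.exists_ordLE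
  rcases lt_or_ge M k with hk | hk
  · rw [hM.coeff_eq_zero hk, OrdLE.coeff_eq_zero (OrdLE.mul (ordLE_const a) hM) (by omega),
      mul_zero]
  obtain ⟨t, rfl⟩ : ∃ t : ℕ, k = 0 + M - t := ⟨(M - k).toNat, by omega⟩
  refine (mono_comp_coeff d hM a 0 t).trans ?_
  rw [Finset.sum_eq_single (0, t)]
  · simp [coeff]
  · rintro ⟨u, v⟩ hy hne
    rw [mem_antidiagonal] at hy
    have hu : 0 < u := by
      rcases Nat.eq_zero_or_pos u with rfl | h
      · exact absurd (by simp_all) hne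
      · exact h
    rw [Ring.choose_zero_pos ℤ hu]
    simp
  · intro h
    simp at h

theorem coeff_dp_one_mul (R : Psi d) (k : ℤ) :
    coeff (dp d 1 * R) k = coeff R (k - 1) + d (coeff R k) := by
  obtain ⟨M, hM⟩ := R.exists_ordLE
  rcases lt_or_ge (1 + M) k with hk | hk
  · rw [hM.coeff_eq_zero (show M < k - 1 by omega), hM.coeff_eq_zero (show M < k by omega),
      OrdLE.coeff_eq_zero (OrdLE.mul (ordLE_dp 1) hM) (by omega), map_zero, add_zero]
  obtain ⟨t, rfl⟩ : ∃ t : ℕ, k = 1 + M - t := ⟨(1 + M - k).toNat, by omega⟩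
  refine (mono_comp_coeff d hM 1 1 t).trans ?_
  have hch : ∀ u : ℕ, Ring.choose (1 : ℤ) (u + 2) = 0 := fun u => by
    simpa [Nat.choose_eq_zero_of_lt] using Ring.choose_natCast (R := ℤ) 1 (u + 2)
  rcases t with _ | t
  · rw [hM.coeff_eq_zero (show M < 1 + M - ((0 : ℕ) : ℤ) by omega), map_zero, add_zero]
    simp [coeff]
  · rw [Finset.Nat.antidiagonal_succ, Finset.sum_cons, Finset.sum_map]
    rcases t with _ | t
    · simp [coeff]
    · rw [Finset.Nat.antidiagonal_succ, Finset.sum_cons, Finset.sum_map, Finset.sum_eq_zero]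
      · simp only [Function.Embedding.prodMap, Function.Embedding.coeFn_mk, Prod.map,
          Function.Embedding.refl_apply, Ring.choose_zero_right, coeff]
        simp only [Nat.succ_eq_add_one, zero_add, Ring.choose_one_right, Function.iterate_one,
          Function.iterate_zero, id, Int.cast_one, one_mul, add_zero]
        congr 2
        · push_cast; ring
        · congr 1; push_cast; ring
      · intro x _
        simp only [Function.Embedding.prodMap, Function.Embedding.coeFn_mk, Prod.map,
          Function.Embedding.refl_apply, Nat.succ_eq_add_one]
        rw [show x.1 + 1 + 1 = x.1 + 2 from rfl, hch]
        simp

theorem pow_eq (P : PsiDO A) (i : ℕ) : PsiDO.pow d P i = of d P ^ i := by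
  induction i with
  | zero => rfl
  | succ i ih =>
    rw [pow_succ, ← ih]
    rfl

/-! ### Derivations acting on the coefficients -/

/-- The derivation `δ` applied to the coefficients of an operator. -/
def der (δ : Derivation ℚ A A) (P : Psi d) : Psi d := PsiDO.deriv δ P

@[simp] theorem coeff_der (δ : Derivation ℚ A A) (P : Psi d) (k : ℤ) :
    coeff (der δ P) k = δ (coeff P k) := rfl

theorem der_add (δ : Derivation ℚ A A) (P R : Psi d) : der δ (P + R) = der δ P + der δ R := by
  ext k; simp

theorem der_sub (δ : Derivation ℚ A A) (P R : Psi d) : der δ (P - R) = der δ P - der δ R := by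
  ext k; simp

theorem OrdLE.der {P : Psi d} {N : ℤ} (hP : OrdLE P N) (δ : Derivation ℚ A A) :
    OrdLE (der δ P) N := fun k hk => by
  change δ (coeff P k) = 0
  rw [hP.coeff_eq_zero hk, map_zero]

theorem der_dp (δ : Derivation ℚ A A) (q : ℤ) : der δ (dp d q) = 0 := by
  ext k
  rw [coeff_der, coeff_dp]
  split_ifs <;> simp

theorem iterate_comm {δ : Derivation ℚ A A} (h : ∀ a, δ (d a) = d (δ a)) (l : ℕ) (a : A) :
    δ (d^[l] a) = d^[l] (δ a) := by
  induction l generalizing a with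
  | zero => rfl
  | succ l ih => rw [Function.iterate_succ_apply, ih, h, Function.iterate_succ_apply]

theorem der_mul {δ : Derivation ℚ A A} (h : ∀ a, δ (d a) = d (δ a)) (P R : Psi d) :
    der δ (P * R) = der δ P * R + P * der δ R := by
  obtain ⟨N, hN⟩ := P.exists_ordLE
  obtain ⟨M, hM⟩ := R.exists_ordLE
  ext k
  rw [coeff_der, coeff_add]
  rcases lt_or_ge (N + M) k with hk | hk
  · rw [(hN.mul hM).coeff_eq_zero hk, ((hN.der δ).mul hM).coeff_eq_zero hk,
      (hN.mul (hM.der δ)).coeff_eq_zero hk, map_zero, add_zero]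
  obtain ⟨t, rfl⟩ : ∃ t : ℕ, k = N + M - t := ⟨(N + M - k).toNat, by omega⟩
  rw [coeff_mul_sub hN hM, coeff_mul_sub (hN.der δ) hM, coeff_mul_sub hN (hM.der δ), map_sum,
    ← Finset.sum_add_distrib]
  refine Finset.sum_congr rfl fun x _ => ?_
  rw [map_sum, ← Finset.sum_add_distrib]
  refine Finset.sum_congr rfl fun y _ => ?_
  simp only [Derivation.leibniz, smul_eq_mul, coeff_der, iterate_comm h, Derivation.map_intCast,
    mul_zero, add_zero]
  ring

/-! ### Differential operators -/

/-- `P` is a differential operator. -/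
def IsDiff (P : Psi d) : Prop := ∀ k < 0, coeff P k = 0

theorem IsDiff.add {P R : Psi d} (hP : IsDiff P) (hR : IsDiff R) : IsDiff (P + R) :=
  fun k hk => by rw [coeff_add, hP k hk, hR k hk, add_zero]

theorem IsDiff.sub {P R : Psi d} (hP : IsDiff P) (hR : IsDiff R) : IsDiff (P - R) :=
  fun k hk => by rw [coeff_sub, hP k hk, hR k hk, sub_zero]

theorem IsDiff.mul {P R : Psi d} (hP : IsDiff P) (hR : IsDiff R) : IsDiff (P * R) := by
  intro k hk
  refine finsum_eq_zero_of_forall_eq_zero fun pl => ?_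
  obtain ⟨p, l⟩ := pl
  rcases lt_or_ge p 0 with h | h
  · rw [show PsiDO.coeff P p = 0 from hP p h, zero_mul, mul_zero]
  obtain ⟨m, rfl⟩ := Int.eq_ofNat_of_zero_le h
  rcases lt_or_ge m l with hl | hl
  · have := Ring.choose_natCast (R := ℤ) m l
    rw [Nat.choose_eq_zero_of_lt hl] at this
    dsimp only
    rw [show ((Ring.choose (m : ℤ) l : ℤ) : A) = 0 by rw [this]; simp, zero_mul]
  · rw [show PsiDO.coeff R (k - m + l) = 0 from hR _ (by omega), iterate_zero_of_derivation,
      mul_zero, mul_zero]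

theorem IsDiff.der {P : Psi d} (hP : IsDiff P) (δ : Derivation ℚ A A) : IsDiff (der δ P) :=
  fun k hk => by rw [coeff_der, hP k hk, map_zero]

theorem isDiff_dp (i : ℕ) : IsDiff (dp d i) := fun k hk => if_neg (by omega)

theorem isDiff_const (a : A) : IsDiff (const d a) := fun k hk => if_neg (by omega)

theorem isDiff_zero : IsDiff (0 : Psi d) := fun _ _ => rfl

/-- The differential part, as an element of `Psi d`. -/
def pl (P : Psi d) : Psi d := PsiDO.plus P

theorem coeff_pl (P : Psi d) (k : ℤ) : coeff (pl P) k = if 0 ≤ k then coeff P k else 0 := rfl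

theorem isDiff_pl (P : Psi d) : IsDiff (pl P) := fun k hk => if_neg (by omega)

theorem ordLE_sub_pl (P : Psi d) : OrdLE (P - pl P) (-1) := fun k hk => by
  change coeff (P - pl P) k = 0
  rw [coeff_sub, coeff_pl, if_pos (by omega), sub_self]

/-- The decomposition into a differential operator and an operator of negative order is unique. -/
theorem IsDiff.eq_pl {B P : Psi d} (hB : IsDiff B) (h : OrdLE (P - B) (-1)) : pl P = B := by
  ext k
  rw [coeff_pl]
  split_ifs with hk
  · have := h.coeff_eq_zero (show -1 < k by omega)
    rwa [coeff_sub, sub_eq_zero] at this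
  · exact (hB k (by omega)).symm

theorem IsDiff.pl_eq {P : Psi d} (hP : IsDiff P) : pl P = P :=
  hP.eq_pl (by rw [sub_self]; exact ordLE_zero _)

theorem IsDiff.eq_zero {P : Psi d} (hP : IsDiff P) (h : OrdLE P (-1)) : P = 0 := by
  ext k
  rcases lt_or_ge k 0 with hk | hk
  · exact hP k hk
  · exact h.coeff_eq_zero (by omega)

/-! ### Successive approximation, division and roots -/

/-- Constructing an operator one coefficient at a time. -/
theorem exists_of_steps (N : ℤ) (p : ℕ → Psi d → Prop) (h0 : ∃ X, p 0 X)
    (step : ∀ j X, p j X → ∃ X', p (j + 1) X' ∧ OrdLE (X' - X) (N - j)) :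
    ∃ Y, ∀ j : ℕ, ∃ X, p j X ∧ OrdLE (Y - X) (N - j) := by
  obtain ⟨X0, hX0⟩ := h0
  choose! F hF using step
  let X : ℕ → Psi d := fun j => Nat.rec X0 F j
  have hp : ∀ j, p j (X j) := fun j => by
    induction j with
    | zero => exact hX0
    | succ j ih => exact (hF j _ ih).1
  have hs : ∀ j, OrdLE (X (j + 1) - X j) (N - j) := fun j => (hF j _ (hp j)).2
  have hst : ∀ i j, OrdLE (X (j + i) - X j) (N - j) := fun i j => by
    induction i with
    | zero => rw [add_zero, sub_self]; exact ordLE_zero _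
    | succ i ih =>
      have := ((hs (j + i)).mono (show N - ((j + i : ℕ) : ℤ) ≤ N - j by push_cast; omega)).add ih
      rwa [sub_add_sub_cancel] at this
  obtain ⟨M, hM⟩ := X0.exists_ordLE
  refine ⟨(⟨fun k => coeff (X (N - k + 1).toNat) k, max M N, fun k hk => ?_⟩ : PsiDO A),
    fun j => ⟨X j, hp j, fun k hk => ?_⟩⟩
  · have h1 := hM.coeff_eq_zero (lt_of_le_of_lt (le_max_left _ _) hk)
    rwa [show (N - k + 1).toNat = 0 by have := lt_of_le_of_lt (le_max_right _ _) hk; omega]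
  · change coeff (X (N - k + 1).toNat) k - coeff (X j) k = 0
    rcases le_total j (N - k + 1).toNat with h | h
    · obtain ⟨i, hi⟩ := Nat.exists_eq_add_of_le h
      have := (hst i j).coeff_eq_zero hk
      rwa [← hi, coeff_sub] at this
    · obtain ⟨i, hi⟩ := Nat.exists_eq_add_of_le h
      have := (hst i (N - k + 1).toNat).coeff_eq_zero (k := k) (by omega)
      rw [← hi, coeff_sub] at this
      rw [← neg_sub, this, neg_zero]

/-- `W = 1 + (terms of negative order)`. -/
structure IsUnip (W : Psi d) : Prop where
  ordLE : OrdLE W 0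
  lead : coeff W 0 = 1

/-- Left multiples of `W = 1 + ⋯` exhaust all operators. -/
theorem IsUnip.exists_mul_eq {W : Psi d} (hW : IsUnip W) {Y : Psi d} {N : ℤ} (hY : OrdLE Y N) :
    ∃ X, OrdLE X N ∧ X * W = Y := by
  obtain ⟨X, hX⟩ := exists_of_steps N (fun j X => OrdLE (Y - X * W) (N - j) ∧ OrdLE X N)
    ⟨0, by simpa using ⟨hY, ordLE_zero N⟩⟩ (fun j X hX => by
      have hm : OrdLE (mon d (coeff (Y - X * W) (N - j)) (N - j)) (N - j) := ordLE_mon _ _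
      refine ⟨X + mon d (coeff (Y - X * W) (N - j)) (N - j), ⟨?_, ?_⟩, ?_⟩
      · have h1 := hm.mul hW.ordLE
        have h2 := coeff_mul_top hm hW.ordLE
        rw [add_zero] at h1 h2
        rw [add_mul, ← sub_sub, show N - ((j + 1 : ℕ) : ℤ) = N - j - 1 by push_cast; ring]
        refine (hX.1.sub h1).pred ?_
        rw [coeff_sub, h2, hW.lead, mul_one]
        rw [coeff_mon, if_pos rfl, sub_self]
      · exact hX.2.add (hm.mono (by omega))
      · rw [add_sub_cancel_left]
        exact hm)
  refine ⟨X, ?_, ?_⟩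
  · obtain ⟨X', ⟨_, h1⟩, h2⟩ := hX 0
    have := (h2.mono (show N - ((0 : ℕ) : ℤ) ≤ N by simp)).add h1
    rwa [sub_add_cancel] at this
  · refine (sub_eq_zero.mp (eq_zero_of_ordLE N fun j => ?_)).symm
    obtain ⟨X', ⟨h1, _⟩, h2⟩ := hX j
    have h3 := h2.mul hW.ordLE
    rw [add_zero] at h3
    have := h1.sub h3
    rwa [sub_mul, sub_sub, add_sub_cancel] at this

theorem IsUnip.eq_zero_of_mul {W : Psi d} (hW : IsUnip W) {X : Psi d} (h : X * W = 0) :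
    X = 0 := by
  obtain ⟨N, hN⟩ := X.exists_ordLE
  refine eq_zero_of_ordLE N fun j => ?_
  induction j with
  | zero => simpa using hN
  | succ j ih =>
    rw [show N - ((j + 1 : ℕ) : ℤ) = N - j - 1 by push_cast; ring]
    refine ih.pred ?_
    have := coeff_mul_top ih hW.ordLE
    rw [hW.lead, mul_one, h] at this
    rw [← this, coeff_zero]

theorem IsUnip.mul_right_cancel {W : Psi d} (hW : IsUnip W) {X Y : Psi d} (h : X * W = Y * W) :
    X = Y :=
  sub_eq_zero.mp (hW.eq_zero_of_mul (by rw [sub_mul, h, sub_self]))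

/-- An operator `∂ + q_0 + q_1 ∂^{-1} + ⋯`. -/
structure IsMonicOne (Q : Psi d) : Prop where
  ordLE : OrdLE Q 1
  lead : coeff Q 1 = 1

theorem IsMonicOne.pow {Q : Psi d} (hQ : IsMonicOne Q) (i : ℕ) :
    OrdLE (Q ^ i) i ∧ coeff (Q ^ i) i = 1 := by
  induction i with
  | zero => exact ⟨ordLE_one, rfl⟩
  | succ i ih =>
    rw [pow_succ]
    have h1 := ih.1.mul hQ.ordLE
    have h2 := coeff_mul_top ih.1 hQ.ordLE
    rw [ih.2, hQ.lead, one_mul] at h2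
    push_cast
    exact ⟨h1, h2⟩

/-- If `S_0 = 0` and `S_{i+1} = X^i Z + S_i Y` with `X`, `Y` monic of order one, then
the leading coefficient of `S_n` is `n` times that of `Z`, so `S_n = 0` forces `Z = 0`. This
applies to `S_n = X^n - Y^n` and to `S_n = δ (X^n)` for a derivation `δ`. -/
theorem eq_zero_of_telescope {X Y Z : Psi d} (hX : IsMonicOne X) (hY : IsMonicOne Y)
    {S : ℕ → Psi d} (h0 : S 0 = 0) (hS : ∀ i, S (i + 1) = X ^ i * Z + S i * Y) {n : ℕ}
    (hn : n ≠ 0) (hSn : S n = 0) : Z = 0 := by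
  obtain ⟨N, hN⟩ := Z.exists_ordLE
  have key : ∀ m, OrdLE Z m → ∀ i : ℕ, OrdLE (S i) (m + i - 1) ∧
      coeff (S i) (m + i - 1) = i * coeff Z m := fun m hm i => by
    induction i with
    | zero => rw [h0]; exact ⟨ordLE_zero _, by simp⟩
    | succ i ih =>
      have h1 := (hX.pow i).1.mul hm
      have h2 := coeff_mul_top (hX.pow i).1 hm
      have h3 := ih.1.mul hY.ordLE
      have h4 := coeff_mul_top ih.1 hY.ordLE
      rw [(hX.pow i).2, one_mul] at h2
      rw [ih.2, hY.lead, mul_one] at h4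
      have e1 : m + ((i + 1 : ℕ) : ℤ) - 1 = i + m := by push_cast; ring
      have e2 : m + (i : ℤ) - 1 + 1 = i + m := by ring
      rw [e2] at h3 h4
      rw [e1, hS, coeff_add, h2, h4]
      exact ⟨h1.add h3, by push_cast; ring⟩
  refine eq_zero_of_ordLE N fun j => ?_
  induction j with
  | zero => simpa using hN
  | succ j ih =>
    rw [show N - ((j + 1 : ℕ) : ℤ) = N - j - 1 by push_cast; ring]
    refine ih.pred ?_
    have h1 := (key _ ih n).2
    rw [hSn, coeff_zero] at h1
    have h2 : (n : ℚ) • coeff Z (N - j) = 0 := by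
      rw [Algebra.smul_def, map_natCast, ← h1]
    have hn' : (n : ℚ) ≠ 0 := Nat.cast_ne_zero.mpr hn
    rw [← inv_smul_smul₀ hn' (coeff Z (N - j)), h2, smul_zero]

theorem IsMonicOne.eq_of_pow_eq {X Y : Psi d} (hX : IsMonicOne X) (hY : IsMonicOne Y) {n : ℕ}
    (hn : n ≠ 0) (h : X ^ n = Y ^ n) : X = Y := by
  refine sub_eq_zero.mp (eq_zero_of_telescope hX hY (S := fun i => X ^ i - Y ^ i) (by simp)
    (fun i => ?_) hn (sub_eq_zero.mpr h))
  rw [pow_succ, pow_succ]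
  noncomm_ring

end Psi

end

section

open PowerSeries (derivative constantCoeff)

section Exp

variable {R : Type u} [CommRing R] [Algebra ℚ R]

theorem smul_right_injective_of_rat {q : ℚ} (hq : q ≠ 0) {a b : R} (h : q • a = q • b) : a = b := by
  rw [← inv_smul_smul₀ hq a, h, inv_smul_smul₀ hq b]

/-! ### Exponentials of formal power series -/

/-- The coefficients of the exponential of `∑ f_j κ^j`, by the recursion
`(j + 1) e_{j+1} = ∑_{l ≤ j} (l + 1) f_{l+1} e_{j-l}`. The value `f 0` is irrelevant. -/
noncomputable def expCoeff (f : ℕ → R) : ℕ → R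
  | 0 => 1
  | j + 1 => (1 / (j + 1 : ℚ)) •
      ∑ l : Fin (j + 1), ((l : ℕ) + 1 : ℚ) • (f (l + 1) * expCoeff f (j - l))

/-- The exponential of a formal power series with vanishing constant term (the constant term is
ignored): the solution of `E' = f' E` with constant term `1`. -/
noncomputable def expPS (f : PowerSeries R) : PowerSeries R :=
  PowerSeries.mk (expCoeff fun j => PowerSeries.coeff j f)

@[simp] theorem constantCoeff_expPS (f : PowerSeries R) : constantCoeff (expPS f) = 1 := by
  rw [expPS, PowerSeries.constantCoeff_mk, expCoeff]

@[simp] theorem coeff_zero_expPS (f : PowerSeries R) : PowerSeries.coeff 0 (expPS f) = 1 := by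
  rw [PowerSeries.coeff_zero_eq_constantCoeff, constantCoeff_expPS]

theorem expCoeff_succ (f : ℕ → R) (j : ℕ) : ((j : ℚ) + 1) • expCoeff f (j + 1) =
    ∑ x ∈ antidiagonal j, ((x.1 : ℚ) + 1) • (f (x.1 + 1) * expCoeff f x.2) := by
  have : (j : ℚ) + 1 ≠ 0 := by positivity
  rw [expCoeff, one_div, smul_inv_smul₀ this, Finset.Nat.sum_antidiagonal_eq_sum_range_succ_mk,
    Finset.sum_range]

theorem coeff_derivative_eq_smul (f : PowerSeries R) (j : ℕ) :
    PowerSeries.coeff j (derivative R f) = ((j : ℚ) + 1) • PowerSeries.coeff (j + 1) f := by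
  rw [PowerSeries.coeff_derivative, Algebra.smul_def, mul_comm]
  simp

theorem derivative_expPS (f : PowerSeries R) :
    derivative R (expPS f) = derivative R f * expPS f := by
  ext j
  rw [coeff_derivative_eq_smul, PowerSeries.coeff_mul, expPS, PowerSeries.coeff_mk, expCoeff_succ]
  refine Finset.sum_congr rfl fun x _ => ?_
  rw [coeff_derivative_eq_smul, PowerSeries.coeff_mk, smul_mul_assoc]

/-- Uniqueness for `E' = g E`. -/
theorem eq_zero_of_derivative_eq {E g : PowerSeries R} (h : derivative R E = g * E)
    (h0 : constantCoeff E = 0) : E = 0 := by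
  ext j
  induction j using Nat.strong_induction_on with
  | _ j ih =>
    rcases j with _ | j
    · simpa using h0
    · have := congrArg (PowerSeries.coeff j) h
      rw [coeff_derivative_eq_smul, PowerSeries.coeff_mul, Finset.sum_eq_zero] at this
      · refine smul_right_injective_of_rat (q := (j : ℚ) + 1) (by positivity) ?_
        rw [this, map_zero, smul_zero]
      · intro x hx
        rw [mem_antidiagonal] at hx
        rw [ih x.2 (by omega), map_zero, mul_zero]

theorem eq_expPS {E f : PowerSeries R} (h : derivative R E = derivative R f * E)
    (h0 : constantCoeff E = 1) : E = expPS f :=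
  sub_eq_zero.mp (eq_zero_of_derivative_eq (g := derivative R f)
    (by rw [map_sub, derivative_expPS, h, mul_sub]) (by simp [h0]))

theorem expPS_add (f g : PowerSeries R) : expPS (f + g) = expPS f * expPS g := by
  refine (eq_expPS ?_ (by simp)).symm
  rw [Derivation.leibniz, derivative_expPS, derivative_expPS, map_add, smul_eq_mul, smul_eq_mul]
  ring

@[simp] theorem expPS_zero : expPS (0 : PowerSeries R) = 1 :=
  (eq_expPS (by simp) (by simp)).symm

theorem expPS_mul_neg (f : PowerSeries R) : expPS f * expPS (-f) = 1 := by
  rw [← expPS_add, add_neg_cancel, expPS_zero]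

theorem isUnit_expPS (f : PowerSeries R) : IsUnit (expPS f) :=
  IsUnit.of_mul_eq_one _ (expPS_mul_neg f)

theorem eq_of_derivative_eq {f g : PowerSeries R} (h : derivative R f = derivative R g)
    (h0 : constantCoeff f = constantCoeff g) : f = g :=
  sub_eq_zero.mp (eq_zero_of_derivative_eq (g := 0) (by rw [map_sub, h, sub_self, zero_mul])
    (by rw [map_sub, h0, sub_self]))

theorem expPS_injective {f g : PowerSeries R} (h : expPS f = expPS g)
    (h0 : constantCoeff f = constantCoeff g) : f = g := by
  refine eq_of_derivative_eq ?_ h0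
  refine (isUnit_expPS f).mul_right_cancel ?_
  rw [← derivative_expPS, h, derivative_expPS]

theorem derivative_map {S : Type v} [CommRing S] [Algebra ℚ S] (φ : R →+* S) (f : PowerSeries R) :
    derivative S (PowerSeries.map φ f) = PowerSeries.map φ (derivative R f) := by
  ext j
  rw [PowerSeries.coeff_derivative, PowerSeries.coeff_map, PowerSeries.coeff_map,
    PowerSeries.coeff_derivative]
  simp

theorem map_expPS {S : Type v} [CommRing S] [Algebra ℚ S] (φ : R →+* S) (f : PowerSeries R) :
    PowerSeries.map φ (expPS f) = expPS (PowerSeries.map φ f) := by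
  refine eq_expPS ?_ ?_
  · rw [derivative_map, derivative_expPS, map_mul, derivative_map]
  · rw [← PowerSeries.coeff_zero_eq_constantCoeff_apply, PowerSeries.coeff_map]
    simp

/-- Every power series with constant term `1` is an exponential. -/
theorem exists_expPS_eq {E : PowerSeries R} (h0 : constantCoeff E = 1) :
    ∃ f, constantCoeff f = 0 ∧ expPS f = E := by
  obtain ⟨u, hu⟩ : IsUnit E :=
    PowerSeries.isUnit_iff_constantCoeff.mpr (by rw [h0]; exact isUnit_one)
  -- The logarithm is the primitive of the logarithmic derivative.
  let g : PowerSeries R := derivative R E * ↑u⁻¹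
  let f : PowerSeries R := PowerSeries.mk fun j =>
    (1 / (j : ℚ)) • (if j = 0 then 0 else PowerSeries.coeff (j - 1) g)
  have hf : derivative R f = g := by
    ext j
    have : (j : ℚ) + 1 ≠ 0 := by positivity
    rw [coeff_derivative_eq_smul, PowerSeries.coeff_mk, if_neg (Nat.succ_ne_zero j)]
    push_cast
    rw [one_div, smul_inv_smul₀ this]
  refine ⟨f, by simp [f], (eq_expPS ?_ h0).symm⟩
  rw [hf, mul_assoc, ← hu, Units.inv_mul, mul_one]

/-- A derivation of the ring of coefficients, applied to the coefficients of a power series. -/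
noncomputable def mapDer (δ : Derivation ℚ R R) : Derivation ℚ (PowerSeries R) (PowerSeries R) :=
  Derivation.mk'
    { toFun := fun f => PowerSeries.mk fun j => δ (PowerSeries.coeff j f)
      map_add' := fun f g => by ext j; simp
      map_smul' := fun q f => by
        ext j
        simp only [PowerSeries.coeff_mk, RingHom.id_apply]
        rw [PowerSeries.coeff_smul, PowerSeries.coeff_smul, Derivation.map_smul,
          PowerSeries.coeff_mk] }
    (fun f g => by
      ext j
      simp only [LinearMap.coe_mk, AddHom.coe_mk, PowerSeries.coeff_mk, PowerSeries.coeff_mul,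
        map_sum, Derivation.leibniz, smul_eq_mul, map_add, Finset.sum_add_distrib]
      congr 1
      exact Finset.Nat.sum_antidiagonal_swap (f := fun x => PowerSeries.coeff x.1 g *
        δ (PowerSeries.coeff x.2 f)))

@[simp] theorem coeff_mapDer (δ : Derivation ℚ R R) (f : PowerSeries R) (j : ℕ) :
    PowerSeries.coeff j (mapDer δ f) = δ (PowerSeries.coeff j f) :=
  PowerSeries.coeff_mk j fun j => δ (PowerSeries.coeff j f)

theorem derivative_mapDer (δ : Derivation ℚ R R) (f : PowerSeries R) :
    derivative R (mapDer δ f) = mapDer δ (derivative R f) := by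
  ext j
  rw [coeff_derivative_eq_smul, coeff_mapDer, coeff_mapDer, coeff_derivative_eq_smul,
    Derivation.map_smul]

theorem mapDer_expPS (δ : Derivation ℚ R R) {f : PowerSeries R} (h0 : constantCoeff f = 0) :
    mapDer δ (expPS f) = mapDer δ f * expPS f := by
  refine sub_eq_zero.mp (eq_zero_of_derivative_eq (g := derivative R f) ?_ ?_)
  · rw [map_sub, derivative_mapDer, derivative_expPS, Derivation.leibniz, Derivation.leibniz,
      derivative_mapDer, derivative_expPS]
    simp only [smul_eq_mul]
    ring
  · rw [map_sub, map_mul, ← PowerSeries.coeff_zero_eq_constantCoeff_apply,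
      ← PowerSeries.coeff_zero_eq_constantCoeff_apply, coeff_mapDer, coeff_mapDer,
      PowerSeries.coeff_zero_eq_constantCoeff_apply, PowerSeries.coeff_zero_eq_constantCoeff_apply,
      h0, constantCoeff_expPS]
    simp

/-! ### Sums over compositions -/

/-- Prepending a block to a composition. -/
def consComposition {j : ℕ} (x : Σ i : Fin (j + 1), Composition (j - i)) : Composition (j + 1) where
  blocks := ((x.1 : ℕ) + 1) :: x.2.blocks
  blocks_pos := by
    intro i hi
    rcases List.mem_cons.mp hi with rfl | h
    · exact Nat.succ_pos _
    · exact x.2.blocks_pos h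
  blocks_sum := by
    rw [List.sum_cons, x.2.blocks_sum]
    have := x.1.isLt
    omega

theorem consComposition_bijective (j : ℕ) : Function.Bijective (consComposition (j := j)) := by
  constructor
  · rintro ⟨i, c⟩ ⟨i', c'⟩ h
    have hb := congrArg Composition.blocks h
    simp only [consComposition, List.cons.injEq] at hb
    obtain rfl : i = i' := Fin.ext (by omega)
    rw [Composition.ext hb.2]
  · intro c
    obtain ⟨b, hpos, hsum⟩ := c
    rcases b with _ | ⟨i, b⟩
    · simp at hsum
    · have hi : 0 < i := hpos (by simp)
      rw [List.sum_cons] at hsum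
      refine ⟨⟨⟨i - 1, by omega⟩, ⟨b, fun h => hpos (by simp [h]), by dsimp only; omega⟩⟩, ?_⟩
      apply Composition.ext
      simp only [consComposition, List.cons.injEq, and_true]
      omega

theorem sum_composition_succ {B : Type*} [AddCommMonoid B] (j : ℕ) (F : List ℕ → B) :
    ∑ c : Composition (j + 1), F c.blocks =
      ∑ x ∈ antidiagonal j, ∑ c : Composition x.2, F ((x.1 + 1) :: c.blocks) := by
  rw [Finset.Nat.sum_antidiagonal_eq_sum_range_succ_mk, Finset.sum_range,
    ← Fintype.sum_bijective _ (consComposition_bijective j) (fun x => F (consComposition x).blocks)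
      (fun c => F c.blocks) (fun _ => rfl), Fintype.sum_sigma]
  rfl

theorem sum_composition_eq (f : ℕ → R) (g : ℕ → ℚ) (j M : ℕ) (hM : j ≤ M) :
    ∑ c : Composition j, g c.blocks.length • (c.blocks.map f).prod =
      ∑ m ∈ Finset.range (M + 1), g m • PowerSeries.coeff j
        ((PowerSeries.X * PowerSeries.mk fun i => f (i + 1)) ^ m) := by
  induction j using Nat.strong_induction_on generalizing g M with
  | _ j ih =>
    rcases j with _ | j
    · rw [Fintype.sum_eq_single (Composition.ones 0)
        fun c hc => absurd (Composition.ext (by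
          rw [c.blocks_eq_nil.mpr rfl, (Composition.ones 0).blocks_eq_nil.mpr rfl])) hc,
        Finset.sum_eq_single 0]
      · simp
      · intro m _ hm
        rw [PowerSeries.coeff_zero_eq_constantCoeff_apply, map_pow, map_mul]
        simp [hm]
      · intro h; simp at h
    · obtain ⟨M, rfl⟩ : ∃ M', M = M' + 1 := ⟨M - 1, by omega⟩
      rw [sum_composition_succ j fun b => g b.length • (b.map f).prod, Finset.sum_range_succ']
      have h1 : PowerSeries.coeff (j + 1)
        ((PowerSeries.X * PowerSeries.mk fun i => f (i + 1)) ^ 0) = 0 := by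
        simp [PowerSeries.coeff_one]
      rw [h1, smul_zero, add_zero]
      have h2 : ∀ x ∈ antidiagonal j, ∑ c : Composition x.2,
          g ((x.1 + 1) :: c.blocks).length • (((x.1 + 1) :: c.blocks).map f).prod =
          ∑ m ∈ Finset.range (M + 1), g (m + 1) • (f (x.1 + 1) * PowerSeries.coeff x.2
            ((PowerSeries.X * PowerSeries.mk fun i => f (i + 1)) ^ m)) := by
        intro x hx
        rw [mem_antidiagonal] at hx
        have := ih x.2 (by omega) (fun m => g (m + 1)) M (by omega)
        simp only [List.length_cons, List.map_cons, List.prod_cons, ← mul_smul_comm]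
        rw [← Finset.mul_sum, this, Finset.mul_sum]
      rw [Finset.sum_congr rfl h2, Finset.sum_comm]
      refine Finset.sum_congr rfl fun m _ => ?_
      rw [← Finset.smul_sum, pow_succ', mul_assoc, PowerSeries.coeff_succ_X_mul,
        PowerSeries.coeff_mul]
      simp

/-- The exponential as a sum over compositions:
`e_j = ∑_{r_1 + ⋯ + r_m = j} (1 / m!) f_{r_1} ⋯ f_{r_m}`. -/
theorem sum_composition_eq_expPS (f : ℕ → R) (j : ℕ) :
    ∑ c : Composition j, (1 / (c.blocks.length.factorial : ℚ)) • (c.blocks.map f).prod =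
      PowerSeries.coeff j (expPS (PowerSeries.mk f)) := by
  set F : PowerSeries R := PowerSeries.X * PowerSeries.mk fun i => f (i + 1) with hF
  let e : ℕ → PowerSeries R := fun M => ∑ m ∈ Finset.range (M + 1), (1 / (m.factorial : ℚ)) • F ^ m
  have hco : ∀ j M, j ≤ M →
      ∑ c : Composition j, (1 / (c.blocks.length.factorial : ℚ)) • (c.blocks.map f).prod =
      PowerSeries.coeff j (e M) := fun j M hM => by
    rw [sum_composition_eq f (fun m => 1 / (m.factorial : ℚ)) j M hM, map_sum]
    refine Finset.sum_congr rfl fun m _ => ?_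
    rw [PowerSeries.coeff_smul]
  have hder : ∀ M, derivative R (e (M + 1)) = derivative R F * e M := fun M => by
    simp only [e]
    rw [Finset.sum_range_succ', map_add, map_sum, pow_zero, Finset.mul_sum]
    have h1 : derivative R ((1 / (Nat.factorial 0 : ℚ)) • (1 : PowerSeries R)) = 0 := by simp
    rw [h1, add_zero]
    refine Finset.sum_congr rfl fun m _ => ?_
    have h2 : derivative R ((1 / ((m + 1).factorial : ℚ)) • F ^ (m + 1)) =
        (1 / ((m + 1).factorial : ℚ)) • derivative R (F ^ (m + 1)) := by
      ext j
      rw [coeff_derivative_eq_smul, PowerSeries.coeff_smul, PowerSeries.coeff_smul,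
        coeff_derivative_eq_smul, smul_comm]
    rw [h2, Derivation.leibniz_pow, Nat.add_sub_cancel, smul_eq_mul, Nat.factorial_succ,
      ← Nat.cast_smul_eq_nsmul ℚ, smul_smul, mul_smul_comm, mul_comm (F ^ m)]
    congr 1
    have : (m : ℚ) + 1 ≠ 0 := by positivity
    have h3 : (m.factorial : ℚ) ≠ 0 := by positivity
    push_cast
    field_simp
  let E : PowerSeries R := PowerSeries.mk fun j => PowerSeries.coeff j (e j)
  have hE : ∀ j M, j ≤ M → PowerSeries.coeff j E = PowerSeries.coeff j (e M) := fun j M h => by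
    rw [PowerSeries.coeff_mk, ← hco j j le_rfl, hco j M h]
  have hdF : derivative R F = derivative R (PowerSeries.mk f) := by
    ext j
    rw [coeff_derivative_eq_smul, coeff_derivative_eq_smul, hF, PowerSeries.coeff_succ_X_mul,
      PowerSeries.coeff_mk, PowerSeries.coeff_mk]
  rw [hco j j le_rfl, ← hE j j le_rfl, eq_expPS (E := E) (f := PowerSeries.mk f)]
  · ext j
    rw [coeff_derivative_eq_smul, hE (j + 1) (j + 1) le_rfl, ← coeff_derivative_eq_smul, hder, hdF,
      PowerSeries.coeff_mul, PowerSeries.coeff_mul]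
    refine Finset.sum_congr rfl fun x hx => ?_
    rw [mem_antidiagonal] at hx
    rw [hE x.2 j (by omega)]
  · rw [← PowerSeries.coeff_zero_eq_constantCoeff_apply, hE 0 0 le_rfl]
    simp [e]

end Exp

end

section

/-! ### Constant-coefficient operators in commuting derivations -/

/-- Polynomials in symbols `y_1, y_2, …`, standing for the derivations `∂_1, ∂_2, …`. -/
abbrev Ops : Type := MvPolynomial ℕ+ ℚ

section Act

variable {A : Type u} [CommRing A] [Algebra ℚ A]

/-- The action of `Ops` on `A` in which `y_i` acts as `∂_i`. -/
noncomputable def act (D : ℕ+ → Derivation ℚ A A) (hD : ∀ i j a, D i (D j a) = D j (D i a)) :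
    Ops →ₐ[ℚ] Module.End ℚ A :=
  haveI : IsMulCommutative (Algebra.adjoin ℚ (Set.range fun i => (D i : A →ₗ[ℚ] A))) :=
    Algebra.isMulCommutative_adjoin ℚ (by
      rintro _ ⟨i, rfl⟩ _ ⟨j, rfl⟩
      exact LinearMap.ext (hD i j))
  letI : CommRing (Algebra.adjoin ℚ (Set.range fun i => (D i : A →ₗ[ℚ] A))) :=
    { (inferInstance : Ring (Algebra.adjoin ℚ (Set.range fun i => (D i : A →ₗ[ℚ] A)))) with
      mul_comm := mul_comm' }
  (Algebra.adjoin ℚ (Set.range fun i => (D i : A →ₗ[ℚ] A))).val.comp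
    (MvPolynomial.aeval fun i => ⟨(D i : A →ₗ[ℚ] A), Algebra.subset_adjoin ⟨i, rfl⟩⟩)

variable {D : ℕ+ → Derivation ℚ A A} (hD : ∀ i j a, D i (D j a) = D j (D i a))

@[simp] theorem act_X (i : ℕ+) (a : A) : act D hD (MvPolynomial.X i) a = D i a := by
  simp [act]

theorem act_mul (p q : Ops) (a : A) : act D hD (p * q) a = act D hD p (act D hD q a) := by
  rw [map_mul]; rfl

theorem act_X_mul (i : ℕ+) (p : Ops) (a : A) :
    act D hD (MvPolynomial.X i * p) a = D i (act D hD p a) := by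
  rw [act_mul, act_X]

theorem act_comm (p q : Ops) (a : A) :
    act D hD p (act D hD q a) = act D hD q (act D hD p a) := by
  rw [← act_mul, mul_comm, act_mul]

theorem act_der (i : ℕ+) (p : Ops) (a : A) : act D hD p (D i a) = D i (act D hD p a) := by
  rw [← act_X hD, act_comm, act_X]

theorem act_add (p q : Ops) (a : A) : act D hD (p + q) a = act D hD p a + act D hD q a := by
  rw [map_add]; rfl

theorem act_sub (p q : Ops) (a : A) : act D hD (p - q) a = act D hD p a - act D hD q a := by
  rw [map_sub]; rfl

theorem act_neg (p : Ops) (a : A) : act D hD (-p) a = -act D hD p a := by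
  rw [map_neg]; rfl

theorem act_smul (c : ℚ) (p : Ops) (a : A) : act D hD (c • p) a = c • act D hD p a := by
  rw [map_smul]; rfl

@[simp] theorem act_one (a : A) : act D hD 1 a = a := by
  rw [map_one]; rfl

@[simp] theorem act_zero (a : A) : act D hD 0 a = 0 := by
  rw [map_zero]; rfl

theorem act_sum {ι : Type*} (s : Finset ι) (p : ι → Ops) (a : A) :
    act D hD (∑ i ∈ s, p i) a = ∑ i ∈ s, act D hD (p i) a := by
  rw [map_sum, LinearMap.sum_apply]

theorem act_list_prod (I : List ℕ+) (a : A) :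
    act D hD (I.map MvPolynomial.X).prod a = iterD D I a := by
  induction I with
  | nil => simp [iterD]
  | cons i I ih => rw [List.map_cons, List.prod_cons, act_X_mul, ih]; rfl

/-! ### Shift operators -/

/-- The series `∑_{r ≥ 1} (y_r / r) s^r`. -/
noncomputable def flowSeries : PowerSeries Ops :=
  PowerSeries.mk fun r => (1 / (r : ℚ)) • MvPolynomial.X r.toPNat'

/-- The coefficient of `s^r` in `exp (c ∑_{r ≥ 1} (y_r / r) s^r)`; on functions of
`x_1, x_2, …` this exponential is the shift `x_r ↦ x_r + c s^r / r`. -/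
noncomputable def shiftOp (c : ℚ) (r : ℕ) : Ops := PowerSeries.coeff r (expPS (c • flowSeries))

@[simp] theorem shiftOp_zero (c : ℚ) : shiftOp c 0 = 1 := coeff_zero_expPS _

theorem shiftOp_succ (c : ℚ) (r : ℕ) : ((r : ℚ) + 1) • shiftOp c (r + 1) =
    c • ∑ x ∈ antidiagonal r, MvPolynomial.X x.1.succPNat * shiftOp c x.2 := by
  rw [shiftOp, ← coeff_derivative_eq_smul, derivative_expPS, PowerSeries.coeff_mul, Finset.smul_sum]
  refine Finset.sum_congr rfl fun x _ => ?_
  have : (x.1 : ℚ) + 1 ≠ 0 := by positivity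
  rw [coeff_derivative_eq_smul, PowerSeries.coeff_smul, flowSeries, PowerSeries.coeff_mk, shiftOp,
    smul_comm, ← smul_mul_assoc]
  congr 2
  push_cast
  rw [one_div, smul_inv_smul₀ this]
  rfl

theorem shiftOp_add (c c' : ℚ) (r : ℕ) :
    ∑ x ∈ antidiagonal r, shiftOp c x.1 * shiftOp c' x.2 = shiftOp (c + c') r := by
  rw [shiftOp, add_smul, expPS_add, PowerSeries.coeff_mul]
  rfl

theorem shiftOp_zero_left (r : ℕ) : shiftOp 0 r = if r = 0 then 1 else 0 := by
  rw [shiftOp, zero_smul, expPS_zero, PowerSeries.coeff_one]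

theorem act_shiftOp_succ (c : ℚ) (r : ℕ) (a : A) :
    ((r : ℚ) + 1) • act D hD (shiftOp c (r + 1)) a =
      c • ∑ x ∈ antidiagonal r, D x.1.succPNat (act D hD (shiftOp c x.2) a) := by
  rw [← act_smul, shiftOp_succ, act_smul, act_sum]
  simp only [act_X_mul]

theorem act_shiftOp_one (c : ℚ) (a : A) : act D hD (shiftOp c 1) a = c • D 1 a := by
  have := act_shiftOp_succ hD c 0 a
  simpa using this.trans (by simp; rfl : _ = c • D 1 a)

/-- The shift `a ↦ ∑_r s^r (shiftOp c r) a` is a ring homomorphism, being the exponential of a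
derivation. -/
theorem act_shiftOp_mul (c : ℚ) (r : ℕ) (a b : A) :
    act D hD (shiftOp c r) (a * b) =
      ∑ x ∈ antidiagonal r, act D hD (shiftOp c x.1) a * act D hD (shiftOp c x.2) b := by
  induction r using Nat.strong_induction_on with
  | _ r ih =>
    rcases r with _ | r
    · simp
    refine smul_right_injective_of_rat (q := (r : ℚ) + 1) (by positivity) ?_
    let T : A → PowerSeries A := fun a => PowerSeries.mk fun r => act D hD (shiftOp c r) a
    have hcoe : ∀ a r, PowerSeries.coeff r (T a) = act D hD (shiftOp c r) a :=
      fun a r => PowerSeries.coeff_mk _ _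
    have hT : ∀ a b, ∑ x ∈ antidiagonal (r + 1),
        act D hD (shiftOp c x.1) a * act D hD (shiftOp c x.2) b =
        PowerSeries.coeff (r + 1) (T a * T b) := fun a b => by
      rw [PowerSeries.coeff_mul]
      simp only [hcoe]
    have hder : ∀ a r, PowerSeries.coeff r (PowerSeries.derivative A (T a)) =
        c • ∑ x ∈ antidiagonal r, D x.1.succPNat (act D hD (shiftOp c x.2) a) := fun a r => by
      rw [coeff_derivative_eq_smul, hcoe, act_shiftOp_succ]
    have half : ∀ a b : A, ∑ x ∈ antidiagonal r, PowerSeries.coeff x.1 (T a) *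
        PowerSeries.coeff x.2 (PowerSeries.derivative A (T b)) =
        c • ∑ x ∈ antidiagonal r, ∑ y ∈ antidiagonal x.2,
          D x.1.succPNat (act D hD (shiftOp c y.1) b) * act D hD (shiftOp c y.2) a := by
      intro a b
      rw [PsiDO.sum_antidiagonal_assoc r fun i j k =>
        D i.succPNat (act D hD (shiftOp c j) b) * act D hD (shiftOp c k) a,
        ← Finset.Nat.sum_antidiagonal_swap, Finset.smul_sum]
      refine Finset.sum_congr rfl fun x _ => ?_
      rw [Prod.fst_swap, Prod.snd_swap, hder, hcoe, mul_comm, smul_mul_assoc, Finset.sum_mul]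
    rw [act_shiftOp_succ, hT, ← coeff_derivative_eq_smul, Derivation.leibniz, map_add, smul_eq_mul,
      smul_eq_mul, PowerSeries.coeff_mul, PowerSeries.coeff_mul, half, half, ← smul_add,
      ← Finset.sum_add_distrib]
    congr 1
    refine Finset.sum_congr rfl fun x hx => ?_
    rw [mem_antidiagonal] at hx
    rw [ih x.2 (by omega), map_sum]
    have hs : ∑ y ∈ antidiagonal x.2, D x.1.succPNat (act D hD (shiftOp c y.1) b) *
          act D hD (shiftOp c y.2) a =
        ∑ y ∈ antidiagonal x.2, D x.1.succPNat (act D hD (shiftOp c y.2) b) *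
          act D hD (shiftOp c y.1) a := by
      rw [← Finset.Nat.sum_antidiagonal_swap]
      rfl
    rw [hs, ← Finset.sum_add_distrib]
    refine Finset.sum_congr rfl fun y _ => ?_
    rw [Derivation.leibniz, smul_eq_mul, smul_eq_mul]
    ring

theorem act_shiftOp_unit (c : ℚ) (r : ℕ) : act D hD (shiftOp c r) 1 = if r = 0 then 1 else 0 := by
  rcases r with _ | r
  · simp
  refine smul_right_injective_of_rat (q := (r : ℚ) + 1) (by positivity) ?_
  rw [act_shiftOp_succ, Finset.sum_eq_zero, smul_zero, if_neg (Nat.succ_ne_zero r), smul_zero]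
  intro x _
  rw [← act_der, Derivation.map_one_eq_zero, map_zero]

/-- The shift `a ↦ ∑_r s^r (shiftOp c r) a`. -/
noncomputable def taylor (c : ℚ) : A →+* PowerSeries A where
  toFun a := PowerSeries.mk fun r => act D hD (shiftOp c r) a
  map_one' := by
    ext r
    rw [PowerSeries.coeff_mk, act_shiftOp_unit, PowerSeries.coeff_one]
  map_mul' a b := by
    ext r
    rw [PowerSeries.coeff_mk, act_shiftOp_mul, PowerSeries.coeff_mul]
    simp only [PowerSeries.coeff_mk]
  map_zero' := by
    ext r
    simp
  map_add' a b := by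
    ext r
    simp

@[simp] theorem coeff_taylor (c : ℚ) (a : A) (r : ℕ) :
    PowerSeries.coeff r (taylor hD c a) = act D hD (shiftOp c r) a :=
  PowerSeries.coeff_mk r fun r => act D hD (shiftOp c r) a

/-! ### The functions `η` and `ξ` -/

theorem eta_eq (v : A) (r : ℕ) : eta D v r = -act D hD (shiftOp (-1) r) v := by
  have h1 : (-1 : ℚ) • flowSeries =
      PowerSeries.mk fun r : ℕ => (-1 / (r : ℚ)) • (MvPolynomial.X r.toPNat' : Ops) := by
    ext1 r
    rw [PowerSeries.coeff_smul, flowSeries, PowerSeries.coeff_mk, PowerSeries.coeff_mk, smul_smul]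
    congr 1
    ring
  rw [shiftOp, h1, ← sum_composition_eq_expPS, act_sum, eta, ← Finset.sum_neg_distrib]
  refine Finset.sum_congr rfl fun c _ => ?_
  have h2 : ∀ l : List ℕ,
      (l.map fun r : ℕ => (-1 / (r : ℚ)) • (MvPolynomial.X r.toPNat' : Ops)).prod =
      ((-1) ^ l.length / (l.prod : ℚ)) • ((l.map Nat.toPNat').map MvPolynomial.X).prod := by
    intro l
    induction l with
    | nil => simp
    | cons r l ih =>
      simp only [List.map_cons, List.prod_cons, List.length_cons, ih]
      rw [smul_mul_smul_comm]
      congr 1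
      push_cast
      rw [pow_succ', mul_div_mul_comm]
  rw [h2, act_smul, act_smul, act_list_prod, smul_smul, ← neg_smul, c.blocks_length]
  congr 1
  push_cast
  rw [pow_succ]
  field_simp

/-- The wave function `w(κ) = 1 + ∑ ξ_j κ^j = exp (∑ η_r κ^r)`. -/
theorem xi_eq (v : A) (j : ℕ) :
    xi D v j = PowerSeries.coeff j (expPS (PowerSeries.mk (eta D v))) := by
  rw [← sum_composition_eq_expPS]
  rfl

theorem eta_one (hD : ∀ i j a, D i (D j a) = D j (D i a)) (v : A) : eta D v 1 = D 1 v := by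
  rw [eta_eq hD v 1, act_shiftOp_one, neg_one_smul, neg_neg]

end Act

end

section

open Psi

variable {A : Type u} [CommRing A] [Algebra ℚ A]
variable {D : ℕ+ → Derivation ℚ A A} (hD : ∀ i j a, D i (D j a) = D j (D i a))

/-! ### Sato equations and the discrete equation -/

/-- The operator `W ↦ ∂_i W + W ∂^i`, which describes the action of `∂_i` on the wave function
`W exp (∑ x_j k^j)`. -/
noncomputable def flow (D : ℕ+ → Derivation ℚ A A) (i : ℕ+) (W : Psi (D 1)) : Psi (D 1) :=
  der (D i) W + W * dp (D 1) (i : ℕ)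

/-- The left multiples `B W` of `W` by differential operators `B`. -/
def diffMultiples (D : ℕ+ → Derivation ℚ A A) (W : Psi (D 1)) : AddSubgroup (Psi (D 1)) where
  carrier := {X | ∃ B, IsDiff B ∧ X = B * W}
  zero_mem' := ⟨0, isDiff_zero, by rw [zero_mul]⟩
  add_mem' := by
    rintro _ _ ⟨B, hB, rfl⟩ ⟨C, hC, rfl⟩
    exact ⟨B + C, hB.add hC, by rw [add_mul]⟩
  neg_mem' := by
    rintro _ ⟨B, hB, rfl⟩
    exact ⟨0 - B, isDiff_zero.sub hB, by rw [zero_sub, neg_mul]⟩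

/-- The Sato equations: every `∂_i W + W ∂^i` is a left multiple of `W` by a differential operator.
If `W = 1 + ⋯`, that operator is `(W ∂^i W^{-1})_+`. -/
def Sato (D : ℕ+ → Derivation ℚ A A) (W : Psi (D 1)) : Prop :=
  ∀ i, flow D i W ∈ diffMultiples D W

theorem flow_mul (hD : ∀ i j a, D i (D j a) = D j (D i a)) (i : ℕ+) (B W : Psi (D 1)) :
    flow D i (B * W) = der (D i) B * W + B * flow D i W := by
  rw [flow, flow, der_mul (hD i 1), mul_add, mul_assoc, add_assoc]

theorem flow_mem (hD : ∀ i j a, D i (D j a) = D j (D i a)) {i : ℕ+} {W X : Psi (D 1)}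
    (hi : flow D i W ∈ diffMultiples D W) (hX : X ∈ diffMultiples D W) :
    flow D i X ∈ diffMultiples D W := by
  obtain ⟨B, hB, rfl⟩ := hX
  obtain ⟨C, hC, hi⟩ := hi
  rw [flow_mul hD, hi, ← mul_assoc, ← add_mul]
  exact ⟨_, (hB.der _).add (hB.mul hC), rfl⟩

/-- The coefficient of `s^r` in `exp (-∑ (s^i / i) flow_i) W = (T_s W) (1 - s ∂)`, where
`T_s = exp (-∑ (s^i / i) ∂_i)` acts on the coefficients. -/
noncomputable def shiftedWave (r : ℕ) (W : Psi (D 1)) : Psi (D 1) :=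
  (⟨fun k => act D hD (shiftOp (-1) r) (coeff W k) -
      if r = 0 then 0 else act D hD (shiftOp (-1) (r - 1)) (coeff W (k - 1)), by
    obtain ⟨N, hN⟩ := W.exists_ordLE
    refine ⟨N + 1, fun k hk => ?_⟩
    rw [hN.coeff_eq_zero (show N < k by omega), hN.coeff_eq_zero (show N < k - 1 by omega),
      map_zero, map_zero, ite_self, sub_zero]⟩ : PsiDO A)

theorem coeff_shiftedWave (r : ℕ) (W : Psi (D 1)) (k : ℤ) :
    coeff (shiftedWave hD r W) k = act D hD (shiftOp (-1) r) (coeff W k) -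
      if r = 0 then 0 else act D hD (shiftOp (-1) (r - 1)) (coeff W (k - 1)) := rfl

theorem shiftedWave_zero (W : Psi (D 1)) : shiftedWave hD 0 W = W := by
  ext k
  simp [coeff_shiftedWave]

theorem shiftedWave_succ (r : ℕ) (W : Psi (D 1)) :
    (r + 1) • shiftedWave hD (r + 1) W =
      -∑ x ∈ antidiagonal r, flow D x.1.succPNat (shiftedWave hD x.2 W) := by
  have hrec : ∀ (r : ℕ) (a : A), ((r : ℚ) + 1) • act D hD (shiftOp (-1) (r + 1)) a =
      -∑ x ∈ antidiagonal r, D x.1.succPNat (act D hD (shiftOp (-1) x.2) a) := fun r a => by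
    rw [act_shiftOp_succ, neg_one_smul]
  ext k
  rw [coeff_neg, coeff_sum, coeff_nsmul, ← Nat.cast_smul_eq_nsmul ℚ, coeff_shiftedWave,
    if_neg (Nat.succ_ne_zero r), Nat.add_sub_cancel, smul_sub]
  push_cast
  have hterm : ∀ x : ℕ × ℕ, coeff (flow D x.1.succPNat (shiftedWave hD x.2 W)) k =
      D x.1.succPNat (act D hD (shiftOp (-1) x.2) (coeff W k)) -
      (if x.2 = 0 then 0 else
        D x.1.succPNat (act D hD (shiftOp (-1) (x.2 - 1)) (coeff W (k - 1)))) +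
      (act D hD (shiftOp (-1) x.2) (coeff W (k - (x.1 + 1))) -
        if x.2 = 0 then 0 else
          act D hD (shiftOp (-1) (x.2 - 1)) (coeff W (k - (x.1 + 1) - 1))) := by
    intro x
    rw [flow, coeff_add, coeff_der, coeff_mul_dp, coeff_shiftedWave, coeff_shiftedWave, map_sub]
    simp only [Nat.succPNat_coe, Nat.succ_eq_add_one, Nat.cast_add, Nat.cast_one]
    congr 2
    split_ifs <;> simp
  rw [Finset.sum_congr rfl fun x _ => hterm x, hrec, Finset.sum_add_distrib,
    Finset.sum_sub_distrib, Finset.sum_sub_distrib]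
  rcases r with _ | r
  · simp
    ring
  · have h1 : ∑ x ∈ antidiagonal (r + 1), (if x.2 = 0 then 0 else
        D x.1.succPNat (act D hD (shiftOp (-1) (x.2 - 1)) (coeff W (k - 1)))) =
        -(((r : ℚ) + 1) • act D hD (shiftOp (-1) (r + 1)) (coeff W (k - 1))) := by
      rw [hrec, neg_neg, Finset.Nat.sum_antidiagonal_succ', if_pos rfl, zero_add]
      refine Finset.sum_congr rfl fun x _ => ?_
      rw [if_neg (Nat.succ_ne_zero _), Nat.add_sub_cancel]
    have h2 : ∑ x ∈ antidiagonal (r + 1), (if x.2 = 0 then 0 else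
        act D hD (shiftOp (-1) (x.2 - 1)) (coeff W (k - (x.1 + 1) - 1))) =
        ∑ x ∈ antidiagonal r, act D hD (shiftOp (-1) x.2) (coeff W (k - (x.1 + 1) - 1)) := by
      rw [Finset.Nat.sum_antidiagonal_succ', if_pos rfl, zero_add]
      refine Finset.sum_congr rfl fun x _ => ?_
      rw [if_neg (Nat.succ_ne_zero _), Nat.add_sub_cancel]
    have h3 : ∑ x ∈ antidiagonal (r + 1),
        act D hD (shiftOp (-1) x.2) (coeff W (k - (x.1 + 1))) =
        act D hD (shiftOp (-1) (r + 1)) (coeff W (k - 1)) +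
        ∑ x ∈ antidiagonal r, act D hD (shiftOp (-1) x.2) (coeff W (k - (x.1 + 1) - 1)) := by
      rw [Finset.Nat.sum_antidiagonal_succ]
      simp only [Nat.cast_zero, zero_add, Nat.cast_add, Nat.cast_one, sub_sub]
    rw [h1, h2, h3]
    push_cast
    rw [add_smul _ (1 : ℚ), one_smul]
    abel

/-- The discrete form of the Sato equations, in terms of the coefficients of
`w = 1 + ξ_1 κ + ξ_2 κ^2 + ⋯`. -/
def DiscreteKP (hD : ∀ i j a, D i (D j a) = D j (D i a)) (ξ : ℕ → A) : Prop :=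
  ∀ r j : ℕ, act D hD (shiftOp (-1) (r + 2)) (ξ j) =
    act D hD (shiftOp (-1) (r + 1)) (ξ (j + 1)) - act D hD (shiftOp (-1) (r + 1)) (ξ 1) * ξ j

theorem mem_of_nsmul_mem {W X : Psi (D 1)} (r : ℕ) (h : (r + 1) • X ∈ diffMultiples D W) :
    X ∈ diffMultiples D W := by
  obtain ⟨B, hB, h⟩ := h
  refine ⟨const (D 1) (algebraMap ℚ A (1 / ((r : ℚ) + 1))) * B, (isDiff_const _).mul hB, ?_⟩
  rw [mul_assoc, ← h]
  ext k
  have : (r : ℚ) + 1 ≠ 0 := by positivity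
  rw [coeff_const_mul, coeff_nsmul, ← Algebra.smul_def, ← Nat.cast_smul_eq_nsmul ℚ, one_div]
  push_cast
  rw [inv_smul_smul₀ this]

theorem shiftedWave_mem {W : Psi (D 1)} (hS : Sato D W) (r : ℕ) :
    shiftedWave hD r W ∈ diffMultiples D W := by
  induction r using Nat.strong_induction_on with
  | _ r ih =>
    rcases r with _ | r
    · rw [shiftedWave_zero]
      exact ⟨1, isDiff_dp 0, by rw [one_mul]⟩
    · refine mem_of_nsmul_mem r ?_
      rw [shiftedWave_succ]
      refine neg_mem (sum_mem fun x hx => ?_)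
      rw [mem_antidiagonal] at hx
      exact flow_mem hD (hS _) (ih x.2 (by omega))

theorem sato_of_shiftedWave_mem {W : Psi (D 1)}
    (h : ∀ r, shiftedWave hD r W ∈ diffMultiples D W) : Sato D W := by
  have key : ∀ r : ℕ, flow D r.succPNat W ∈ diffMultiples D W := by
    intro r
    induction r using Nat.strong_induction_on with
    | _ r ih =>
      have h1 := shiftedWave_succ hD r W
      rw [← Finset.add_sum_erase _ _ (show (r, 0) ∈ antidiagonal r by simp)] at h1
      dsimp only at h1
      rw [shiftedWave_zero] at h1
      rw [show flow D r.succPNat W = -((r + 1) • shiftedWave hD (r + 1) W) -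
        ∑ x ∈ (antidiagonal r).erase (r, 0), flow D x.1.succPNat (shiftedWave hD x.2 W) by
          rw [h1]; abel]
      refine sub_mem (neg_mem (nsmul_mem (h _) _)) (sum_mem fun x hx => ?_)
      rw [Finset.mem_erase, mem_antidiagonal] at hx
      refine flow_mem hD (ih x.1 ?_) (h _)
      rcases Nat.eq_zero_or_pos x.2 with h0 | h0
      · exact absurd (Prod.ext (by dsimp only; omega) h0) hx.1
      · omega
  intro i
  have := key i.natPred
  rwa [PNat.succPNat_natPred] at this

/-- For `W = 1 + ⋯`, membership of all `shiftedWave r W` in the left multiples of `W` pins them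
down by comparison of orders: `(T_s W) (1 - s ∂) = (α_s - s ∂) W`. -/
theorem shiftedWave_mem_iff {W : Psi (D 1)} (hW : IsUnip W) :
    (∀ r, shiftedWave hD r W ∈ diffMultiples D W) ↔ DiscreteKP hD fun j => coeff W (-j) := by
  have hlead : ∀ k : ℤ, 0 ≤ k → coeff W k = if k = 0 then 1 else 0 := fun k hk => by
    split_ifs with h
    · rw [h, hW.lead]
    · exact hW.ordLE.coeff_eq_zero (by omega)
  constructor
  · intro h r j
    obtain ⟨B, hB, hBW⟩ := h (r + 2)
    -- The coefficients of order `≥ 1` of `shiftedWave (r + 2) W` vanish.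
    have hord : OrdLE (shiftedWave hD (r + 2) W) 0 := fun k hk => by
      change coeff (shiftedWave hD (r + 2) W) k = 0
      rw [coeff_shiftedWave, hlead k hk.le, hlead (k - 1) (by omega), if_neg (by omega),
        if_neg (by omega), map_zero, show r + 2 - 1 = r + 1 from rfl]
      split_ifs
      · rw [act_shiftOp_unit, if_neg (by omega), sub_zero]
      · rw [map_zero, sub_zero]
    obtain ⟨B', hB', hB'W⟩ := hW.exists_mul_eq hord
    obtain rfl : B' = B := hW.mul_right_cancel (hB'W.trans hBW)
    have hBc : B' = const (D 1) (coeff B' 0) := by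
      ext k
      rcases lt_trichotomy k 0 with hk | rfl | hk
      · rw [hB k hk, isDiff_const _ k hk]
      · rfl
      · rw [hB'.coeff_eq_zero hk, (ordLE_const _).coeff_eq_zero hk]
    have hc : ∀ j : ℕ, act D hD (shiftOp (-1) (r + 2)) (coeff W (-j)) -
        act D hD (shiftOp (-1) (r + 1)) (coeff W (-(j + 1 : ℕ))) =
        coeff B' 0 * coeff W (-j) := fun j => by
      have := congrArg (coeff · (-(j : ℤ))) hBW
      rw [hBc, coeff_const_mul, coeff_shiftedWave, if_neg (by omega)] at this
      rw [← this, show -((j + 1 : ℕ) : ℤ) = -j - 1 by push_cast; ring]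
      rfl
    have h0 := hc 0
    simp only [Nat.cast_zero, neg_zero, hW.lead, act_shiftOp_unit, mul_one] at h0
    rw [if_neg (by omega), zero_sub] at h0
    have hj := hc j
    rw [← h0] at hj
    simp only [Nat.cast_one]
    simp only [zero_add, Nat.cast_one] at hj
    linear_combination hj
  · intro h r
    rcases r with _ | _ | r
    · rw [shiftedWave_zero]
      exact ⟨1, isDiff_dp 0, by rw [one_mul]⟩
    · -- The first operator is `-∂ W` by direct computation.
      refine ⟨0 - dp (D 1) 1, isDiff_zero.sub (isDiff_dp 1), ?_⟩
      ext k
      rw [zero_sub, neg_mul, coeff_neg, coeff_dp_one_mul, coeff_shiftedWave, if_neg (by omega),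
        zero_add, act_shiftOp_one]
      simp only [Nat.sub_self, shiftOp_zero, act_one, neg_smul, one_smul]
      ring
    · refine ⟨const (D 1) (-act D hD (shiftOp (-1) (r + 1)) (coeff W (-1))), isDiff_const _, ?_⟩
      ext k
      rw [coeff_const_mul, coeff_shiftedWave, if_neg (by omega),
        show r + 1 + 1 - 1 = r + 1 from rfl]
      rcases lt_or_ge 0 k with hk | hk
      · rw [hlead k hk.le, hlead (k - 1) (by omega), if_neg (by omega), map_zero, mul_zero]
        split_ifs
        · rw [act_shiftOp_unit, if_neg (by omega), sub_zero]
        · rw [map_zero, sub_zero]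
      · obtain ⟨j, rfl⟩ : ∃ j : ℕ, k = -j := ⟨(-k).toNat, by omega⟩
        have := h r j
        simp only [Nat.cast_one] at this
        rw [this, show -((j + 1 : ℕ) : ℤ) = -j - 1 by push_cast; ring]
        ring

theorem sato_iff_discreteKP {W : Psi (D 1)} (hW : IsUnip W) :
    Sato D W ↔ DiscreteKP hD fun j => coeff W (-j) :=
  ⟨fun h => (shiftedWave_mem_iff hD hW).mp (shiftedWave_mem hD h),
    fun h => sato_of_shiftedWave_mem hD ((shiftedWave_mem_iff hD hW).mpr h)⟩

/-! ### The Fay identity -/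

/-- For `η = ∑ η_j κ^j` the series `exp (T_s η - η)`, as a power series in `κ` whose coefficients
are power series in `s`. -/
noncomputable def fayExp (η : PowerSeries A) : PowerSeries (PowerSeries A) :=
  expPS (PowerSeries.map (taylor hD (-1)) η - PowerSeries.map (PowerSeries.C) η)

/-- The coefficient of `s^i κ^j` in a power series in `κ` over power series in `s`. -/
noncomputable def coeff₂ {R : Type*} [CommRing R] (i j : ℕ) (f : PowerSeries (PowerSeries R)) : R :=
  PowerSeries.coeff i (PowerSeries.coeff j f)

theorem coeff₂_zero_expPS {R : Type u} [CommRing R] [Algebra ℚ R]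
    {g : PowerSeries (PowerSeries R)} (h : ∀ j, coeff₂ 0 j g = 0) (j : ℕ) :
    coeff₂ 0 j (expPS g) = if j = 0 then 1 else 0 := by
  have e1 : PowerSeries.map (PowerSeries.constantCoeff (R := R)) g = 0 :=
    PowerSeries.ext fun j => by
    rw [PowerSeries.coeff_map, map_zero, ← PowerSeries.coeff_zero_eq_constantCoeff_apply]
    exact h j
  have e2 := congrArg (PowerSeries.coeff j) (map_expPS (PowerSeries.constantCoeff (R := R)) g)
  rwa [e1, expPS_zero, PowerSeries.coeff_map, PowerSeries.coeff_one,
    ← PowerSeries.coeff_zero_eq_constantCoeff_apply] at e2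

/-- The differential Fay identity: the coefficients of `s^i κ^j`, `i, j ≥ 1`, in
`exp (T_s η - η)` depend on `i + j` only. -/
def Fay (hD : ∀ i j a, D i (D j a) = D j (D i a)) (η : PowerSeries A) : Prop :=
  ∀ i j : ℕ, coeff₂ (i + 1) (j + 2) (fayExp hD η) = coeff₂ (i + 2) (j + 1) (fayExp hD η)

theorem fayExp_mul (η : PowerSeries A) : fayExp hD η * PowerSeries.map PowerSeries.C (expPS η) =
    PowerSeries.map (taylor hD (-1)) (expPS η) := by
  rw [fayExp, map_expPS, map_expPS, ← expPS_add, sub_add_cancel]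

theorem coeff_taylor_expPS (η : PowerSeries A) (i j : ℕ) :
    act D hD (shiftOp (-1) i) (PowerSeries.coeff j (expPS η)) =
      ∑ x ∈ antidiagonal j, coeff₂ i x.1 (fayExp hD η) * PowerSeries.coeff x.2 (expPS η) := by
  have := congrArg (coeff₂ i j) (fayExp_mul hD η)
  rw [coeff₂, coeff₂, PowerSeries.coeff_map, coeff_taylor, PowerSeries.coeff_mul, map_sum] at this
  rw [← this]
  refine Finset.sum_congr rfl fun x _ => ?_
  rw [PowerSeries.coeff_map, PowerSeries.coeff_mul_C]
  rfl

theorem coeff₂_succ_zero_fayExp (η : PowerSeries A) (i : ℕ) :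
    coeff₂ (i + 1) 0 (fayExp hD η) = 0 := by
  rw [coeff₂, fayExp, coeff_zero_expPS, PowerSeries.coeff_one, if_neg (by omega)]

theorem coeff₂_one_fayExp (η : PowerSeries A) (i : ℕ) : coeff₂ (i + 1) 1 (fayExp hD η) =
    act D hD (shiftOp (-1) (i + 1)) (PowerSeries.coeff 1 (expPS η)) := by
  rw [coeff_taylor_expPS, Finset.Nat.antidiagonal_succ, Finset.sum_cons, coeff₂_succ_zero_fayExp]
  simp

theorem discreteKP_iff_fay (η : PowerSeries A) :
    DiscreteKP hD (fun j => PowerSeries.coeff j (expPS η)) ↔ Fay hD η := by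
  -- Comparison of coefficients in `κ T_{i+2} w = T_{i+1} w - κ (T_{i+1} ξ_1) w` after division
  -- by `w`, where `T_i` denotes the coefficient of `s^i` in `T_s`.
  have hrow : ∀ i : ℕ, (∀ j, act D hD (shiftOp (-1) (i + 2)) (PowerSeries.coeff j (expPS η)) =
      act D hD (shiftOp (-1) (i + 1)) (PowerSeries.coeff (j + 1) (expPS η)) -
        act D hD (shiftOp (-1) (i + 1)) (PowerSeries.coeff 1 (expPS η)) *
          PowerSeries.coeff j (expPS η)) ↔
      ∀ j, coeff₂ (i + 1) (j + 2) (fayExp hD η) = coeff₂ (i + 2) (j + 1) (fayExp hD η) := by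
    intro i
    let h1 : PowerSeries A := PowerSeries.mk fun j => coeff₂ (i + 2) j (fayExp hD η)
    let h2 : PowerSeries A := PowerSeries.mk fun j => if j = 0 then 0 else
      coeff₂ (i + 1) (j + 1) (fayExp hD η)
    have e1 : ∀ j, act D hD (shiftOp (-1) (i + 2)) (PowerSeries.coeff j (expPS η)) =
        PowerSeries.coeff j (h1 * expPS η) := fun j => by
      rw [coeff_taylor_expPS, PowerSeries.coeff_mul]
      simp only [h1, PowerSeries.coeff_mk]
    have e2 : ∀ j, act D hD (shiftOp (-1) (i + 1)) (PowerSeries.coeff (j + 1) (expPS η)) -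
        act D hD (shiftOp (-1) (i + 1)) (PowerSeries.coeff 1 (expPS η)) *
          PowerSeries.coeff j (expPS η) = PowerSeries.coeff j (h2 * expPS η) := fun j => by
      rw [coeff_taylor_expPS, PowerSeries.coeff_mul, Finset.Nat.sum_antidiagonal_succ,
        coeff₂_succ_zero_fayExp, zero_mul, zero_add, ← coeff₂_one_fayExp]
      rw [← Finset.add_sum_erase _ _ (show (0, j) ∈ antidiagonal j by simp),
        ← Finset.add_sum_erase _ _ (show (0, j) ∈ antidiagonal j by simp)]
      simp only [zero_add, add_sub_cancel_left, h2, PowerSeries.coeff_mk, if_true, zero_mul]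
      refine Finset.sum_congr rfl fun x hx => ?_
      rw [Finset.mem_erase, mem_antidiagonal] at hx
      rw [if_neg]
      intro h0
      exact hx.1 (Prod.ext h0 (by dsimp only; omega))
    simp only [e1, e2]
    rw [← PowerSeries.ext_iff, (isUnit_expPS η).mul_left_inj, PowerSeries.ext_iff]
    simp only [h1, h2, PowerSeries.coeff_mk]
    constructor
    · intro h j
      have := h (j + 1)
      rw [if_neg (by omega)] at this
      exact this.symm
    · rintro h (_ | j)
      · rw [coeff₂_succ_zero_fayExp, if_pos rfl]
      · rw [if_neg (by omega), h j]
  exact forall_congr' hrow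

end

section

open Psi
open PsiDO (IsRoot IsGDOperator)

variable {A : Type u} [CommRing A] [Algebra ℚ A]
variable {D : ℕ+ → Derivation ℚ A A} (hD : ∀ i j a, D i (D j a) = D j (D i a))

/-! ### Wave operators, roots and generated solutions -/

theorem expPS_congr {R : Type u} [CommRing R] [Algebra ℚ R] {f g : PowerSeries R}
    (h : ∀ j, PowerSeries.coeff (j + 1) f = PowerSeries.coeff (j + 1) g) : expPS f = expPS g := by
  refine eq_expPS ?_ (constantCoeff_expPS f)
  rw [derivative_expPS]
  congr 1
  ext j
  rw [coeff_derivative_eq_smul, coeff_derivative_eq_smul, h]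

/-- The series `η = ∑_{r ≥ 1} η_r κ^r`. -/
noncomputable def etaSeries (D : ℕ+ → Derivation ℚ A A) (v : A) : PowerSeries A :=
  PowerSeries.mk fun r => if r = 0 then 0 else eta D v r

theorem coeff_etaSeries_succ (v : A) (r : ℕ) : PowerSeries.coeff (r + 1) (etaSeries D v) =
    -act D hD (shiftOp (-1) (r + 1)) v := by
  rw [etaSeries, PowerSeries.coeff_mk, if_neg (Nat.succ_ne_zero r), eta_eq hD]

@[simp] theorem constantCoeff_etaSeries (v : A) :
    PowerSeries.constantCoeff (etaSeries D v) = 0 := by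
  simp [etaSeries]

theorem xi_eq_coeff (v : A) (j : ℕ) : xi D v j = PowerSeries.coeff j (expPS (etaSeries D v)) := by
  rw [xi_eq]
  congr 1
  exact expPS_congr fun j => by simp [etaSeries]

theorem etaSeries_add (hD : ∀ i j a, D i (D j a) = D j (D i a)) (v v' : A) :
    etaSeries D (v + v') = etaSeries D v + etaSeries D v' := by
  ext r
  rcases r with _ | r
  · simp
  · rw [map_add, coeff_etaSeries_succ hD, coeff_etaSeries_succ hD, coeff_etaSeries_succ hD,
      map_add, neg_add]

/-- The wave operator of `v`, as an element of the ring of pseudo-differential operators. -/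
noncomputable def wave (D : ℕ+ → Derivation ℚ A A) (v : A) : Psi (D 1) := waveOp D v

theorem coeff_wave (v : A) (j : ℕ) :
    coeff (wave D v) (-j) = PowerSeries.coeff j (expPS (etaSeries D v)) := by
  rw [← xi_eq_coeff]
  change (if (-(j : ℤ)) ≤ 0 then xi D v (-(-(j : ℤ))).toNat else 0) = _
  rw [if_pos (by omega)]
  simp

theorem isUnip_wave (v : A) : IsUnip (wave D v) where
  ordLE := fun k hk => if_neg (not_le.mpr hk)
  lead := by simpa using coeff_wave (D := D) v 0

theorem sato_wave_iff (v : A) : Sato D (wave D v) ↔ Fay hD (etaSeries D v) := by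
  rw [sato_iff_discreteKP hD (isUnip_wave v), ← discreteKP_iff_fay]
  simp only [coeff_wave]

theorem Psi.ext_iff_of_ordLE_zero {d : Derivation ℚ A A} {P R : Psi d} (hP : OrdLE P 0)
    (hR : OrdLE R 0) : P = R ↔ ∀ j : ℕ, coeff P (-j) = coeff R (-j) := by
  refine ⟨fun h j => by rw [h], fun h => Psi.ext fun k => ?_⟩
  rcases lt_or_ge 0 k with hk | hk
  · rw [hP.coeff_eq_zero hk, hR.coeff_eq_zero hk]
  · obtain ⟨j, rfl⟩ : ∃ j : ℕ, k = -j := ⟨(-k).toNat, by omega⟩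
    exact h j

theorem act_shiftOp_eq_zero {u : A} (h : ∀ i, D i u = 0) (c : ℚ) (r : ℕ) :
    act D hD (shiftOp c (r + 1)) u = 0 := by
  refine smul_right_injective_of_rat (q := (r : ℚ) + 1) (by positivity) ?_
  rw [act_shiftOp_succ, Finset.sum_eq_zero, smul_zero, smul_zero]
  intro x _
  rw [← act_der, h, map_zero]

theorem eq_zero_of_act_shiftOp {u : A} (h : ∀ r, act D hD (shiftOp (-1) (r + 1)) u = 0) (i : ℕ+) :
    D i u = 0 := by
  obtain ⟨r, rfl⟩ : ∃ r : ℕ, i = r.succPNat := ⟨i.natPred, (PNat.succPNat_natPred i).symm⟩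
  have h1 := act_shiftOp_succ hD (-1) r u
  rw [h, smul_zero, ← Finset.add_sum_erase _ _ (show (r, 0) ∈ antidiagonal r by simp),
    Finset.sum_eq_zero, add_zero, neg_one_smul] at h1
  · simpa using h1.symm
  · intro x hx
    rw [Finset.mem_erase, mem_antidiagonal] at hx
    obtain ⟨m, hm⟩ : ∃ m, x.2 = m + 1 := Nat.exists_eq_succ_of_ne_zero fun h0 =>
      hx.1 (Prod.ext (by dsimp only; omega) h0)
    rw [hm, h, map_zero]

/-- The wave operator does not depend on `x_i` if and only if `∂_i v` is a constant. -/
theorem der_wave_eq_zero_iff (hD : ∀ i j a, D i (D j a) = D j (D i a)) (i : ℕ+) (v : A) :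
    der (D i) (wave D v) = 0 ↔ ∀ j, D j (D i v) = 0 := by
  rw [Psi.ext_iff_of_ordLE_zero ((isUnip_wave v).ordLE.der _) (ordLE_zero 0)]
  simp only [coeff_der, coeff_wave, coeff_zero]
  have h1 : (∀ j : ℕ, D i (PowerSeries.coeff j (expPS (etaSeries D v))) = 0) ↔
      mapDer (D i) (etaSeries D v) = 0 := by
    rw [← (isUnit_expPS (etaSeries D v)).mul_left_inj, ← mapDer_expPS _ (constantCoeff_etaSeries v),
      zero_mul, PowerSeries.ext_iff]
    simp
  rw [h1]
  constructor
  · intro h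
    refine eq_zero_of_act_shiftOp hD fun r => ?_
    have := congrArg (PowerSeries.coeff (r + 1)) h
    rw [coeff_mapDer, coeff_etaSeries_succ hD, map_neg, ← act_der, map_zero, neg_eq_zero] at this
    exact this
  · intro h
    ext r
    rcases r with _ | r
    · simp
    · rw [coeff_mapDer, coeff_etaSeries_succ hD, map_neg, ← act_der, act_shiftOp_eq_zero hD h,
        neg_zero, map_zero]

variable {n : ℕ} {L : PsiDO A}

theorem isRoot_iff {Q : PsiDO A} : IsRoot (D 1) n L Q ↔
    IsMonicOne (of (D 1) Q) ∧ of (D 1) Q ^ n = of (D 1) L := by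
  rw [← pow_eq]
  exact ⟨fun h => ⟨⟨h.above, h.lead⟩, h.pow_eq⟩, fun h => ⟨h.1.lead, h.1.ordLE, h.2⟩⟩

theorem isGeneratedBy_iff (v : A) : IsGeneratedBy D n L v ↔
    of (D 1) L * wave D v = wave D v * dp (D 1) n ∧ ∃ Q : Psi (D 1), IsMonicOne Q ∧
      Q ^ n = of (D 1) L ∧ ∀ i : ℕ+, flow D i (wave D v) = pl (Q ^ (i : ℕ)) * wave D v := by
  refine and_congr Iff.rfl ⟨?_, ?_⟩
  · rintro ⟨Q, hQ, h⟩
    refine ⟨of (D 1) Q, (isRoot_iff.mp hQ).1, (isRoot_iff.mp hQ).2, fun i => ?_⟩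
    have := h i
    rw [pow_eq] at this
    exact eq_sub_iff_add_eq.mp this
  · rintro ⟨Q, hQ, hn, h⟩
    obtain ⟨Q, rfl⟩ : ∃ P : PsiDO A, of (D 1) P = Q := ⟨Q, rfl⟩
    refine ⟨Q, isRoot_iff.mpr ⟨hQ, hn⟩, fun i => ?_⟩
    rw [pow_eq]
    exact eq_sub_iff_add_eq.mpr (h i)

theorem isGDSolution_iff : IsGDSolution D n L ↔
    IsGDOperator n L ∧ ∃ Q : Psi (D 1), IsMonicOne Q ∧ Q ^ n = of (D 1) L ∧
      ∀ i : ℕ+, der (D i) (of (D 1) L) =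
        pl (Q ^ (i : ℕ)) * of (D 1) L - of (D 1) L * pl (Q ^ (i : ℕ)) := by
  refine and_congr Iff.rfl ⟨?_, ?_⟩
  · rintro ⟨Q, hQ, h⟩
    refine ⟨of (D 1) Q, (isRoot_iff.mp hQ).1, (isRoot_iff.mp hQ).2, fun i => ?_⟩
    have := h i
    rw [pow_eq] at this
    exact this
  · rintro ⟨Q, hQ, hn, h⟩
    obtain ⟨Q, rfl⟩ : ∃ P : PsiDO A, of (D 1) P = Q := ⟨Q, rfl⟩
    refine ⟨Q, isRoot_iff.mpr ⟨hQ, hn⟩, fun i => ?_⟩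
    rw [pow_eq]
    exact h i

namespace Psi

variable {d : Derivation ℚ A A}

/-- The subleading coefficient of a product of monic operators. -/
theorem coeff_mul_sub_one {P R : Psi d} {N M : ℤ} (hP : OrdLE P N) (hR : OrdLE R M)
    (hP1 : coeff P N = 1) (hR1 : coeff R M = 1) :
    coeff (P * R) (N + M - 1) = coeff P (N - 1) + coeff R (M - 1) := by
  have h := coeff_mul_sub hP hR 1
  simp only [Finset.Nat.antidiagonal_succ, Finset.Nat.antidiagonal_zero, Finset.sum_cons] at h
  rw [show N + M - ((1 : ℕ) : ℤ) = N + M - 1 by simp] at h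
  rw [h]
  simp [hP1, hR1, add_comm]

theorem IsMonicOne.coeff_pow_sub_one {Q : Psi d} (hQ : IsMonicOne Q) (i : ℕ) :
    coeff (Q ^ i) (i - 1) = i • coeff Q 0 := by
  induction i with
  | zero => rw [pow_zero, coeff_one, if_neg (by simp), zero_smul]
  | succ i ih =>
    have := coeff_mul_sub_one (hQ.pow i).1 hQ.ordLE (hQ.pow i).2 hQ.lead
    rw [pow_succ, show ((i + 1 : ℕ) : ℤ) - 1 = i + 1 - 1 by push_cast; ring, this, ih, sub_self,
      succ_nsmul]

/-- Every `W = 1 + ⋯` dresses `∂` to an operator `Q = W ∂ W^{-1}` with `q_0 = 0`. -/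
theorem IsUnip.exists_dressing {W : Psi d} (hW : IsUnip W) :
    ∃ Q, IsMonicOne Q ∧ coeff Q 0 = 0 ∧ Q * W = W * dp d 1 := by
  have ho : OrdLE (W * dp d 1) 1 := by simpa using hW.ordLE.mul (ordLE_dp 1)
  obtain ⟨Q, hQ, h⟩ := hW.exists_mul_eq ho
  have hl : coeff Q 1 = 1 := by
    have h1 := coeff_mul_top hQ hW.ordLE
    rw [h, coeff_mul_dp, hW.lead, mul_one] at h1
    rw [← h1]
    exact hW.lead
  refine ⟨Q, ⟨hQ, hl⟩, ?_, h⟩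
  have h2 := coeff_mul_sub_one hQ hW.ordLE hl hW.lead
  rw [h, coeff_mul_dp] at h2
  simpa using h2

theorem pow_mul_of_mul_eq {Q W : Psi d} (h : Q * W = W * dp d 1) (i : ℕ) :
    Q ^ i * W = W * dp d i := by
  induction i with
  | zero => rw [pow_zero, one_mul, Nat.cast_zero, dp_zero, mul_one]
  | succ i ih =>
    rw [pow_succ, mul_assoc, h, ← mul_assoc, ih, mul_assoc, dp_mul_dp]
    push_cast
    rfl

theorem IsUnip.ordLE_der {W : Psi d} (hW : IsUnip W) (δ : Derivation ℚ A A) :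
    OrdLE (der δ W) (-1) :=
  (hW.ordLE.der δ).pred (by rw [coeff_der, hW.lead, Derivation.map_one_eq_zero])

theorem IsUnip.ordLE_of_mul {W : Psi d} (hW : IsUnip W) {X : Psi d} {N : ℤ}
    (h : OrdLE (X * W) N) : OrdLE X N := by
  obtain ⟨X', hX', h'⟩ := hW.exists_mul_eq h
  rwa [← hW.mul_right_cancel h']

end Psi

/-- The operator in a Sato equation is the differential part of `Q^i`. -/
theorem Sato.flow_eq {W Q : Psi (D 1)} (hW : IsUnip W) (hS : Sato D W)
    (hQ : Q * W = W * dp (D 1) 1) (i : ℕ+) : flow D i W = pl (Q ^ (i : ℕ)) * W := by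
  obtain ⟨B, hB, h⟩ := hS i
  rw [hB.eq_pl, h]
  refine hW.ordLE_of_mul ?_
  rw [sub_mul, pow_mul_of_mul_eq hQ, ← h, flow, sub_add_cancel_right]
  exact (hW.ordLE_der _).neg

theorem root_eq_of_isGeneratedBy {v : A} (hn : n ≠ 0)
    (h : of (D 1) L * wave D v = wave D v * dp (D 1) n) {Q : Psi (D 1)} (hQ : IsMonicOne Q)
    (hQn : Q ^ n = of (D 1) L) : Q * wave D v = wave D v * dp (D 1) 1 := by
  obtain ⟨Q', hQ', _, hW⟩ := (isUnip_wave (D := D) v).exists_dressing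
  have : Q' = Q := by
    refine hQ'.eq_of_pow_eq hQ hn ?_
    rw [hQn]
    refine (isUnip_wave (D := D) v).mul_right_cancel ?_
    rw [h, pow_mul_of_mul_eq hW]
  rw [← this, hW]

/-- If the wave operator of `v` satisfies the Sato equations and `∂_n v` is a constant, then `v`
generates the solution `L = W ∂^n W^{-1}`. -/
theorem exists_solution_of_sato (hD : ∀ i j a, D i (D j a) = D j (D i a)) {v : A} {m : ℕ+}
    (hm : (m : ℕ) = n) (hS : Sato D (wave D v)) (hv : ∀ j, D j (D m v) = 0) :
    ∃ L : PsiDO A, IsGDSolution D n L ∧ IsGeneratedBy D n L v := by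
  have hW := isUnip_wave (D := D) v
  obtain ⟨Q, hQ, hQ0, hQW⟩ := hW.exists_dressing
  have hfl := hS.flow_eq hW hQW
  have hLW := pow_mul_of_mul_eq hQW n
  have hdiff : IsDiff (Q ^ n) := by
    have h1 := hfl m
    rw [flow, (der_wave_eq_zero_iff hD m v).mpr hv, zero_add, hm, ← hLW] at h1
    rw [hW.mul_right_cancel h1]
    exact isDiff_pl _
  refine ⟨Q ^ n, isGDSolution_iff.mpr ⟨⟨(hQ.pow n).2, ?_, (hQ.pow n).1, hdiff⟩, Q, hQ, rfl,
    fun i => ?_⟩, (isGeneratedBy_iff v).mpr ⟨hLW, Q, hQ, rfl, hfl⟩⟩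
  · have := hQ.coeff_pow_sub_one n
    rw [hQ0, smul_zero] at this
    exact this
  · change der (D i) (Q ^ n) = pl (Q ^ (i : ℕ)) * Q ^ n - Q ^ n * pl (Q ^ (i : ℕ))
    refine hW.mul_right_cancel ?_
    have h1 := congrArg (der (D i)) hLW
    rw [der_mul (hD i 1), der_mul (hD i 1), der_dp, mul_zero, add_zero] at h1
    have h2 : der (D i) (wave D v) = pl (Q ^ (i : ℕ)) * wave D v - wave D v * dp (D 1) (i : ℕ) :=
      eq_sub_iff_add_eq.mpr (hfl i)
    rw [h2, mul_sub, sub_mul, ← mul_assoc (Q ^ n) (wave D v), hLW, mul_assoc (wave D v) (dp _ _),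
      mul_assoc (wave D v) (dp _ _), dp_mul_dp, dp_mul_dp, mul_assoc (pl _) (wave D v), ← hLW,
      add_comm (n : ℤ)] at h1
    rw [sub_mul, mul_assoc, mul_assoc]
    have h3 := eq_sub_of_add_eq h1
    rw [h3]
    abel

theorem sato_of_isGeneratedBy {v : A} (h : IsGeneratedBy D n L v) : Sato D (wave D v) := by
  obtain ⟨_, Q, _, _, h⟩ := (isGeneratedBy_iff v).mp h
  exact fun i => ⟨_, isDiff_pl _, h i⟩

theorem der_eq_zero_of_isGeneratedBy (hD : ∀ i j a, D i (D j a) = D j (D i a)) {v : A} {m : ℕ+}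
    (hm : (m : ℕ) = n) (hL : IsGDOperator n L) (h : IsGeneratedBy D n L v) (j : ℕ+) :
    D j (D m v) = 0 := by
  obtain ⟨hLW, Q, _, hQn, hfl⟩ := (isGeneratedBy_iff v).mp h
  refine (der_wave_eq_zero_iff hD m v).mp ?_ j
  have hdiff : IsDiff (of (D 1) L) := hL.below
  have := hfl m
  rwa [flow, hm, hQn, hdiff.pl_eq, hLW, add_eq_right] at this

theorem operator_unique {L' : PsiDO A} {v : A} (h : IsGeneratedBy D n L v)
    (h' : IsGeneratedBy D n L' v) : L = L' :=
  (isUnip_wave (D := D) v).mul_right_cancel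
    (((isGeneratedBy_iff v).mp h).1.trans ((isGeneratedBy_iff v).mp h').1.symm)

/-- `∂_i ∂ v` is determined by `L`: up to sign it is the residue of `L^{i/n}`. -/
theorem der_der_one_eq (hD : ∀ i j a, D i (D j a) = D j (D i a)) {v : A} (hn : n ≠ 0)
    (h : of (D 1) L * wave D v = wave D v * dp (D 1) n) {Q : Psi (D 1)} (hQ : IsMonicOne Q)
    (hQn : Q ^ n = of (D 1) L)
    (hfl : ∀ i : ℕ+, flow D i (wave D v) = pl (Q ^ (i : ℕ)) * wave D v) (i : ℕ+) :
    D i (D 1 v) = -coeff (Q ^ (i : ℕ)) (-1) := by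
  have hW := isUnip_wave (D := D) v
  have h1 : der (D i) (wave D v) = -((Q ^ (i : ℕ) - pl (Q ^ (i : ℕ))) * wave D v) := by
    rw [sub_mul, pow_mul_of_mul_eq (root_eq_of_isGeneratedBy hn h hQ hQn), ← hfl, flow]
    abel
  have h2 := coeff_mul_top (ordLE_sub_pl (Q ^ (i : ℕ))) hW.ordLE
  have h3 := congrArg (coeff · (-1 : ℤ)) h1
  have h4 := coeff_wave (D := D) v 1
  rw [← xi_eq_coeff] at h4
  have h5 : xi D v 1 = D 1 v := by
    rw [xi_eq, ← eta_one hD v]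
    have := congrArg (PowerSeries.coeff 0) (derivative_expPS (PowerSeries.mk (eta D v)))
    rw [coeff_derivative_eq_smul, PowerSeries.coeff_mul, Finset.Nat.antidiagonal_zero,
      Finset.sum_singleton, coeff_derivative_eq_smul, coeff_zero_expPS, mul_one, PowerSeries.coeff_mk] at this
    simpa using this
  simp only [coeff_der, coeff_neg] at h3
  rw [add_zero, hW.lead, mul_one, coeff_sub, coeff_pl, if_neg (by omega), sub_zero] at h2
  rw [h2] at h3
  rw [← h3, ← h5, ← h4]
  simp

theorem der_der_one_unique (hD : ∀ i j a, D i (D j a) = D j (D i a)) {v v' : A} (hn : n ≠ 0)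
    (h : IsGeneratedBy D n L v) (h' : IsGeneratedBy D n L v') (i : ℕ+) :
    D i (D 1 v') = D i (D 1 v) := by
  obtain ⟨hLW, Q, hQ, hQn, hfl⟩ := (isGeneratedBy_iff v).mp h
  obtain ⟨hLW', Q', hQ', hQn', hfl'⟩ := (isGeneratedBy_iff v').mp h'
  obtain rfl := hQ'.eq_of_pow_eq hQ hn (hQn'.trans hQn.symm)
  rw [der_der_one_eq hD hn hLW hQ hQn hfl, der_der_one_eq hD hn hLW' hQ hQn' hfl']

/-- A change of `v` with constant first derivatives multiplies the wave operator from the right by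
an operator with constant coefficients. -/
theorem exists_wave_eq_mul (hD : ∀ i j a, D i (D j a) = D j (D i a)) {v v' : A}
    (h : ∀ i j, D i (D j v') = D i (D j v)) : ∃ C : Psi (D 1), (∀ i, der (D i) C = 0) ∧
      wave D v' = wave D v * C := by
  set c := v' - v with hc
  have hder : ∀ i, der (D i) (wave D c) = 0 := fun i => by
    rw [der_wave_eq_zero_iff hD]
    intro j
    rw [hc, map_sub, map_sub, h, sub_self]
  refine ⟨wave D c, hder, ?_⟩
  have hW := isUnip_wave (D := D) v
  have hC := isUnip_wave (D := D) c
  have hWC : OrdLE (wave D v * wave D c) 0 := by simpa using hW.ordLE.mul hC.ordLE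
  rw [Psi.ext_iff_of_ordLE_zero (isUnip_wave v').ordLE hWC]
  intro t
  have h1 := coeff_mul_sub hW.ordLE hC.ordLE t
  rw [add_zero, zero_sub] at h1
  rw [h1, coeff_wave, show v' = v + c by rw [hc]; abel, etaSeries_add hD, expPS_add,
    PowerSeries.coeff_mul]
  refine Finset.sum_congr rfl fun x _ => ?_
  rw [Finset.sum_eq_single (0, x.2)]
  · simp [coeff_wave]
  · rintro ⟨l, b⟩ hy hne
    rw [mem_antidiagonal] at hy
    rcases l with _ | l
    · exact absurd (show (0, b) = (0, x.2) by rw [← hy]; simp) hne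
    · have h2 : D 1 (coeff (wave D c) (0 - b)) = 0 := by
        rw [← coeff_der, hder, coeff_zero]
      rw [Function.iterate_succ_apply, h2, PsiDO.iterate_zero_of_derivation, mul_zero, mul_zero]
  · intro h
    simp at h

theorem isGeneratedBy_of_der_eq (hD : ∀ i j a, D i (D j a) = D j (D i a)) {v v' : A}
    (h : IsGeneratedBy D n L v) (hv : ∀ i j, D i (D j v') = D i (D j v)) :
    IsGeneratedBy D n L v' := by
  obtain ⟨hLW, Q, hQ, hQn, hfl⟩ := (isGeneratedBy_iff v).mp h
  obtain ⟨C, hC, hW⟩ := exists_wave_eq_mul hD hv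
  have hcomm : ∀ i : ℕ, C * dp (D 1) i = dp (D 1) i * C := by
    have h1 : Commute C (dp (D 1) 1) := by
      refine Psi.ext fun k => ?_
      rw [coeff_mul_dp, coeff_dp_one_mul, ← coeff_der, hC, coeff_zero, add_zero]
    intro i
    rw [← dp_one_pow]
    exact (h1.pow_right i)
  refine (isGeneratedBy_iff v').mpr ⟨?_, Q, hQ, hQn, fun i => ?_⟩
  · rw [hW, ← mul_assoc, hLW, mul_assoc, mul_assoc, hcomm]
  · rw [hW, ← mul_assoc, ← hfl, flow, flow, der_mul (hD i 1), hC, mul_zero, add_zero, add_mul,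
      mul_assoc, mul_assoc, hcomm]

end

section

open Psi
open PsiDO (IsRoot IsGDOperator)

variable {A : Type u} [CommRing A] [Algebra ℚ A]
variable {D : ℕ+ → Derivation ℚ A A} (hD : ∀ i j a, D i (D j a) = D j (D i a))

/-! ### The wave operator of a solution -/

theorem der_comm (hD : ∀ i j a, D i (D j a) = D j (D i a)) (i j : ℕ+) (P : Psi (D 1)) :
    der (D i) (der (D j) P) = der (D j) (der (D i) P) :=
  Psi.ext fun k => by simp only [coeff_der, hD i j]

/-- The Lax equation for `L` implies the Lax equation for its root. -/
theorem lax_root (hD : ∀ i j a, D i (D j a) = D j (D i a)) {n : ℕ} (hn : n ≠ 0) {Q B : Psi (D 1)}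
    (hQ : IsMonicOne Q) (i : ℕ+) (h : der (D i) (Q ^ n) = B * Q ^ n - Q ^ n * B) (j : ℕ) :
    der (D i) (Q ^ j) = B * Q ^ j - Q ^ j * B := by
  have h1 : der (D i) Q - (B * Q - Q * B) = 0 := by
    refine eq_zero_of_telescope hQ hQ
      (S := fun k => der (D i) (Q ^ k) - (B * Q ^ k - Q ^ k * B)) ?_ (fun k => ?_) hn ?_
    · rw [pow_zero, ← dp_zero, der_dp, dp_zero, mul_one, one_mul, sub_self, sub_self]
    · rw [pow_succ, der_mul (hD i 1)]
      noncomm_ring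
    · exact sub_eq_zero.mpr h
  induction j with
  | zero => rw [pow_zero, ← dp_zero, der_dp, dp_zero, mul_one, one_mul, sub_self]
  | succ j ih =>
    rw [pow_succ, der_mul (hD i 1), ih, sub_eq_zero.mp h1]
    noncomm_ring

/-- The zero curvature equations for the negative parts of the powers of `Q`. -/
theorem zero_curvature {Q : Psi (D 1)}
    (h : ∀ (i : ℕ+) (j : ℕ), der (D i) (Q ^ j) =
      pl (Q ^ (i : ℕ)) * Q ^ j - Q ^ j * pl (Q ^ (i : ℕ))) (i j : ℕ+) :
    der (D i) (Q ^ (j : ℕ) - pl (Q ^ (j : ℕ))) - der (D j) (Q ^ (i : ℕ) - pl (Q ^ (i : ℕ))) =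
      (Q ^ (j : ℕ) - pl (Q ^ (j : ℕ))) * (Q ^ (i : ℕ) - pl (Q ^ (i : ℕ))) -
      (Q ^ (i : ℕ) - pl (Q ^ (i : ℕ))) * (Q ^ (j : ℕ) - pl (Q ^ (j : ℕ))) := by
  have hi := ordLE_sub_pl (Q ^ (i : ℕ))
  have hj := ordLE_sub_pl (Q ^ (j : ℕ))
  have hBi := isDiff_pl (Q ^ (i : ℕ))
  have hBj := isDiff_pl (Q ^ (j : ℕ))
  have e1 := h i j
  have e2 := h j i
  have e3 : Q ^ (i : ℕ) * Q ^ (j : ℕ) = Q ^ (j : ℕ) * Q ^ (i : ℕ) := by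
    rw [← pow_add, ← pow_add, add_comm]
  rw [der_sub, der_sub, e1, e2]
  rw [← sub_eq_zero]
  -- The difference of the two sides is a differential operator of negative order.
  set X := Q ^ (i : ℕ)
  set Y := Q ^ (j : ℕ)
  have key : pl X * Y - Y * pl X - der (D i) (pl Y) - (pl Y * X - X * pl Y - der (D j) (pl X)) -
      ((Y - pl Y) * (X - pl X) - (X - pl X) * (Y - pl Y)) =
      pl X * pl Y - pl Y * pl X - der (D i) (pl Y) + der (D j) (pl X) := by
    have : X * Y - Y * X = 0 := by rw [e3, sub_self]
    calc _ = pl X * pl Y - pl Y * pl X - der (D i) (pl Y) + der (D j) (pl X) + (X * Y - Y * X) := by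
          noncomm_ring
      _ = _ := by rw [this, add_zero]
  refine IsDiff.eq_zero ?_ ?_
  · rw [key]
    have := (((hBi.mul hBj).sub (hBj.mul hBi)).sub (hBj.der (D i))).add (hBi.der (D j))
    exact this
  · have h1 := (hj.der (D i)).sub (hi.der (D j))
    rw [der_sub, der_sub, e1, e2] at h1
    exact h1.sub (((hj.mul hi).mono (by omega)).sub ((hi.mul hj).mono (by omega)))

/-- If closed forms are exact, then a flat connection by operators of negative order is trivial. -/
theorem exists_unip_of_zero_curvature (hD : ∀ i j a, D i (D j a) = D j (D i a))
    (hex : ClosedFormsExact D) {N : ℕ+ → Psi (D 1)} (hN : ∀ i, OrdLE (N i) (-1))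
    (hcurv : ∀ i j, der (D i) (N j) - der (D j) (N i) = N j * N i - N i * N j) :
    ∃ W, IsUnip W ∧ ∀ i, der (D i) W + N i * W = 0 := by
  obtain ⟨W, hW⟩ := exists_of_steps (d := D 1) (-1) (fun j X => IsUnip X ∧
      ∀ i, OrdLE (der (D i) X + N i * X) (-1 - j))
    ⟨1, ⟨ordLE_one, rfl⟩, fun i => by
      rw [← dp_zero, der_dp, dp_zero, mul_one, zero_add]
      simpa using hN i⟩ (fun j X hX => by
      set E : ℕ+ → Psi (D 1) := fun i => der (D i) X + N i * X with hE
      have hcl : ∀ i k, D i (-coeff (E k) (-1 - j)) = D k (-coeff (E i) (-1 - j)) := by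
        intro i k
        have h1 : der (D i) (E k) - der (D k) (E i) = N k * E i - N i * E k := by
          have h2 := congrArg (· * X) (hcurv i k)
          simp only [hE, der_add, der_mul (hD i 1), der_mul (hD k 1), der_comm hD i k]
          have h3 : der (D i) (N k) * X = der (D k) (N i) * X + (N k * N i - N i * N k) * X := by
            rw [← h2]; noncomm_ring
          rw [h3]
          noncomm_ring
        have h4 : ∀ k i, coeff (N k * E i) (-1 - j) = 0 := fun k i =>
          ((hN k).mul (hX.2 i)).coeff_eq_zero (by omega)
        have h5 := congrArg (coeff · (-1 - (j : ℤ))) h1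
        simp only [coeff_sub, coeff_der, h4, sub_zero] at h5
        rw [map_neg, map_neg, sub_eq_zero.mp h5]
      obtain ⟨ξ, hξ⟩ := hex _ hcl
      have hm : OrdLE (mon (D 1) ξ (-1 - j)) (-1 - j) := ordLE_mon _ _
      refine ⟨X + mon (D 1) ξ (-1 - j), ⟨⟨hX.1.ordLE.add (hm.mono (by omega)), ?_⟩,
        fun i => ?_⟩, ?_⟩
      · rw [coeff_add, hX.1.lead, coeff_mon, if_neg (by omega), add_zero]
      · have h1 : OrdLE (N i * mon (D 1) ξ (-1 - j)) (-1 - j - 1) :=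
          ((hN i).mul hm).mono (by omega)
        have h2 : OrdLE (E i + der (D i) (mon (D 1) ξ (-1 - j))) (-1 - j - 1) := by
          refine ((hX.2 i).add (hm.der _)).pred ?_
          rw [coeff_add, coeff_der, coeff_mon, if_pos rfl, hξ, add_neg_cancel]
        rw [show (-1 : ℤ) - ((j + 1 : ℕ) : ℤ) = -1 - j - 1 by push_cast; ring, der_add, mul_add]
        have := h2.add h1
        simp only [hE] at this
        convert this using 1
        abel
      · rw [add_sub_cancel_left]
        exact hm)
  refine ⟨W, ?_, fun i => ?_⟩
  · obtain ⟨X, ⟨hX, _⟩, h⟩ := hW 0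
    rw [Nat.cast_zero, sub_zero] at h
    refine ⟨?_, ?_⟩
    · have := (h.mono (show (-1 : ℤ) ≤ 0 by omega)).add hX.ordLE
      rwa [sub_add_cancel] at this
    · have := h.coeff_eq_zero (k := 0) (by omega)
      rw [coeff_sub, hX.lead] at this
      exact sub_eq_zero.mp this
  · refine eq_zero_of_ordLE (-1) fun j => ?_
    obtain ⟨X, ⟨_, hX⟩, h⟩ := hW j
    have h1 := ((hX i).add (h.der (D i))).add
      (((hN i).mul h).mono (show (-1 : ℤ) + (-1 - j) ≤ -1 - j by omega))
    rw [der_sub] at h1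
    convert h1 using 1
    noncomm_ring

theorem dp_one_mul_eq (W : Psi (D 1)) : dp (D 1) 1 * W = W * dp (D 1) 1 + der (D 1) W := by
  refine Psi.ext fun k => ?_
  rw [coeff_dp_one_mul, coeff_add, coeff_mul_dp, coeff_der]

/-- If closed forms are exact, every solution has a wave operator. -/
theorem exists_unip_of_isGDSolution (hD : ∀ i j a, D i (D j a) = D j (D i a))
    (hex : ClosedFormsExact D) {n : ℕ} (hn : n ≠ 0) {L : PsiDO A} (hL : IsGDSolution D n L) :
    ∃ W Q : Psi (D 1), IsUnip W ∧ IsMonicOne Q ∧ Q ^ n = of (D 1) L ∧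
      Q * W = W * dp (D 1) 1 ∧ ∀ i : ℕ+, flow D i W = pl (Q ^ (i : ℕ)) * W := by
  obtain ⟨hL, Q, hQ, hQn, hlax⟩ := isGDSolution_iff.mp hL
  have hlax' := fun (i : ℕ+) => lax_root hD hn hQ i (by rw [hQn]; exact hlax i)
  obtain ⟨W, hW, hder⟩ := exists_unip_of_zero_curvature hD hex
    (N := fun i => Q ^ (i : ℕ) - pl (Q ^ (i : ℕ))) (fun i => ordLE_sub_pl _)
    (zero_curvature hlax')
  have hQ0 : coeff Q 0 = 0 := by
    have h1 := hQ.coeff_pow_sub_one n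
    have h2 : coeff (Q ^ n) (n - 1) = 0 := by
      rw [hQn]
      exact hL.sublead
    rw [h2, ← Nat.cast_smul_eq_nsmul ℚ] at h1
    refine smul_right_injective_of_rat (q := (n : ℚ)) (Nat.cast_ne_zero.mpr hn) ?_
    rw [← h1, smul_zero]
  have hpl : pl Q = dp (D 1) 1 := by
    refine (isDiff_dp 1).eq_pl ?_
    refine OrdLE.pred (N := 0) (OrdLE.pred (N := 1) (hQ.ordLE.sub (ordLE_dp 1)) ?_) ?_
    · rw [coeff_sub, hQ.lead]
      exact sub_self _
    · rw [coeff_sub, hQ0, coeff_dp, if_neg (by norm_num), sub_zero]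
  have hQW : Q * W = W * dp (D 1) 1 := by
    have h1 := hder 1
    simp only [PNat.one_coe, pow_one, hpl] at h1
    rw [sub_mul, dp_one_mul_eq] at h1
    rw [← sub_eq_zero, ← h1]
    abel
  refine ⟨W, Q, hW, hQ, hQn, hQW, fun i => ?_⟩
  have h1 := hder i
  rw [sub_mul, pow_mul_of_mul_eq hQW] at h1
  rw [flow, ← sub_eq_zero, ← h1]
  abel

/-! ### Reconstruction of `v` from the wave operator -/

theorem coeff₂_mul {R : Type u} [CommRing R] (i j : ℕ) (f g : PowerSeries (PowerSeries R)) :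
    coeff₂ i j (f * g) = ∑ x ∈ antidiagonal j, ∑ y ∈ antidiagonal i,
      coeff₂ y.1 x.1 f * coeff₂ y.2 x.2 g := by
  rw [coeff₂, PowerSeries.coeff_mul, map_sum]
  exact Finset.sum_congr rfl fun x _ => PowerSeries.coeff_mul _ _ _

theorem ext_coeff₂ {R : Type u} [CommRing R] {f g : PowerSeries (PowerSeries R)}
    (h : ∀ i j, coeff₂ i j f = coeff₂ i j g) : f = g :=
  PowerSeries.ext fun j => PowerSeries.ext fun i => h i j

/-- The exchange of the two variables. -/
noncomputable def swapPS {R : Type u} [CommRing R] (f : PowerSeries (PowerSeries R)) :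
    PowerSeries (PowerSeries R) :=
  PowerSeries.mk fun j => PowerSeries.mk fun i => coeff₂ j i f

theorem coeff₂_swapPS {R : Type u} [CommRing R] (f : PowerSeries (PowerSeries R)) (i j : ℕ) :
    coeff₂ i j (swapPS f) = coeff₂ j i f := by
  rw [coeff₂, swapPS, PowerSeries.coeff_mk, PowerSeries.coeff_mk]

theorem swapPS_mul {R : Type u} [CommRing R] (f g : PowerSeries (PowerSeries R)) :
    swapPS (f * g) = swapPS f * swapPS g := by
  refine ext_coeff₂ fun i j => ?_
  rw [coeff₂_swapPS, coeff₂_mul, coeff₂_mul, Finset.sum_comm]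
  simp only [coeff₂_swapPS]

/-- The exponential is symmetric in its two variables only if the exponent is. -/
theorem swapPS_eq_of_expPS {R : Type u} [CommRing R] [Algebra ℚ R]
    {g : PowerSeries (PowerSeries R)} (h1 : ∀ i, coeff₂ i 0 g = 0) (h2 : ∀ j, coeff₂ 0 j g = 0)
    (h : swapPS (expPS g) = expPS g) : swapPS g = g := by
  have hg0 : PowerSeries.constantCoeff g = 0 := PowerSeries.ext fun i => by
    rw [← PowerSeries.coeff_zero_eq_constantCoeff_apply, map_zero]
    exact h1 i
  have hE0 := coeff₂_zero_expPS h2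
  let δ : Derivation ℚ (PowerSeries R) (PowerSeries R) :=
    (PowerSeries.derivative R).restrictScalars ℚ
  have hδ : ∀ f : PowerSeries (PowerSeries R),
      PowerSeries.derivative (PowerSeries R) (swapPS f) = swapPS (mapDer δ f) := fun f => by
    refine ext_coeff₂ fun i j => ?_
    rw [coeff₂_swapPS, coeff₂, coeff_derivative_eq_smul, PowerSeries.coeff_smul, coeff₂,
      coeff_mapDer]
    change _ = PowerSeries.coeff j (PowerSeries.derivative R _)
    rw [coeff_derivative_eq_smul]
    congr 1
    exact coeff₂_swapPS f i (j + 1)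
  have hswap : swapPS (expPS g) = expPS (swapPS g) := by
    refine eq_expPS ?_ ?_
    · rw [hδ, hδ, mapDer_expPS _ hg0, swapPS_mul]
    · refine PowerSeries.ext fun i => ?_
      rw [← PowerSeries.coeff_zero_eq_constantCoeff_apply, PowerSeries.coeff_one]
      exact (coeff₂_swapPS _ i 0).trans (hE0 i)
  refine expPS_injective (hswap.symm.trans h) ?_
  rw [hg0]
  refine PowerSeries.ext fun i => ?_
  rw [← PowerSeries.coeff_zero_eq_constantCoeff_apply, map_zero]
  exact (coeff₂_swapPS _ i 0).trans (h2 i)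

/-- The Fay identity makes `exp (T_s η - η)`, hence `T_s η - η`, symmetric in `s` and `κ`. -/
theorem shiftOp_symm_of_fay {η : PowerSeries A} (h0 : PowerSeries.constantCoeff η = 0)
    (h : Fay hD η) (i j : ℕ) :
    act D hD (shiftOp (-1) (i + 1)) (PowerSeries.coeff (j + 1) η) =
      act D hD (shiftOp (-1) (j + 1)) (PowerSeries.coeff (i + 1) η) := by
  set g := PowerSeries.map (taylor hD (-1)) η - PowerSeries.map (PowerSeries.C) η with hg
  have hcoeff : ∀ i j, coeff₂ i j g = act D hD (shiftOp (-1) i) (PowerSeries.coeff j η) -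
      if i = 0 then PowerSeries.coeff j η else 0 := fun i j => by
    rw [hg, coeff₂, map_sub, map_sub, PowerSeries.coeff_map, PowerSeries.coeff_map, coeff_taylor,
      PowerSeries.coeff_C]
  have h1 : ∀ i, coeff₂ i 0 g = 0 := fun i => by
    rw [hcoeff, PowerSeries.coeff_zero_eq_constantCoeff_apply, h0, map_zero, ite_self, sub_zero]
  have h2 : ∀ j, coeff₂ 0 j g = 0 := fun j => by
    rw [hcoeff, shiftOp_zero, act_one, if_pos rfl, sub_self]
  have hF0 : ∀ j, coeff₂ 0 (j + 1) (fayExp hD η) = 0 := fun j =>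
    (coeff₂_zero_expPS h2 (j + 1)).trans (if_neg (Nat.succ_ne_zero j))
  have hdiag : ∀ a i j, coeff₂ (i + 1 + a) (j + 1) (fayExp hD η) =
      coeff₂ (i + 1) (j + 1 + a) (fayExp hD η) := fun a => by
    induction a with
    | zero => intro i j; rfl
    | succ a ih =>
      intro i j
      have := h (i + a) j
      rw [show i + 1 + (a + 1) = i + a + 2 by ring, ← this, show i + a + 1 = i + 1 + a by ring,
        show j + 2 = (j + 1) + 1 by ring, ih, show j + 1 + 1 + a = j + 1 + (a + 1) by ring]
  have hsw : swapPS (expPS g) = expPS g := by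
    refine ext_coeff₂ fun i j => ?_
    rw [coeff₂_swapPS]
    change coeff₂ j i (fayExp hD η) = coeff₂ i j (fayExp hD η)
    rcases i with _ | i <;> rcases j with _ | j
    · rfl
    · rw [hF0, coeff₂_succ_zero_fayExp]
    · rw [hF0, coeff₂_succ_zero_fayExp]
    · have e1 := hdiag j 0 i
      have e2 := hdiag i 0 j
      rw [show 0 + 1 + j = j + 1 by ring] at e1
      rw [show 0 + 1 + i = i + 1 by ring] at e2
      rw [e1, e2]
      congr 1
      ring
  have := congrArg (coeff₂ (i + 1) (j + 1)) (swapPS_eq_of_expPS h1 h2 hsw)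
  rw [coeff₂_swapPS, hcoeff, hcoeff, if_neg (by omega), if_neg (by omega), sub_zero,
    sub_zero] at this
  exact this.symm

/-- `exp (∑ (y_i / i) s^i) d/ds exp (-∑ (y_i / i) s^i) = -∑ y_i s^{i - 1}`. -/
theorem sum_shiftOp_mul_deriv (r : ℕ) : ∑ x ∈ antidiagonal r,
    shiftOp 1 x.2 * (((x.1 : ℚ) + 1) • shiftOp (-1) (x.1 + 1)) = -MvPolynomial.X r.succPNat := by
  have h1 : PowerSeries.derivative Ops (expPS ((-1 : ℚ) • flowSeries)) *
      expPS ((1 : ℚ) • flowSeries) = PowerSeries.derivative Ops ((-1 : ℚ) • flowSeries) := by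
    rw [derivative_expPS, mul_assoc, ← expPS_add, ← add_smul, neg_add_cancel, zero_smul,
      expPS_zero, mul_one]
  have h2 := congrArg (PowerSeries.coeff r) h1
  rw [PowerSeries.coeff_mul, coeff_derivative_eq_smul] at h2
  simp only [coeff_derivative_eq_smul] at h2
  refine (Finset.sum_congr rfl fun x _ => mul_comm _ _).trans (h2.trans ?_)
  have : (r : ℚ) + 1 ≠ 0 := by positivity
  rw [PowerSeries.coeff_smul, flowSeries, PowerSeries.coeff_mk, neg_one_smul, smul_neg]
  push_cast
  rw [one_div, smul_inv_smul₀ this]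
  rfl

/-- If closed forms are exact, then the symmetry of `T_i η_j` allows to solve `-T_j v = η_j`. -/
theorem exists_potential (hex : ClosedFormsExact D) {η : ℕ → A}
    (h : ∀ i j, act D hD (shiftOp (-1) (i + 1)) (η (j + 1)) =
      act D hD (shiftOp (-1) (j + 1)) (η (i + 1))) :
    ∃ v, ∀ j, -act D hD (shiftOp (-1) (j + 1)) v = η (j + 1) := by
  -- Since `-d/ds (T_s v) = T_s (∑ s^{i-1} ∂_i v)`, the derivatives of `v` have to be
  -- `∑ s^{i-1} ∂_i v = T_s^{-1} (dη / ds)`.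
  let u : ℕ → A := fun a => ((a : ℚ) + 1) • η (a + 1)
  let w : ℕ → A := fun r => ∑ x ∈ antidiagonal r, act D hD (shiftOp 1 x.2) (u x.1)
  have hsum : ∀ r a, ∑ x ∈ antidiagonal r, act D hD (shiftOp 1 x.2)
      (((x.1 : ℚ) + 1) • act D hD (shiftOp (-1) (x.1 + 1)) a) = -D r.succPNat a := fun r a => by
    rw [← act_X hD, ← act_neg, ← sum_shiftOp_mul_deriv, act_sum]
    refine Finset.sum_congr rfl fun x _ => ?_
    rw [act_mul, act_smul]
  have h1 : ∀ r j, act D hD (shiftOp (-1) (j + 1)) (w r) = -D r.succPNat (η (j + 1)) := by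
    intro r j
    rw [map_sum, ← hsum]
    refine Finset.sum_congr rfl fun x _ => ?_
    rw [act_comm, map_smul, h]
  have h2 : ∀ l r, D l.succPNat (w r) = D r.succPNat (w l) := by
    intro l r
    rw [← neg_inj, ← hsum r (w l), map_sum, ← Finset.sum_neg_distrib]
    refine Finset.sum_congr rfl fun x _ => ?_
    rw [h1, ← act_der, Derivation.map_smul, smul_neg, map_neg]
  have h3 : ∀ r, ∑ x ∈ antidiagonal r, act D hD (shiftOp (-1) x.2) (w x.1) = u r := by
    intro r
    have e1 : ∀ x ∈ antidiagonal r, act D hD (shiftOp (-1) x.2) (w x.1) =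
        ∑ y ∈ antidiagonal x.1, act D hD (shiftOp (-1) x.2 * shiftOp 1 y.2) (u y.1) := by
      intro x _
      simp only [w, map_sum, act_mul]
    rw [Finset.sum_congr rfl e1, Finset.Nat.sum_antidiagonal_swap.symm]
    simp only [Prod.fst_swap, Prod.snd_swap]
    have e2 := PsiDO.sum_antidiagonal_assoc r fun i j k =>
      act D hD (shiftOp (-1) i * shiftOp 1 j) (u k)
    have e3 : ∀ x ∈ antidiagonal r, ∑ y ∈ antidiagonal x.2,
        act D hD (shiftOp (-1) x.1 * shiftOp 1 y.2) (u y.1) = ∑ y ∈ antidiagonal x.2,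
        act D hD (shiftOp (-1) x.1 * shiftOp 1 y.1) (u y.2) := fun x _ => by
      rw [← Finset.Nat.sum_antidiagonal_swap]
      rfl
    rw [Finset.sum_congr rfl e3, e2]
    simp only [← act_sum, shiftOp_add, neg_add_cancel, shiftOp_zero_left]
    rw [Finset.sum_eq_single (0, r)]
    · simp
    · rintro ⟨a, b⟩ hab hne
      rw [mem_antidiagonal] at hab
      rw [if_neg, act_zero]
      rintro rfl
      exact hne (by rw [← hab]; simp)
    · simp
  obtain ⟨v, hv⟩ := hex (fun i => w i.natPred) (fun i j => by
    have := h2 i.natPred j.natPred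
    rwa [PNat.succPNat_natPred, PNat.succPNat_natPred] at this)
  refine ⟨v, fun j => ?_⟩
  refine smul_right_injective_of_rat (q := (j : ℚ) + 1) (by positivity) ?_
  rw [smul_neg, act_shiftOp_succ, neg_one_smul, neg_neg]
  refine Eq.trans (Finset.sum_congr rfl fun x _ => ?_) (h3 j)
  rw [← act_der, hv, Nat.natPred_succPNat]

/-- If closed forms are exact, every operator satisfying the Sato equations is the wave operator
of some `v`. -/
theorem exists_wave_eq (hD : ∀ i j a, D i (D j a) = D j (D i a)) (hex : ClosedFormsExact D)
    {W : Psi (D 1)} (hW : IsUnip W) (hS : Sato D W) : ∃ v, wave D v = W := by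
  obtain ⟨η, h0, hη⟩ := exists_expPS_eq (E := PowerSeries.mk fun j : ℕ => coeff W (-j))
    (by rw [PowerSeries.constantCoeff_mk]; simpa using hW.lead)
  have hcoeff : ∀ j : ℕ, PowerSeries.coeff j (expPS η) = coeff W (-j) := fun j => by
    rw [hη, PowerSeries.coeff_mk]
  have hF : Fay hD η := by
    rw [← discreteKP_iff_fay]
    simp only [hcoeff]
    exact (sato_iff_discreteKP hD hW).mp hS
  obtain ⟨v, hv⟩ := exists_potential hD hex (η := fun j => PowerSeries.coeff j η)
    (shiftOp_symm_of_fay hD h0 hF)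
  refine ⟨v, (Psi.ext_iff_of_ordLE_zero (isUnip_wave v).ordLE hW.ordLE).mpr fun j => ?_⟩
  rw [coeff_wave, ← hcoeff]
  congr 1
  refine expPS_congr fun j => ?_
  rw [coeff_etaSeries_succ hD, hv]

theorem exists_isGeneratedBy (hD : ∀ i j a, D i (D j a) = D j (D i a)) (hex : ClosedFormsExact D)
    {m : ℕ+} {n : ℕ} (hm : (m : ℕ) = n) {L : PsiDO A} (hL : IsGDSolution D n L) :
    ∃ v, D m v = 0 ∧ IsGeneratedBy D n L v := by
  have hn : n ≠ 0 := hm ▸ m.ne_zero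
  obtain ⟨W, Q, hW, hQ, hQn, hQW, hfl⟩ := exists_unip_of_isGDSolution hD hex hn hL
  obtain ⟨v, rfl⟩ := exists_wave_eq hD hex hW fun i => ⟨_, isDiff_pl _, hfl i⟩
  have hv : IsGeneratedBy D n L v :=
    (isGeneratedBy_iff v).mpr ⟨by rw [← hQn, pow_mul_of_mul_eq hQW], Q, hQ, hQn, hfl⟩
  have hc := der_eq_zero_of_isGeneratedBy hD hm hL.1 hv
  obtain ⟨v', hv'⟩ := hex (fun i => if i = m then 0 else D i v) (fun i j => by
    split_ifs with h1 h2 h2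
    · simp
    · rw [map_zero, h1, hD, hc]
    · rw [map_zero, h2, hD, hc]
    · exact hD i j v)
  refine ⟨v', by rw [hv', if_pos rfl], isGeneratedBy_of_der_eq hD hv fun i j => ?_⟩
  rw [hv']
  split_ifs with h
  · rw [h, hc, map_zero]
  · rfl

end

section

variable {A : Type u} [CommRing A] [Algebra ℚ A]
variable {D : ℕ+ → Derivation ℚ A A} (hD : ∀ i j a, D i (D j a) = D j (D i a))

/-! ### Shifts of power series -/

theorem sum_antidiagonal_exchange {B : Type*} [AddCommMonoid B] (n : ℕ) (f : ℕ → ℕ → ℕ → ℕ → B) :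
    ∑ x ∈ antidiagonal n, ∑ y ∈ antidiagonal x.1, ∑ z ∈ antidiagonal x.2, f y.1 y.2 z.1 z.2 =
      ∑ x ∈ antidiagonal n, ∑ y ∈ antidiagonal x.1, ∑ z ∈ antidiagonal x.2,
        f y.1 z.1 y.2 z.2 := by
  simp only [Finset.sum_sigma']
  refine Finset.sum_nbij'
    (fun t => ⟨(t.2.1.1 + t.2.2.1, t.2.1.2 + t.2.2.2), (t.2.1.1, t.2.2.1), (t.2.1.2, t.2.2.2)⟩)
    (fun t => ⟨(t.2.1.1 + t.2.2.1, t.2.1.2 + t.2.2.2), (t.2.1.1, t.2.2.1), (t.2.1.2, t.2.2.2)⟩)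
    ?_ ?_ ?_ ?_ ?_
  iterate 2
    rintro ⟨⟨a, b⟩, ⟨c, e⟩, ⟨f, g⟩⟩ h
    simp only [Finset.mem_sigma, mem_antidiagonal, and_true] at h ⊢
    omega
  iterate 2
    rintro ⟨⟨a, b⟩, ⟨c, e⟩, ⟨f, g⟩⟩ h
    simp only [Finset.mem_sigma, mem_antidiagonal] at h
    obtain ⟨_, rfl, rfl⟩ := h
    rfl
  rintro ⟨⟨a, b⟩, ⟨c, e⟩, ⟨f, g⟩⟩ _
  rfl

/-- The substitution `∑ f_j s^j ↦ ∑ s^j T_{c s} f_j`, where `T_{c s}` is the shift of the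
coefficients by `x_r ↦ x_r + c s^r / r`. -/
noncomputable def shiftPS (c : ℚ) : PowerSeries A →+* PowerSeries A where
  toFun f := PowerSeries.mk fun n =>
    ∑ x ∈ antidiagonal n, act D hD (shiftOp c x.1) (PowerSeries.coeff x.2 f)
  map_one' := by
    ext n
    rw [PowerSeries.coeff_mk, Finset.sum_eq_single (n, 0), PowerSeries.coeff_one, if_pos rfl,
      act_shiftOp_unit, PowerSeries.coeff_one]
    · rintro ⟨a, b⟩ h hne
      rw [mem_antidiagonal] at h
      rw [PowerSeries.coeff_one, if_neg, map_zero]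
      rintro rfl
      exact hne (by rw [← h]; rfl)
    · simp
  map_mul' f g := by
    ext n
    rw [PowerSeries.coeff_mk, PowerSeries.coeff_mul]
    simp only [PowerSeries.coeff_mk, PowerSeries.coeff_mul, map_sum, act_shiftOp_mul,
      Finset.sum_mul_sum]
    rw [← sum_antidiagonal_exchange n fun a b c' e =>
      act D hD (shiftOp c a) (PowerSeries.coeff c' f) *
        act D hD (shiftOp c b) (PowerSeries.coeff e g)]
    refine Finset.sum_congr rfl fun x _ => ?_
    rw [Finset.sum_comm]
  map_zero' := by
    ext n
    simp
  map_add' f g := by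
    ext n
    simp [Finset.sum_add_distrib]

theorem coeff_shiftPS (c : ℚ) (f : PowerSeries A) (n : ℕ) :
    PowerSeries.coeff n (shiftPS hD c f) =
      ∑ x ∈ antidiagonal n, act D hD (shiftOp c x.1) (PowerSeries.coeff x.2 f) :=
  PowerSeries.coeff_mk n fun n =>
    ∑ x ∈ antidiagonal n, act D hD (shiftOp c x.1) (PowerSeries.coeff x.2 f)

theorem shiftPS_injective (c : ℚ) : Function.Injective (shiftPS hD c) := by
  rw [injective_iff_map_eq_zero]
  intro f hf
  ext n
  induction n using Nat.strong_induction_on with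
  | _ n ih =>
    have h := congrArg (PowerSeries.coeff n) hf
    rw [coeff_shiftPS, Finset.sum_eq_single (0, n), shiftOp_zero, act_one] at h
    · exact h
    · rintro ⟨a, b⟩ hab hne
      rw [mem_antidiagonal] at hab
      have ha : a ≠ 0 := by
        rintro rfl
        exact hne (by rw [← hab]; simp)
      rw [ih b (by dsimp only at hab; omega), map_zero, map_zero]
    · simp

theorem shiftPS_C (c : ℚ) {a : A} (h : ∀ i, D i a = 0) :
    shiftPS hD c (PowerSeries.C a) = PowerSeries.C a := by
  ext n
  rw [coeff_shiftPS, Finset.sum_eq_single (n, 0), PowerSeries.coeff_C, if_pos rfl,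
    PowerSeries.coeff_C]
  · rcases n with _ | n
    · simp
    · rw [act_shiftOp_eq_zero hD h, if_neg (by omega)]
  · rintro ⟨x, y⟩ hxy hne
    rw [mem_antidiagonal] at hxy
    rw [PowerSeries.coeff_C, if_neg, map_zero]
    rintro rfl
    exact hne (by rw [← hxy]; rfl)
  · simp

theorem shiftPS_X (c : ℚ) : shiftPS hD c PowerSeries.X = PowerSeries.X := by
  ext n
  rw [coeff_shiftPS]
  rcases n with _ | n
  · simp
  · rw [Finset.sum_eq_single (n, 1), PowerSeries.coeff_one_X, act_shiftOp_unit,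
      PowerSeries.coeff_X]
    · simp
    · rintro ⟨x, y⟩ hxy hne
      rw [mem_antidiagonal] at hxy
      rw [PowerSeries.coeff_X, if_neg, map_zero]
      rintro rfl
      exact hne (Prod.ext (Nat.add_right_cancel hxy) rfl)
    · simp

/-- The derivations `∂_i` on power series over `A`. -/
noncomputable def mapDers (D : ℕ+ → Derivation ℚ A A) (i : ℕ+) :
    Derivation ℚ (PowerSeries A) (PowerSeries A) := mapDer (D i)

theorem mapDers_comm (hD : ∀ i j a, D i (D j a) = D j (D i a)) (i j : ℕ+) (f : PowerSeries A) :
    mapDers D i (mapDers D j f) = mapDers D j (mapDers D i f) := by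
  ext l
  simp only [mapDers, coeff_mapDer, hD i j]

theorem coeff_act_mapDers (p : Ops) (f : PowerSeries A) (j : ℕ) :
    PowerSeries.coeff j (act (mapDers D) (mapDers_comm hD) p f) =
      act D hD p (PowerSeries.coeff j f) := by
  induction p using MvPolynomial.induction_on generalizing f with
  | C a =>
    rw [← MvPolynomial.algebraMap_eq, AlgHom.commutes, AlgHom.commutes,
      Module.algebraMap_end_apply, Module.algebraMap_end_apply, PowerSeries.coeff_smul]
  | add p q hp hq => rw [act_add, act_add, map_add, hp, hq]
  | mul_X p i hp => rw [act_mul, act_mul, hp, act_X, act_X, mapDers, coeff_mapDer]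

/-- The shift by `x_r ↦ x_r + (s^r + κ^r) / (2 r)` on power series in `s` and `κ`. -/
noncomputable def halfShift : PowerSeries (PowerSeries A) →+* PowerSeries (PowerSeries A) :=
  (shiftPS (mapDers_comm hD) (1 / 2)).comp (PowerSeries.map (shiftPS hD (1 / 2)))

theorem coeff₂_halfShift (f : PowerSeries (PowerSeries A)) (i j : ℕ) :
    coeff₂ i j (halfShift hD f) = ∑ x ∈ antidiagonal j, ∑ y ∈ antidiagonal i,
      act D hD (shiftOp (1 / 2) y.1 * shiftOp (1 / 2) x.1) (coeff₂ y.2 x.2 f) := by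
  rw [coeff₂, halfShift, RingHom.comp_apply, coeff_shiftPS, map_sum]
  refine Finset.sum_congr rfl fun x _ => ?_
  rw [coeff_act_mapDers, PowerSeries.coeff_map, coeff_shiftPS, map_sum]
  refine Finset.sum_congr rfl fun y _ => ?_
  rw [mul_comm, act_mul]
  rfl

theorem coeff₂_halfShift_of_eq {f : PowerSeries (PowerSeries A)} {P Q : ℕ → Ops} {v : A}
    (h : ∀ i j, coeff₂ i j f = act D hD (P i * Q j) v) (i j : ℕ) :
    coeff₂ i j (halfShift hD f) =
      act D hD ((∑ y ∈ antidiagonal i, shiftOp (1 / 2) y.1 * P y.2) *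
        ∑ x ∈ antidiagonal j, shiftOp (1 / 2) x.1 * Q x.2) v := by
  rw [coeff₂_halfShift, Finset.sum_mul_sum, act_sum, Finset.sum_comm]
  refine Finset.sum_congr rfl fun y _ => ?_
  rw [act_sum]
  refine Finset.sum_congr rfl fun x _ => ?_
  rw [h, ← act_mul]
  congr 2
  ring

theorem halfShift_injective : Function.Injective (halfShift hD) := by
  refine (shiftPS_injective (mapDers_comm hD) _).comp fun f g h => ?_
  ext1 j
  refine shiftPS_injective hD (1 / 2) ?_
  have := congrArg (PowerSeries.coeff j) h
  rwa [PowerSeries.coeff_map, PowerSeries.coeff_map] at this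

theorem halfShift_X : halfShift hD PowerSeries.X = PowerSeries.X := by
  rw [halfShift, RingHom.comp_apply, PowerSeries.map_X, shiftPS_X]

theorem halfShift_C_X : halfShift hD (PowerSeries.C PowerSeries.X) =
    PowerSeries.C PowerSeries.X := by
  rw [halfShift, RingHom.comp_apply, PowerSeries.map_C, shiftPS_X, shiftPS_C]
  intro i
  ext j
  rw [mapDers, coeff_mapDer, PowerSeries.coeff_X]
  split_ifs <;> simp

theorem coeff_expPS {R : Type u} [CommRing R] [Algebra ℚ R] {f : PowerSeries R}
    (h0 : PowerSeries.constantCoeff f = 0) {j M : ℕ} (hM : j ≤ M) :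
    PowerSeries.coeff j (expPS f) =
      ∑ m ∈ Finset.range (M + 1), (1 / (m.factorial : ℚ)) • PowerSeries.coeff j (f ^ m) := by
  have hf : f = PowerSeries.X * PowerSeries.mk fun i => PowerSeries.coeff (i + 1) f := by
    ext i
    rcases i with _ | i
    · simp [h0]
    · rw [PowerSeries.coeff_succ_X_mul, PowerSeries.coeff_mk]
  have h1 := sum_composition_eq (fun i => PowerSeries.coeff i f) (fun m => 1 / (m.factorial : ℚ))
    j M hM
  rw [← hf, sum_composition_eq_expPS] at h1
  rw [← h1]
  congr 2
  ext i
  rw [PowerSeries.coeff_mk]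

/-- An endomorphism of a ring of power series commutes with exponentials if, modulo every power of
the variable, it depends only on the argument modulo that power. -/
theorem map_expPS_of_coeff {R : Type u} [CommRing R] [Algebra ℚ R]
    (φ : PowerSeries R →+* PowerSeries R) (hφ : ∀ f g : PowerSeries R, ∀ j,
      (∀ b ≤ j, PowerSeries.coeff b f = PowerSeries.coeff b g) →
        PowerSeries.coeff j (φ f) = PowerSeries.coeff j (φ g)) {f : PowerSeries R}
    (h0 : PowerSeries.constantCoeff f = 0) : φ (expPS f) = expPS (φ f) := by
  have h1 : PowerSeries.constantCoeff (φ f) = 0 := by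
    rw [← PowerSeries.coeff_zero_eq_constantCoeff_apply, hφ f 0 0, map_zero, map_zero]
    intro b hb
    rw [Nat.le_zero.mp hb, PowerSeries.coeff_zero_eq_constantCoeff_apply, h0, map_zero]
  ext j
  rw [coeff_expPS h1 le_rfl, hφ _ (∑ m ∈ Finset.range (j + 1), (1 / (m.factorial : ℚ)) • f ^ m) j]
  · rw [map_sum, map_sum]
    refine Finset.sum_congr rfl fun m _ => ?_
    rw [map_rat_smul, map_pow, PowerSeries.coeff_smul]
  · intro b hb
    rw [coeff_expPS h0 hb, map_sum]
    refine Finset.sum_congr rfl fun m _ => ?_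
    rw [PowerSeries.coeff_smul]

theorem halfShift_expPS {f : PowerSeries (PowerSeries A)}
    (h0 : PowerSeries.constantCoeff f = 0) : halfShift hD (expPS f) = expPS (halfShift hD f) := by
  refine map_expPS_of_coeff _ (fun f g j h => PowerSeries.ext fun i => ?_) h0
  change coeff₂ i j _ = coeff₂ i j _
  rw [coeff₂_halfShift, coeff₂_halfShift]
  refine Finset.sum_congr rfl fun x hx => ?_
  rw [mem_antidiagonal] at hx
  simp only [coeff₂, h x.2 (by omega)]

/-! ### The symmetric form of the Fay identity -/

/-- Twice the even part (with respect to `y ↦ -y`) of `shiftOp (1 / 2) r`. -/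
noncomputable def evenOp (r : ℕ) : Ops := shiftOp (1 / 2) r + shiftOp (-(1 / 2)) r

/-- Twice the odd part (with respect to `y ↦ -y`) of `shiftOp (1 / 2) r`. -/
noncomputable def oddOp (r : ℕ) : Ops := shiftOp (1 / 2) r - shiftOp (-(1 / 2)) r

/-- The antisymmetric combination
`shiftOp (1/2) a * shiftOp (-1/2) b - shiftOp (-1/2) a * shiftOp (1/2) b`. -/
noncomputable def antiOp (a b : ℕ) : Ops :=
  (1 / 2 : ℚ) • (oddOp a * evenOp b - evenOp a * oddOp b)

theorem antiOp_eq (a b : ℕ) : antiOp a b = shiftOp (1 / 2) a * shiftOp (-(1 / 2)) b -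
    shiftOp (-(1 / 2)) a * shiftOp (1 / 2) b := by
  refine smul_right_injective_of_rat (q := 2) two_ne_zero ?_
  rw [antiOp, smul_smul, oddOp, evenOp, oddOp, evenOp, two_smul]
  norm_num
  ring

theorem antiOp_swap (a b : ℕ) : antiOp b a = -antiOp a b := by
  rw [antiOp_eq, antiOp_eq]
  ring

@[simp] theorem oddOp_zero : oddOp 0 = 0 := by simp [oddOp]

@[simp] theorem evenOp_zero : evenOp 0 = 2 := by
  rw [evenOp, shiftOp_zero, shiftOp_zero]
  norm_num

/-- The operator `∑_{l < j} antiOp (i + l) (j - 1 - l)`. -/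
noncomputable def diagOp : ℕ → ℕ → Ops
  | _, 0 => 0
  | i, j + 1 => diagOp (i + 1) j + antiOp i j

theorem diagOp_eq (i j : ℕ) : diagOp i j = ∑ l ∈ Finset.range j, antiOp (i + l) (j - 1 - l) := by
  induction j generalizing i with
  | zero => rfl
  | succ j ih =>
    rw [diagOp, ih, Finset.sum_range_succ']
    congr 1
    refine Finset.sum_congr rfl fun l hl => ?_
    congr 1
    · ring
    · omega

theorem diagOp_zero_left (j : ℕ) : diagOp 0 j = 0 := by
  have h : diagOp 0 j = -diagOp 0 j := by
    rw [diagOp_eq, ← Finset.sum_neg_distrib, ← Finset.sum_range_reflect]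
    refine Finset.sum_congr rfl fun l hl => ?_
    rw [Finset.mem_range] at hl
    rw [← antiOp_swap]
    congr 1 <;> omega
  exact self_eq_neg.mp h

/-- The exponent of the symmetric form of the Fay identity: minus the mixed second difference of `v`
in the directions of `s` and `κ`. -/
noncomputable def symExponent (v : A) : PowerSeries (PowerSeries A) :=
  PowerSeries.mk fun j => PowerSeries.mk fun i => -act D hD (oddOp i * oddOp j) v

theorem coeff₂_symExponent (v : A) (i j : ℕ) :
    coeff₂ i j (symExponent hD v) = -act D hD (oddOp i * oddOp j) v := by
  rw [coeff₂, symExponent, PowerSeries.coeff_mk, PowerSeries.coeff_mk]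

theorem sum_shiftOp_mul_ite (c : ℚ) (n : ℕ) :
    ∑ x ∈ antidiagonal n, shiftOp c x.1 * (if x.2 = 0 then 1 else 0) = shiftOp c n := by
  rw [Finset.sum_eq_single (n, 0)]
  · simp
  · rintro ⟨a, b⟩ hab hne
    rw [mem_antidiagonal] at hab
    rw [if_neg, mul_zero]
    rintro rfl
    exact hne (by rw [← hab]; rfl)
  · simp

theorem sum_shiftOp_mul_shiftOp (n : ℕ) :
    ∑ x ∈ antidiagonal n, shiftOp (1 / 2) x.1 * shiftOp (-1) x.2 = shiftOp (-(1 / 2)) n := by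
  rw [shiftOp_add]
  norm_num

theorem sum_shiftOp_mul_sub (n : ℕ) :
    ∑ x ∈ antidiagonal n, shiftOp (1 / 2) x.1 * (shiftOp (-1) x.2 - if x.2 = 0 then 1 else 0) =
      -oddOp n := by
  simp only [mul_sub, Finset.sum_sub_distrib, sum_shiftOp_mul_ite, sum_shiftOp_mul_shiftOp, oddOp]
  ring

theorem coeff₂_X_mul_sub {R : Type u} [CommRing R] (f : PowerSeries (PowerSeries R)) (i j : ℕ) :
    coeff₂ (i + 1) (j + 1) (PowerSeries.X * f - PowerSeries.C PowerSeries.X * f) =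
      coeff₂ (i + 1) j f - coeff₂ i (j + 1) f := by
  rw [coeff₂, map_sub, map_sub, PowerSeries.coeff_succ_X_mul, PowerSeries.coeff_C_mul,
    PowerSeries.coeff_succ_X_mul]
  rfl

theorem coeff₂_X_mul_X_mul {R : Type u} [CommRing R] (f : PowerSeries (PowerSeries R)) (i j : ℕ) :
    coeff₂ (i + 1) (j + 1) (PowerSeries.X * (PowerSeries.C PowerSeries.X * f)) = coeff₂ i j f := by
  rw [coeff₂, PowerSeries.coeff_succ_X_mul, PowerSeries.coeff_C_mul, PowerSeries.coeff_succ_X_mul]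
  rfl

theorem coeff₂_expPS_zero {R : Type u} [CommRing R] [Algebra ℚ R]
    (g : PowerSeries (PowerSeries R)) (i : ℕ) :
    coeff₂ i 0 (expPS g) = if i = 0 then 1 else 0 := by
  rw [coeff₂, coeff_zero_expPS, PowerSeries.coeff_one]

theorem coeff₂_expPS_one {R : Type u} [CommRing R] [Algebra ℚ R]
    (g : PowerSeries (PowerSeries R)) (i : ℕ) : coeff₂ i 1 (expPS g) = coeff₂ i 1 g := by
  have h := congrArg (coeff₂ i 0) (derivative_expPS g)
  rw [coeff₂, coeff_derivative_eq_smul, coeff₂, PowerSeries.coeff_mul, Finset.Nat.antidiagonal_zero,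
    Finset.sum_singleton, coeff_derivative_eq_smul, coeff_zero_expPS, mul_one] at h
  rw [coeff₂, coeff₂]
  simpa using h

/-- The coefficients of `s` in the exponential are those of the exponent. -/
theorem coeff₂_one_expPS {R : Type u} [CommRing R] [Algebra ℚ R]
    {g : PowerSeries (PowerSeries R)} (h : ∀ j, coeff₂ 0 j g = 0)
    (hg : ∀ i, coeff₂ i 0 g = 0) (j : ℕ) : coeff₂ 1 j (expPS g) = coeff₂ 1 j g := by
  rcases j with _ | j
  · rw [coeff₂_expPS_zero, hg, if_neg one_ne_zero]
  have h1 := congrArg (coeff₂ 1 j) (derivative_expPS g)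
  rw [coeff₂, coeff_derivative_eq_smul, PowerSeries.coeff_smul, coeff₂_mul] at h1
  refine smul_right_injective_of_rat (q := (j : ℚ) + 1) (by positivity) (h1.trans ?_)
  rw [Finset.sum_eq_single (j, 0)]
  · rw [Finset.sum_eq_single (1, 0), coeff₂_expPS_zero, if_pos rfl, mul_one, coeff₂,
      coeff_derivative_eq_smul, PowerSeries.coeff_smul]
    · rfl
    · rintro ⟨a, b⟩ hab hne
      rw [mem_antidiagonal] at hab
      rw [coeff₂_expPS_zero, if_neg, mul_zero]
      rintro rfl
      exact hne (by rw [← hab]; rfl)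
    · simp
  · rintro ⟨a, b⟩ hab hne
    rw [mem_antidiagonal] at hab
    have hb : b ≠ 0 := by
      rintro rfl
      exact hne (by rw [← hab]; rfl)
    refine Finset.sum_eq_zero ?_
    rintro ⟨c, e⟩ hce
    rw [mem_antidiagonal] at hce
    rcases c with _ | c
    · rw [coeff₂, coeff_derivative_eq_smul, PowerSeries.coeff_smul]
      have := h (a + 1)
      rw [coeff₂] at this
      rw [this, smul_zero, zero_mul]
    · obtain rfl : e = 0 := by dsimp only at hce; omega
      rw [coeff₂_zero_expPS h, if_neg hb, mul_zero]
  · simp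

theorem forall_coeff₂_sub_eq_iff {R : Type u} [CommRing R] {E M : PowerSeries (PowerSeries R)}
    (h1 : ∀ i, coeff₂ i 0 E = if i = 0 then 1 else 0)
    (h2 : ∀ j, coeff₂ 0 j E = if j = 0 then 1 else 0) :
    (∀ i j, coeff₂ (i + 1) j E - coeff₂ i (j + 1) E = coeff₂ i j M) ↔
      PowerSeries.X * E - PowerSeries.C PowerSeries.X * E = PowerSeries.X -
        PowerSeries.C PowerSeries.X + PowerSeries.X * (PowerSeries.C PowerSeries.X * M) := by
  have hR : ∀ i j, coeff₂ (i + 1) (j + 1) (PowerSeries.X - PowerSeries.C PowerSeries.X +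
      PowerSeries.X * (PowerSeries.C PowerSeries.X * M)) = coeff₂ i j M := fun i j => by
    have := coeff₂_X_mul_X_mul M i j
    rw [coeff₂] at this ⊢
    rw [map_add, map_add, this]
    simp only [map_sub, PowerSeries.coeff_X, PowerSeries.coeff_C]
    rw [if_neg (Nat.succ_ne_zero j)]
    split_ifs <;> simp [PowerSeries.coeff_one]
  constructor
  · intro h
    refine ext_coeff₂ fun i j => ?_
    rcases i with _ | i <;> rcases j with _ | j
    · simp [coeff₂]
    · have := h2 j
      simp only [coeff₂] at this ⊢
      simp only [map_sub, map_add, PowerSeries.coeff_succ_X_mul, PowerSeries.coeff_C_mul,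
        PowerSeries.coeff_zero_X_mul, this, PowerSeries.coeff_X, PowerSeries.coeff_C]
      rw [if_neg (Nat.succ_ne_zero j)]
      by_cases hj : j = 0 <;> simp [hj]
    · have := h1 i
      simp only [coeff₂] at this ⊢
      simp only [map_sub, map_add, PowerSeries.coeff_zero_X_mul, PowerSeries.coeff_C_mul,
        PowerSeries.coeff_succ_X_mul, this, PowerSeries.coeff_zero_X, PowerSeries.coeff_C]
      by_cases hi : i = 0 <;> simp [hi, PowerSeries.coeff_X]
    · rw [coeff₂_X_mul_sub, h, hR]
  · intro h i j
    rw [← coeff₂_X_mul_sub, h, hR]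

/-- The symmetric form of the Fay identity, with coefficients that are invariant under `y ↦ -y`. -/
theorem fay_iff_symmetric (v : A) : Fay hD (etaSeries D v) ↔ ∀ i j,
    coeff₂ (i + 1) j (expPS (symExponent hD v)) - coeff₂ i (j + 1) (expPS (symExponent hD v)) =
      act D hD (MvPolynomial.X 1 * antiOp i j) v := by
  set g := PowerSeries.map (taylor hD (-1)) (etaSeries D v) -
    PowerSeries.map (PowerSeries.C) (etaSeries D v) with hg
  have hF : fayExp hD (etaSeries D v) = expPS g := rfl
  let t : ℕ → Ops := fun i => shiftOp (-1) i - if i = 0 then 1 else 0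
  have ht0 : t 0 = 0 := by simp [t]
  have ht : ∀ i, t (i + 1) = shiftOp (-1) (i + 1) := fun i => by simp [t]
  have hcoeff : ∀ i j, coeff₂ i j g = act D hD (-t i * t j) v := fun i j => by
    rw [hg, coeff₂, map_sub, map_sub, PowerSeries.coeff_map, PowerSeries.coeff_map, coeff_taylor,
      PowerSeries.coeff_C]
    rcases j with _ | j
    · simp [ht0]
    · rw [coeff_etaSeries_succ hD, ht]
      rcases i with _ | i
      · simp [ht0]
      · rw [if_neg (by omega), sub_zero, map_neg, ht, ← act_mul, neg_mul, act_neg]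
  have hg1 : ∀ i, coeff₂ i 0 g = 0 := fun i => by rw [hcoeff, ht0, mul_zero, act_zero]
  have hg2 : ∀ j, coeff₂ 0 j g = 0 := fun j => by rw [hcoeff, ht0, neg_zero, zero_mul, act_zero]
  have hg0 : PowerSeries.constantCoeff g = 0 := PowerSeries.ext fun i => by
    rw [← PowerSeries.coeff_zero_eq_constantCoeff_apply, map_zero]
    exact hg1 i
  have hSg : halfShift hD g = symExponent hD v := by
    refine ext_coeff₂ fun i j => ?_
    rw [coeff₂_halfShift_of_eq hD (P := fun i => -t i) (Q := t) hcoeff, coeff₂_symExponent]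
    simp only [t, mul_neg, Finset.sum_neg_distrib, sum_shiftOp_mul_sub]
    rw [neg_neg, act_neg]
  -- The right-hand side is `∂ (T_κ v - T_s v)`.
  let M₁ : PowerSeries (PowerSeries A) := PowerSeries.mk fun j => PowerSeries.mk fun i =>
    act D hD ((if i = 0 then 1 else 0) * (MvPolynomial.X 1 * shiftOp (-1) j)) v
  let M₂ : PowerSeries (PowerSeries A) := PowerSeries.mk fun j => PowerSeries.mk fun i =>
    act D hD ((MvPolynomial.X 1 * shiftOp (-1) i) * (if j = 0 then 1 else 0)) v
  have hM₁ : ∀ i j, coeff₂ i j M₁ =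
      act D hD ((if i = 0 then 1 else 0) * (MvPolynomial.X 1 * shiftOp (-1) j)) v := fun i j => by
    rw [coeff₂, PowerSeries.coeff_mk, PowerSeries.coeff_mk]
  have hM₂ : ∀ i j, coeff₂ i j M₂ =
      act D hD ((MvPolynomial.X 1 * shiftOp (-1) i) * (if j = 0 then 1 else 0)) v := fun i j => by
    rw [coeff₂, PowerSeries.coeff_mk, PowerSeries.coeff_mk]
  have hSM : ∀ i j, coeff₂ i j (halfShift hD (M₁ - M₂)) =
      act D hD (MvPolynomial.X 1 * antiOp i j) v := fun i j => by
    rw [map_sub, coeff₂, map_sub, map_sub]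
    change coeff₂ i j _ - coeff₂ i j _ = _
    rw [coeff₂_halfShift_of_eq hD (P := fun i => if i = 0 then 1 else 0)
        (Q := fun j => MvPolynomial.X 1 * shiftOp (-1) j) hM₁,
      coeff₂_halfShift_of_eq hD (P := fun i => MvPolynomial.X 1 * shiftOp (-1) i)
        (Q := fun j => if j = 0 then 1 else 0) hM₂, ← act_sub]
    simp only [sum_shiftOp_mul_ite, mul_left_comm _ (MvPolynomial.X (1 : ℕ+) : Ops),
      ← Finset.mul_sum, sum_shiftOp_mul_shiftOp, antiOp_eq]
    congr 2
    ring
  have e1 : Fay hD (etaSeries D v) ↔ ∀ i j,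
      coeff₂ (i + 1) j (expPS g) - coeff₂ i (j + 1) (expPS g) = coeff₂ i j (M₁ - M₂) := by
    have hM : ∀ i j, coeff₂ i j (M₁ - M₂) =
        (if i = 0 then D 1 (act D hD (shiftOp (-1) j) v) else 0) -
        if j = 0 then D 1 (act D hD (shiftOp (-1) i) v) else 0 := fun i j => by
      rw [coeff₂, map_sub, map_sub]
      change coeff₂ i j _ - coeff₂ i j _ = _
      rw [hM₁, hM₂, ite_mul, one_mul, zero_mul, mul_ite, mul_one, mul_zero]
      congr 1
      · split_ifs <;> simp
      · split_ifs <;> simp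
    rw [Fay, hF]
    constructor
    · rintro h (_ | i) (_ | j)
      · rw [hM, coeff₂_expPS_zero, coeff₂_zero_expPS hg2]
        simp
      · rw [hM, coeff₂_one_expPS hg2 hg1, hcoeff, coeff₂_zero_expPS hg2, ht, ht, if_neg (by omega),
          if_pos rfl, if_neg (by omega), neg_mul, act_neg, act_mul, act_shiftOp_one]
        simp
      · rw [hM, coeff₂_expPS_zero, coeff₂_expPS_one, hcoeff, ht, ht, if_neg (by omega),
          if_pos rfl, if_neg (by omega), neg_mul, act_neg, mul_comm, act_mul, act_shiftOp_one]
        simp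
      · rw [hM, if_neg (by omega), if_neg (by omega), sub_zero, sub_eq_zero]
        exact (h i j).symm
    · intro h i j
      have := h (i + 1) (j + 1)
      rw [hM, if_neg (by omega), if_neg (by omega), sub_zero, sub_eq_zero] at this
      exact this.symm
  have hs2 : ∀ j, coeff₂ 0 j (symExponent hD v) = 0 := fun j => by
    rw [coeff₂_symExponent, oddOp_zero, zero_mul, act_zero, neg_zero]
  simp only [← hSM]
  rw [e1, forall_coeff₂_sub_eq_iff (coeff₂_expPS_zero g) (coeff₂_zero_expPS hg2),
    forall_coeff₂_sub_eq_iff (coeff₂_expPS_zero _) (coeff₂_zero_expPS hs2),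
    ← (halfShift_injective hD).eq_iff]
  simp only [map_sub, map_add, map_mul, halfShift_X, halfShift_C_X, halfShift_expPS hD hg0, hSg]

/-- The Fay identity, solved for the coefficients of the exponential. -/
theorem fay_iff_diagOp (v : A) : Fay hD (etaSeries D v) ↔ ∀ i j,
    coeff₂ (i + 1) (j + 2) (expPS (symExponent hD v)) =
      -act D hD (MvPolynomial.X 1 * diagOp (i + 1) (j + 2)) v := by
  have hs2 : ∀ j, coeff₂ 0 j (symExponent hD v) = 0 := fun j => by
    rw [coeff₂_symExponent, oddOp_zero, zero_mul, act_zero, neg_zero]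
  have hone : ∀ i, coeff₂ (i + 1) 1 (expPS (symExponent hD v)) =
      -act D hD (MvPolynomial.X 1 * diagOp (i + 1) 1) v := fun i => by
    have h1 : oddOp 1 = MvPolynomial.X 1 := by
      have h := shiftOp_succ (1 / 2) 0
      have h' := shiftOp_succ (-(1 / 2)) 0
      rw [Finset.Nat.antidiagonal_zero, Finset.sum_singleton, shiftOp_zero, mul_one, Nat.cast_zero,
        zero_add, one_smul, zero_add] at h h'
      rw [oddOp, h, h', ← sub_smul]
      norm_num
      rfl
    rw [coeff₂_expPS_one, coeff₂_symExponent, diagOp, diagOp, zero_add, antiOp, h1, evenOp_zero,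
      oddOp_zero, mul_zero, sub_zero, mul_comm (oddOp _) (MvPolynomial.X 1)]
    congr 4
    rw [mul_comm, ← MvPolynomial.C_mul', ← mul_assoc, ← map_ofNat MvPolynomial.C, ← map_mul]
    norm_num
  rw [fay_iff_symmetric]
  constructor
  · intro h
    have key : ∀ j i, coeff₂ (i + 1) j (expPS (symExponent hD v)) =
        -act D hD (MvPolynomial.X 1 * diagOp (i + 1) j) v := by
      intro j
      induction j with
      | zero =>
        intro i
        rw [coeff₂_expPS_zero, if_neg (by omega), diagOp, mul_zero, act_zero, neg_zero]
      | succ j ih =>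
        intro i
        have := h (i + 1) j
        rw [ih, sub_eq_iff_eq_add] at this
        rw [diagOp, mul_add, act_add, neg_add, this]
        abel
    exact fun i j => key (j + 2) i
  · intro h
    have key : ∀ i j, coeff₂ (i + 1) j (expPS (symExponent hD v)) =
        -act D hD (MvPolynomial.X 1 * diagOp (i + 1) j) v := by
      rintro i (_ | _ | j)
      · rw [coeff₂_expPS_zero, if_neg (by omega), diagOp, mul_zero, act_zero, neg_zero]
      · exact hone i
      · exact h i j
    intro i j
    rw [key]
    rcases i with _ | i
    · have h0 := diagOp_zero_left (j + 1)
      rw [diagOp, zero_add] at h0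
      rw [coeff₂_zero_expPS hs2, if_neg (by omega), sub_zero, ← act_neg, ← mul_neg,
        ← eq_neg_of_add_eq_zero_right h0]
    · rw [key, diagOp.eq_2 (i + 1), mul_add, act_add]
      abel

end

section

/-! ### Filtered pieces of polynomial rings -/

section Filtered

variable {σ τ : Type*}

/-- The span of the monomials in variables from `S` that have weight `m` with respect to `w`
(a degree together with a parity) and weight at least `o` with respect to `u`. -/
noncomputable def filtered (S : Set σ) (w : σ → ℕ × ZMod 2) (u : σ → ℕ) (m : ℕ × ZMod 2) (o : ℕ) :
    Submodule ℚ (MvPolynomial σ ℚ) :=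
  Submodule.span ℚ ((fun s : Multiset σ => (s.map MvPolynomial.X).prod) ''
    {s | (∀ x ∈ s, x ∈ S) ∧ (s.map w).sum = m ∧ o ≤ (s.map u).sum})

variable {S S' : Set σ} {w : σ → ℕ × ZMod 2} {u : σ → ℕ} {m m' : ℕ × ZMod 2} {o o' : ℕ}

theorem prod_mem_filtered {s : Multiset σ} (h1 : ∀ x ∈ s, x ∈ S) (h2 : (s.map w).sum = m)
    (h3 : o ≤ (s.map u).sum) :
    (s.map MvPolynomial.X).prod ∈ filtered S w u m o :=
  Submodule.subset_span ⟨s, ⟨h1, h2, h3⟩, rfl⟩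

theorem X_mem_filtered {x : σ} (hx : x ∈ S) :
    (MvPolynomial.X x : MvPolynomial σ ℚ) ∈ filtered S w u (w x) (u x) := by
  have := prod_mem_filtered (S := S) (w := w) (u := u) (s := {x}) (by simpa using hx) rfl le_rfl
  simpa using this

theorem one_mem_filtered : (1 : MvPolynomial σ ℚ) ∈ filtered S w u 0 0 := by
  simpa using prod_mem_filtered (S := S) (w := w) (u := u) (s := 0) (by simp) rfl le_rfl

theorem filtered_mono (hS : S ⊆ S') (ho : o' ≤ o) :
    filtered S w u m o ≤ filtered S' w u m o' :=
  Submodule.span_mono (Set.image_mono fun _ h => ⟨fun x hx => hS (h.1 x hx), h.2.1, ho.trans h.2.2⟩)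

theorem filtered_congr (h : m = m') {p : MvPolynomial σ ℚ} (hp : p ∈ filtered S w u m o) :
    p ∈ filtered S w u m' o := h ▸ hp

theorem mul_mem_filtered {p q : MvPolynomial σ ℚ} (hp : p ∈ filtered S w u m o)
    (hq : q ∈ filtered S w u m' o') : p * q ∈ filtered S w u (m + m') (o + o') := by
  have h := Submodule.mul_mem_mul hp hq
  rw [filtered, filtered, Submodule.span_mul_span] at h
  refine Submodule.span_mono ?_ h
  rintro _ ⟨_, ⟨s, hs, rfl⟩, _, ⟨t, ht, rfl⟩, rfl⟩
  refine ⟨s + t, ⟨fun x hx => ?_, ?_, ?_⟩, ?_⟩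
  · exact (Multiset.mem_add.mp hx).elim (hs.1 x) (ht.1 x)
  · rw [Multiset.map_add, Multiset.sum_add, hs.2.1, ht.2.1]
  · rw [Multiset.map_add, Multiset.sum_add]
    exact add_le_add hs.2.2 ht.2.2
  · simp only [Multiset.map_add, Multiset.prod_add]

theorem aeval_mem_filtered {T : Set τ} {w' : τ → ℕ × ZMod 2} {u' : τ → ℕ}
    {f : σ → MvPolynomial τ ℚ} (hf : ∀ x ∈ S, f x ∈ filtered T w' u' (w x) (u x))
    {p : MvPolynomial σ ℚ} (hp : p ∈ filtered S w u m o) :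
    MvPolynomial.aeval f p ∈ filtered T w' u' m o := by
  refine Submodule.span_induction ?_ ?_ ?_ ?_ hp
  · rintro _ ⟨s, hs, rfl⟩
    obtain ⟨h1, rfl, h3⟩ := hs
    refine filtered_mono subset_rfl h3 ?_
    dsimp only
    clear h3 hp
    induction s using Multiset.induction_on with
    | empty => simpa using one_mem_filtered
    | cons x s ih =>
      simp only [Multiset.map_cons, Multiset.prod_cons, Multiset.sum_cons]
      rw [map_mul, MvPolynomial.aeval_X]
      exact mul_mem_filtered (hf x (h1 x (Multiset.mem_cons_self x s)))
        (ih fun y hy => h1 y (Multiset.mem_cons_of_mem hy))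
  · rw [map_zero]
    exact Submodule.zero_mem _
  · intro x y _ _ hx hy
    rw [map_add]
    exact Submodule.add_mem _ hx hy
  · intro a x _ hx
    rw [map_smul]
    exact Submodule.smul_mem _ _ hx

theorem derivation_mem_filtered
    {δ : Derivation ℚ (MvPolynomial σ ℚ) (MvPolynomial σ ℚ)} {c : ℕ × ZMod 2}
    (hδ : ∀ x ∈ S, δ (MvPolynomial.X x) ∈ filtered S w u (w x + c) (u x + 1))
    {p : MvPolynomial σ ℚ} (hp : p ∈ filtered S w u m o) :
    δ p ∈ filtered S w u (m + c) (o + 1) := by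
  refine Submodule.span_induction ?_ ?_ ?_ ?_ hp
  · rintro _ ⟨s, hs, rfl⟩
    obtain ⟨h1, rfl, h3⟩ := hs
    refine filtered_mono subset_rfl (Nat.add_le_add_right h3 1) ?_
    dsimp only
    clear h3 hp
    induction s using Multiset.induction_on with
    | empty => simp
    | cons x s ih =>
      have hx := h1 x (Multiset.mem_cons_self x s)
      have hs : ∀ y ∈ s, y ∈ S := fun y hy => h1 y (Multiset.mem_cons_of_mem hy)
      simp only [Multiset.map_cons, Multiset.prod_cons, Multiset.sum_cons]
      rw [Derivation.leibniz, smul_eq_mul, smul_eq_mul]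
      refine Submodule.add_mem _ ?_ ?_
      · rw [add_assoc, add_assoc]
        exact mul_mem_filtered (X_mem_filtered hx) (ih hs)
      · have := mul_mem_filtered (prod_mem_filtered hs (rfl : (s.map w).sum = _)
          (le_refl (s.map u).sum)) (hδ x hx)
        convert this using 1
        congr 1
        · abel
        · ring
  · rw [map_zero]
    exact Submodule.zero_mem _
  · intro x y _ _ hx hy
    rw [map_add]
    exact Submodule.add_mem _ hx hy
  · intro a x _ hx
    rw [Derivation.map_smul]
    exact Submodule.smul_mem _ _ hx

theorem prod_X_eq_monomial (s : Multiset σ) [DecidableEq σ] :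
    (s.map MvPolynomial.X).prod =
      (MvPolynomial.monomial (Multiset.toFinsupp s) (1 : ℚ) : MvPolynomial σ ℚ) := by
  induction s using Multiset.induction_on with
  | empty => simp
  | cons x s ih =>
    rw [Multiset.map_cons, Multiset.prod_cons, ih, ← Multiset.singleton_add, map_add,
      Multiset.toFinsupp_singleton, MvPolynomial.X, MvPolynomial.monomial_mul, one_mul]

theorem mem_support_of_mem_filtered {p : MvPolynomial σ ℚ} (hp : p ∈ filtered S w u m o)
    {d : σ →₀ ℕ} (hd : d ∈ p.support) :
    (∀ x ∈ Finsupp.toMultiset d, x ∈ S) ∧ ((Finsupp.toMultiset d).map w).sum = m ∧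
      o ≤ ((Finsupp.toMultiset d).map u).sum := by
  classical
  rw [MvPolynomial.mem_support_iff] at hd
  by_contra hnot
  refine hd (Submodule.span_induction (p := fun p _ => p.coeff d = 0) ?_ ?_ ?_ ?_ hp)
  · rintro _ ⟨s, hs, rfl⟩
    dsimp only
    rw [prod_X_eq_monomial, MvPolynomial.coeff_monomial, if_neg]
    rintro rfl
    rw [Multiset.toFinsupp_toMultiset] at hnot
    exact hnot hs
  · exact MvPolynomial.coeff_zero d
  · intro x y _ _ hx hy
    rw [MvPolynomial.coeff_add, hx, hy, add_zero]
  · intro a x _ hx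
    rw [MvPolynomial.coeff_smul, hx, smul_zero]

end Filtered

/-! ### The Fay identity in jet variables -/

/-- The weight of `y_r`: its degree `r`, and an odd parity. -/
def opWeight (r : ℕ+) : ℕ × ZMod 2 := (r, 1)

/-- Operators of weight `m` and order at least `o`. -/
noncomputable abbrev opsFiltered (m : ℕ × ZMod 2) (o : ℕ) : Submodule ℚ Ops :=
  filtered Set.univ opWeight (fun _ => 1) m o

theorem X_mem_opsFiltered (r : ℕ) :
    (MvPolynomial.X r.succPNat : Ops) ∈ opsFiltered (r + 1, 1) 1 := by
  have h := X_mem_filtered (S := Set.univ) (w := opWeight) (u := fun _ => 1)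
    (Set.mem_univ r.succPNat)
  exact filtered_congr (Prod.ext (Nat.succPNat_coe r) rfl) h

theorem mem_of_add_one_smul_mem {V : Type*} [AddCommGroup V] [Module ℚ V] {W : Submodule ℚ V}
    (r : ℕ) {x : V} (h : ((r : ℚ) + 1) • x ∈ W) : x ∈ W :=
  (W.smul_mem_iff (by positivity : (r : ℚ) + 1 ≠ 0)).mp h

theorem oddOp_succ (r : ℕ) : ((r : ℚ) + 1) • oddOp (r + 1) =
    (1 / 2 : ℚ) • ∑ x ∈ antidiagonal r, MvPolynomial.X x.1.succPNat * evenOp x.2 := by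
  rw [oddOp, smul_sub, shiftOp_succ, shiftOp_succ, neg_smul, sub_neg_eq_add, ← smul_add,
    ← Finset.sum_add_distrib]
  simp only [evenOp, mul_add]

theorem evenOp_succ (r : ℕ) : ((r : ℚ) + 1) • evenOp (r + 1) =
    (1 / 2 : ℚ) • ∑ x ∈ antidiagonal r, MvPolynomial.X x.1.succPNat * oddOp x.2 := by
  rw [evenOp, smul_add, shiftOp_succ, shiftOp_succ, neg_smul, ← sub_eq_add_neg, ← smul_sub,
    ← Finset.sum_sub_distrib]
  simp only [oddOp, mul_sub]

theorem oddOp_evenOp_mem (r : ℕ) :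
    oddOp r ∈ opsFiltered (r, 1) 1 ∧ evenOp r ∈ opsFiltered (r, 0) 0 := by
  induction r using Nat.strong_induction_on with
  | _ r ih =>
    rcases r with _ | r
    · rw [oddOp_zero, evenOp_zero]
      refine ⟨Submodule.zero_mem _, ?_⟩
      rw [show (2 : Ops) = 1 + 1 from one_add_one_eq_two.symm]
      exact Submodule.add_mem _ one_mem_filtered one_mem_filtered
    · constructor
      · refine mem_of_add_one_smul_mem r ?_
        rw [oddOp_succ]
        refine Submodule.smul_mem _ _ (Submodule.sum_mem _ fun x hx => ?_)
        rw [mem_antidiagonal] at hx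
        have := mul_mem_filtered (X_mem_opsFiltered x.1) (ih x.2 (by omega)).2
        exact filtered_congr (Prod.ext (by simp; omega) (by rfl)) this
      · refine mem_of_add_one_smul_mem r ?_
        rw [evenOp_succ]
        refine Submodule.smul_mem _ _ (Submodule.sum_mem _ fun x hx => ?_)
        rw [mem_antidiagonal] at hx
        have := filtered_mono subset_rfl (Nat.zero_le _)
          (mul_mem_filtered (X_mem_opsFiltered x.1) (ih x.2 (by omega)).1)
        exact filtered_congr (Prod.ext (by simp; omega) (by rfl)) this

theorem evenOp_succ_mem (r : ℕ) : evenOp (r + 1) ∈ opsFiltered (r + 1, 0) 1 := by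
  refine mem_of_add_one_smul_mem r ?_
  rw [evenOp_succ]
  refine Submodule.smul_mem _ _ (Submodule.sum_mem _ fun x hx => ?_)
  rw [mem_antidiagonal] at hx
  have := filtered_mono subset_rfl (show 1 ≤ 1 + 1 by omega)
    (mul_mem_filtered (X_mem_opsFiltered x.1) (oddOp_evenOp_mem x.2).1)
  exact filtered_congr (Prod.ext (by simp; omega) (by rfl)) this

theorem oddOp_succ_sub_mem (r : ℕ) : oddOp (r + 1) -
    (1 / ((r : ℚ) + 1)) • MvPolynomial.X r.succPNat ∈ opsFiltered (r + 1, 1) 2 := by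
  refine mem_of_add_one_smul_mem r ?_
  have hr : (r : ℚ) + 1 ≠ 0 := by positivity
  rw [smul_sub, smul_smul, mul_one_div_cancel hr, one_smul, oddOp_succ,
    ← Finset.add_sum_erase _ _ (show (r, 0) ∈ antidiagonal r by simp), smul_add, evenOp_zero]
  have h2 : (1 / 2 : ℚ) • ((MvPolynomial.X r.succPNat : Ops) * 2) = MvPolynomial.X r.succPNat := by
    rw [mul_two, ← two_smul ℚ, smul_smul]
    norm_num
  rw [h2, add_sub_cancel_left]
  refine Submodule.smul_mem _ _ (Submodule.sum_mem _ ?_)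
  rintro ⟨a, b⟩ hx
  rw [Finset.mem_erase, mem_antidiagonal] at hx
  rcases b with _ | b
  · exact absurd (show (a, 0) = (r, 0) by rw [← hx.2]; rfl) hx.1
  · have := mul_mem_filtered (X_mem_opsFiltered a) (evenOp_succ_mem b)
    exact filtered_congr (Prod.ext (by simp; omega) (by rfl)) this

theorem antiOp_succ_mem (a b : ℕ) : antiOp (a + 1) (b + 1) ∈ opsFiltered (a + b + 2, 1) 2 := by
  refine Submodule.smul_mem _ _ (Submodule.sub_mem _ ?_ ?_)
  · have := mul_mem_filtered (oddOp_evenOp_mem (a + 1)).1 (evenOp_succ_mem b)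
    exact filtered_congr (Prod.ext (by simp; omega) (by rfl)) this
  · have := mul_mem_filtered (evenOp_succ_mem a) (oddOp_evenOp_mem (b + 1)).1
    exact filtered_congr (Prod.ext (by simp; omega) (by rfl)) this

theorem diagOp_sub_mem (a b : ℕ) :
    diagOp (a + 1) (b + 1) - oddOp (a + b + 1) ∈ opsFiltered (a + b + 1, 1) 2 := by
  induction b generalizing a with
  | zero =>
    have : diagOp (a + 1) (0 + 1) = oddOp (a + 0 + 1) := by
      rw [diagOp, diagOp, zero_add, antiOp, oddOp_zero, mul_zero, sub_zero, evenOp_zero, mul_two,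
        ← two_smul ℚ, smul_smul]
      norm_num
    rw [this, sub_self]
    exact Submodule.zero_mem _
  | succ b ih =>
    rw [diagOp, add_sub_right_comm]
    refine Submodule.add_mem _ ?_ ?_
    · have := ih (a + 1)
      rw [show a + 1 + b + 1 = a + (b + 1) + 1 by ring] at this
      exact filtered_congr (Prod.ext (by simp) (by rfl)) this
    · have := antiOp_succ_mem a b
      exact filtered_congr (Prod.ext (by simp; omega) (by rfl)) this

/-- Polynomials in symbols `X_s`, for a multiset `s = {i_1, …, i_k}`, standing for
`∂_{i_1} ⋯ ∂_{i_k} v`. -/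
abbrev Jets : Type := MvPolynomial (Multiset ℕ+) ℚ

/-- The linear map that sends the operator `y_{i_1} ⋯ y_{i_k}` to the jet variable
`∂_{i_1} ⋯ ∂_{i_k} v`. -/
noncomputable def jet : Ops →ₗ[ℚ] Jets :=
  (MvPolynomial.basisMonomials ℕ+ ℚ).constr ℚ fun d => MvPolynomial.X (Finsupp.toMultiset d)

theorem jet_prod (s : Multiset ℕ+) : jet (s.map MvPolynomial.X).prod = MvPolynomial.X s := by
  rw [prod_X_eq_monomial, jet]
  have := (MvPolynomial.basisMonomials ℕ+ ℚ).constr_basis ℚ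
    (fun d => (MvPolynomial.X (Finsupp.toMultiset d) : Jets)) (Multiset.toFinsupp s)
  rw [MvPolynomial.coe_basisMonomials, Multiset.toFinsupp_toMultiset] at this
  exact this

/-- The weight of a jet variable. -/
def jetWeight (s : Multiset ℕ+) : ℕ × ZMod 2 := (s.map opWeight).sum

/-- Jet polynomials of weight `m` in the variables from `S`. -/
noncomputable abbrev jetsFiltered (S : Set (Multiset ℕ+)) (m : ℕ × ZMod 2) : Submodule ℚ Jets :=
  filtered S jetWeight (fun _ => 0) m 0

theorem jet_mem {m : ℕ × ZMod 2} {o : ℕ} {p : Ops} (hp : p ∈ opsFiltered m o) :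
    jet p ∈ jetsFiltered {s | o ≤ s.card ∧ jetWeight s = m} m := by
  refine Submodule.span_induction ?_ ?_ ?_ ?_ hp
  · rintro _ ⟨s, ⟨_, rfl, h3⟩, rfl⟩
    rw [jet_prod]
    refine X_mem_filtered (w := jetWeight) (u := fun _ => 0) ⟨?_, rfl⟩
    simpa using h3
  · rw [map_zero]
    exact Submodule.zero_mem _
  · intro x y _ _ hx hy
    rw [map_add]
    exact Submodule.add_mem _ hx hy
  · intro a x _ hx
    rw [map_smul]
    exact Submodule.smul_mem _ _ hx

/-- The jet variables of order at least two and degree less than `N`. -/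
def lowJets (N : ℕ) : Set (Multiset ℕ+) := {s | 2 ≤ s.card ∧ (jetWeight s).1 < N}

theorem lowJets_mono {N M : ℕ} (h : N ≤ M) : lowJets N ⊆ lowJets M :=
  fun _ hs => ⟨hs.1, hs.2.trans_le h⟩

/-- The exponent of the symmetric Fay identity in jet variables. -/
noncomputable def jetExponent : PowerSeries (PowerSeries Jets) :=
  PowerSeries.mk fun j => PowerSeries.mk fun i => -jet (oddOp i * oddOp j)

theorem coeff₂_jetExponent (i j : ℕ) :
    coeff₂ i j jetExponent = -jet (oddOp i * oddOp j) := by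
  rw [coeff₂, jetExponent, PowerSeries.coeff_mk, PowerSeries.coeff_mk]

theorem coeff₂_jetExponent_mem (i j : ℕ) :
    coeff₂ i j jetExponent ∈ jetsFiltered (lowJets (i + j + 1)) (i + j, 0) := by
  rw [coeff₂_jetExponent]
  refine Submodule.neg_mem _ ?_
  have h := jet_mem (mul_mem_filtered (oddOp_evenOp_mem i).1 (oddOp_evenOp_mem j).1)
  have e : ((i : ℕ), (1 : ZMod 2)) + (j, 1) = (i + j, 0) := by
    ext
    · rfl
    · rfl
  rw [e] at h
  refine filtered_mono ?_ le_rfl h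
  rintro s ⟨h1, h2⟩
  exact ⟨h1, by rw [h2]; exact Nat.lt_succ_self _⟩

/-- The nonlinear terms of a coefficient of the exponential involve only variables of lower
degree. -/
theorem coeff₂_expPS_jetExponent_sub_mem (i j : ℕ) :
    coeff₂ i j (expPS jetExponent) ∈ jetsFiltered (lowJets (i + j + 1)) (i + j, 0) ∧
    coeff₂ i (j + 1) (expPS jetExponent) - coeff₂ i (j + 1) jetExponent ∈
      jetsFiltered (lowJets (i + j + 1)) (i + j + 1, 0) := by
  have h0 : ∀ j, coeff₂ 0 j jetExponent = 0 := fun j => by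
    rw [coeff₂_jetExponent, oddOp_zero, zero_mul, map_zero, neg_zero]
  induction j using Nat.strong_induction_on generalizing i with
  | _ j ih =>
    have hfirst : ∀ i, coeff₂ i j (expPS jetExponent) ∈
        jetsFiltered (lowJets (i + j + 1)) (i + j, 0) := by
      intro i
      rcases j with _ | j
      · rw [coeff₂_expPS_zero]
        split_ifs with h
        · subst h
          exact one_mem_filtered
        · exact Submodule.zero_mem _
      · have h1 := filtered_mono (lowJets_mono (show i + j + 1 ≤ i + (j + 1) + 1 by omega)) le_rfl
          (ih j (by omega) i).2
        have h2 := coeff₂_jetExponent_mem i (j + 1)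
        have := Submodule.add_mem _ h1 h2
        rwa [sub_add_cancel] at this
    refine ⟨hfirst i, mem_of_add_one_smul_mem j ?_⟩
    have h1 := congrArg (coeff₂ i j) (derivative_expPS jetExponent)
    rw [coeff₂, coeff_derivative_eq_smul, PowerSeries.coeff_smul, coeff₂_mul] at h1
    have hd : ∀ c l, coeff₂ c l (PowerSeries.derivative _ jetExponent) =
        ((l : ℚ) + 1) • coeff₂ c (l + 1) jetExponent := fun c l => by
      rw [coeff₂, coeff_derivative_eq_smul, PowerSeries.coeff_smul]
      rfl
    simp only [hd] at h1
    rw [← Finset.add_sum_erase _ _ (show (j, 0) ∈ antidiagonal j by simp),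
      Finset.sum_eq_single (i, 0)] at h1
    · rw [coeff₂_expPS_zero, if_pos rfl, mul_one] at h1
      rw [smul_sub, show ((j : ℚ) + 1) • coeff₂ i (j + 1) (expPS jetExponent) -
        ((j : ℚ) + 1) • coeff₂ i (j + 1) jetExponent = _ from sub_eq_iff_eq_add'.mpr h1]
      refine Submodule.sum_mem _ ?_
      rintro ⟨l, b⟩ hx
      rw [Finset.mem_erase, mem_antidiagonal] at hx
      obtain ⟨hne, hx⟩ := hx
      dsimp only at hx
      have hb : b ≠ 0 := by
        rintro rfl
        exact hne (by rw [← hx]; rfl)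
      refine Submodule.sum_mem _ ?_
      rintro ⟨c, e⟩ hy
      rw [mem_antidiagonal] at hy
      dsimp only at hy ⊢
      rcases Nat.eq_zero_or_pos e with rfl | he
      · rw [coeff₂_zero_expPS h0, if_neg hb, mul_zero]
        exact Submodule.zero_mem _
      · rw [smul_mul_assoc]
        refine Submodule.smul_mem _ _ ?_
        rcases Nat.eq_zero_or_pos j with rfl | hj
        · omega
        have h3 : coeff₂ e b (expPS jetExponent) ∈
            jetsFiltered (lowJets (e + b + 1)) (e + b, 0) := by
          rcases Nat.lt_or_ge b j with hbj | hbj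
          · exact (ih b hbj e).1
          · obtain rfl : b = j := by omega
            exact hfirst e
        have h4 := mul_mem_filtered
          (filtered_mono (lowJets_mono (show c + (l + 1) + 1 ≤ i + j + 1 by omega)) le_rfl
            (coeff₂_jetExponent_mem c (l + 1)))
          (filtered_mono (lowJets_mono (show e + b + 1 ≤ i + j + 1 by omega)) le_rfl h3)
        exact filtered_congr (Prod.ext (by simp; omega) (by rfl)) h4
    · rintro ⟨c, e⟩ hy hne
      rw [mem_antidiagonal] at hy
      rw [coeff₂_expPS_zero, if_neg, mul_zero]
      rintro rfl
      exact hne (by rw [← hy]; rfl)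
    · simp

/-- The polynomial `H` in the equation
`∂_i ∂_j v = (i j / (i + j - 1)) ∂ ∂_{i + j - 1} v + H`, where `i = a + 1` and `j = b + 1`. -/
noncomputable def jetRemainder (a b : ℕ) : Jets :=
  (((a : ℚ) + 1) * (b + 1)) • (coeff₂ (a + 1) (b + 1) (expPS jetExponent) +
    jet (MvPolynomial.X 1 * (diagOp (a + 1) (b + 1) -
      (1 / ((a : ℚ) + b + 1)) • MvPolynomial.X (a + b).succPNat)) +
    jet ((1 / (((a : ℚ) + 1) * (b + 1))) •
      (MvPolynomial.X a.succPNat * MvPolynomial.X b.succPNat)))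

/-- The jet variables of order at least three, or of order two and degree less than `N`. -/
def remainderJets (N : ℕ) : Set (Multiset ℕ+) :=
  {s | 2 ≤ s.card ∧ ((jetWeight s).1 < N ∨ 3 ≤ s.card)}

theorem jetRemainder_mem (a b : ℕ) :
    jetRemainder a b ∈ jetsFiltered (remainderJets (a + b + 2)) (a + b + 2, 0) := by
  refine Submodule.smul_mem _ _ ?_
  have hlow : lowJets (a + b + 2) ⊆ remainderJets (a + b + 2) := fun s hs => ⟨hs.1, Or.inl hs.2⟩
  have hhigh : ∀ p : Ops, p ∈ opsFiltered (a + b + 2, 0) 3 →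
      jet p ∈ jetsFiltered (remainderJets (a + b + 2)) (a + b + 2, 0) := fun p hp => by
    refine filtered_mono ?_ le_rfl (jet_mem hp)
    rintro s ⟨hs, _⟩
    exact ⟨by omega, Or.inr hs⟩
  have hX : ∀ r, (1 / ((r : ℚ) + 1)) • (MvPolynomial.X r.succPNat : Ops) ∈
      opsFiltered (r + 1, 1) 1 := fun r => Submodule.smul_mem _ _ (X_mem_opsFiltered r)
  have h1 : coeff₂ (a + 1) (b + 1) (expPS jetExponent) + jet (oddOp (a + 1) * oddOp (b + 1)) ∈
      jetsFiltered (remainderJets (a + b + 2)) (a + b + 2, 0) := by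
    have := (coeff₂_expPS_jetExponent_sub_mem (a + 1) b).2
    rw [coeff₂_jetExponent, sub_neg_eq_add] at this
    have := filtered_mono ((lowJets_mono (show a + 1 + b + 1 ≤ a + b + 2 by omega)).trans hlow)
      le_rfl this
    exact filtered_congr (Prod.ext (by simp; omega) (by rfl)) this
  have h2 : jet (MvPolynomial.X 1 * (diagOp (a + 1) (b + 1) -
      (1 / ((a : ℚ) + b + 1)) • MvPolynomial.X (a + b).succPNat)) ∈
      jetsFiltered (remainderJets (a + b + 2)) (a + b + 2, 0) := by
    refine hhigh _ ?_
    have h3 := oddOp_succ_sub_mem (a + b)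
    push_cast at h3
    have h4 := Submodule.add_mem _ (diagOp_sub_mem a b) h3
    rw [sub_add_sub_cancel] at h4
    have h5 := mul_mem_filtered (X_mem_opsFiltered 0) h4
    exact filtered_congr (Prod.ext (by simp; omega) (by rfl)) h5
  have h3 : jet (oddOp (a + 1) * oddOp (b + 1) - (1 / (((a : ℚ) + 1) * (b + 1))) •
      (MvPolynomial.X a.succPNat * MvPolynomial.X b.succPNat)) ∈
      jetsFiltered (remainderJets (a + b + 2)) (a + b + 2, 0) := by
    refine hhigh _ ?_
    have e : oddOp (a + 1) * oddOp (b + 1) - (1 / (((a : ℚ) + 1) * (b + 1))) •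
        (MvPolynomial.X a.succPNat * MvPolynomial.X b.succPNat) =
        (oddOp (a + 1) - (1 / ((a : ℚ) + 1)) • MvPolynomial.X a.succPNat) * oddOp (b + 1) +
        ((1 / ((a : ℚ) + 1)) • MvPolynomial.X a.succPNat) *
          (oddOp (b + 1) - (1 / ((b : ℚ) + 1)) • MvPolynomial.X b.succPNat) := by
      rw [sub_mul, mul_sub, smul_mul_smul_comm, one_div_mul_one_div]
      abel
    rw [e]
    have h4 := mul_mem_filtered (oddOp_succ_sub_mem a) (oddOp_evenOp_mem (b + 1)).1
    have h5 := mul_mem_filtered (hX a) (oddOp_succ_sub_mem b)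
    refine Submodule.add_mem _ ?_ ?_
    · exact filtered_congr (Prod.ext (by simp; omega) (by rfl)) h4
    · exact filtered_congr (Prod.ext (by simp; omega) (by rfl)) h5
  have h := Submodule.sub_mem _ (Submodule.add_mem _ h1 h2) h3
  convert h using 1
  rw [map_sub]
  abel

variable {A : Type u} [CommRing A] [Algebra ℚ A]
variable {D : ℕ+ → Derivation ℚ A A} (hD : ∀ i j a, D i (D j a) = D j (D i a))

/-- The evaluation of jet polynomials at `v`. -/
noncomputable def evalJets (D : ℕ+ → Derivation ℚ A A) (v : A) : Jets →ₐ[ℚ] A :=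
  MvPolynomial.aeval fun s => iterD D s.toList v

theorem evalJets_jet (p : Ops) (v : A) : evalJets D v (jet p) = act D hD p v := by
  induction p using MvPolynomial.induction_on' with
  | monomial d c =>
    have h : (MvPolynomial.monomial d c : Ops) =
        c • ((Finsupp.toMultiset d).map MvPolynomial.X).prod := by
      rw [prod_X_eq_monomial, Finsupp.toMultiset_toFinsupp, MvPolynomial.smul_monomial, smul_eq_mul,
        mul_one]
    rw [h, map_smul, map_smul, act_smul, jet_prod, evalJets, MvPolynomial.aeval_X,
      ← act_list_prod hD]
    congr 3
    rw [← Multiset.prod_coe, ← Multiset.map_coe, Multiset.coe_toList]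
  | add p q hp hq => rw [map_add, map_add, act_add, hp, hq]

theorem evalJets_coeff₂ (v : A) (i j : ℕ) : evalJets D v (coeff₂ i j (expPS jetExponent)) =
    coeff₂ i j (expPS (symExponent hD v)) := by
  have h := map_expPS (PowerSeries.map (evalJets D v).toRingHom) jetExponent
  have e : PowerSeries.map (PowerSeries.map (evalJets D v).toRingHom) jetExponent =
      symExponent hD v := by
    refine ext_coeff₂ fun i j => ?_
    rw [coeff₂_symExponent, ← evalJets_jet hD, coeff₂, PowerSeries.coeff_map,
      PowerSeries.coeff_map, ← map_neg, ← coeff₂_jetExponent]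
    rfl
  rw [e] at h
  rw [← h, coeff₂, coeff₂, PowerSeries.coeff_map, PowerSeries.coeff_map]
  rfl

/-- The Fay identity as a system of equations for the second derivatives of `v`. -/
theorem fay_iff_jets (v : A) : Fay hD (etaSeries D v) ↔ ∀ a b : ℕ,
    D a.succPNat (D (b + 1).succPNat v) =
      ((((a : ℚ) + 1) * (b + 2)) / (a + b + 2)) • D 1 (D (a + b + 1).succPNat v) +
        evalJets D v (jetRemainder a (b + 1)) := by
  rw [fay_iff_diagOp]
  refine forall₂_congr fun a b => ?_
  have hc : ((a : ℚ) + 1) * (b + 2) ≠ 0 := by positivity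
  rw [jetRemainder, map_smul, map_add, map_add, evalJets_jet hD, evalJets_jet hD,
    evalJets_coeff₂ hD, mul_sub, act_sub, mul_smul_comm, act_smul, act_smul, act_X_mul, act_X_mul,
    act_X_mul, act_X, act_X]
  push_cast
  have e1 : (b : ℚ) + 1 + 1 = b + 2 := by ring
  have e2 : (a : ℚ) + (b + 1) + 1 = a + b + 2 := by ring
  rw [e1, e2, ← add_assoc a b 1, smul_add, smul_add, smul_sub, smul_smul, smul_smul,
    mul_one_div_cancel hc, one_smul, mul_one_div]
  set E := coeff₂ (a + 1) (b + 2) (expPS (symExponent hD v))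
  set K := (D 1) (act D hD (diagOp (a + 1) (b + 2)) v)
  set c := ((a : ℚ) + 1) * (b + 2)
  set Y := (c / ((a : ℚ) + b + 2)) • (D 1) ((D (a + b + 1).succPNat) v)
  set Z := D a.succPNat (D (b + 1).succPNat v)
  rw [show Y + (c • E + (c • K - Y) + Z) = c • (E + K) + Z by rw [smul_add]; abel,
    right_eq_add, smul_eq_zero_iff_right hc, eq_neg_iff_add_eq_zero]

end

section

/-! ### The reduction -/

/-- Polynomials in symbols `X_{(s, t)}`, standing for `∂_s ∂^t v`. -/
abbrev Normal : Type := MvPolynomial (ℕ+ × ℕ+) ℚ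

/-- The weight of `∂_s ∂^t v`: its degree `s + t`, and the parity of its order `t + 1`. -/
def normalWeight (p : ℕ+ × ℕ+) : ℕ × ZMod 2 := ((p.1 : ℕ) + p.2, ((p.2 : ℕ) : ZMod 2) + 1)

/-- The polynomials of weight `m` in the variables `∂_s ∂^t v` with `s ≤ ν`, such that
`∑ (t_j - 1) ≥ o` in every monomial. -/
noncomputable abbrev normalFiltered (ν : ℕ) (m : ℕ × ZMod 2) (o : ℕ) : Submodule ℚ Normal :=
  filtered {p | (p.1 : ℕ) ≤ ν} normalWeight (fun p => (p.2 : ℕ) - 1) m o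

/-- The derivation `∂` in normal form. -/
noncomputable def normalD : Derivation ℚ Normal Normal :=
  MvPolynomial.mkDerivation ℚ fun p => MvPolynomial.X (p.1, p.2 + 1)

/-- The derivation `∂_i` in normal form, if `G i s` is the normal form of `∂_i ∂_s v`. -/
noncomputable def normalFlow (G : ℕ+ → ℕ+ → Normal) (i : ℕ+) : Derivation ℚ Normal Normal :=
  MvPolynomial.mkDerivation ℚ fun p => normalD^[(p.2 : ℕ)] (G i p.1)

/-- The normal form of `∂_{i_1} ⋯ ∂_{i_k} v`, `k ≥ 2`, if `G i s` is the normal form of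
`∂_i ∂_s v`. -/
noncomputable def normalForm (G : ℕ+ → ℕ+ → Normal) : List ℕ+ → Normal
  | [] => 0
  | [_] => 0
  | [i, j] => G i j
  | i :: j :: k :: I => normalFlow G i (normalForm G (j :: k :: I))

/-- Substitution of normal forms for jet variables. -/
noncomputable def normalize (G : ℕ+ → ℕ+ → Normal) : Jets →ₐ[ℚ] Normal :=
  MvPolynomial.aeval fun s => normalForm G s.toList

section Admissibility

variable {ν : ℕ} {m : ℕ × ZMod 2} {o : ℕ} {G : ℕ+ → ℕ+ → Normal}

theorem normalD_mem {p : Normal} (hp : p ∈ normalFiltered ν m o) :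
    normalD p ∈ normalFiltered ν (m + (1, 1)) (o + 1) := by
  refine derivation_mem_filtered (fun x hx => ?_) hp
  rw [normalD, MvPolynomial.mkDerivation_X]
  have h := X_mem_filtered (S := {p : ℕ+ × ℕ+ | (p.1 : ℕ) ≤ ν}) (w := normalWeight)
    (u := fun p => (p.2 : ℕ) - 1) (x := (x.1, x.2 + 1)) hx
  refine filtered_congr (Prod.ext ?_ ?_) (filtered_mono subset_rfl ?_ h)
  · simp [normalWeight]; omega
  · simp [normalWeight]
  · have := x.2.pos
    simp only [PNat.add_coe, PNat.one_coe]
    omega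

theorem normalD_iterate_mem {p : Normal} (hp : p ∈ normalFiltered ν m o) (t : ℕ) :
    normalD^[t] p ∈ normalFiltered ν (m + (t, (t : ZMod 2))) (o + t) := by
  induction t with
  | zero =>
    refine filtered_congr ?_ hp
    exact Prod.ext (by simp) (by simp)
  | succ t ih =>
    rw [Function.iterate_succ_apply']
    refine filtered_congr ?_ (normalD_mem ih)
    rw [add_assoc]
    congr 1
    exact Prod.ext rfl (by simp)

theorem normalFlow_mem (hG : ∀ i j : ℕ+, G i j ∈ normalFiltered ν ((i : ℕ) + j, 0) 0) (i : ℕ+)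
    {p : Normal} (hp : p ∈ normalFiltered ν m o) :
    normalFlow G i p ∈ normalFiltered ν (m + opWeight i) (o + 1) := by
  refine derivation_mem_filtered (fun x _ => ?_) hp
  rw [normalFlow, MvPolynomial.mkDerivation_X]
  have h := normalD_iterate_mem (hG i x.1) (x.2 : ℕ)
  refine filtered_congr (Prod.ext ?_ ?_) (filtered_mono subset_rfl ?_ h)
  · simp [normalWeight, opWeight]; omega
  · simp only [normalWeight, opWeight, Prod.snd_add, zero_add]
    rw [add_assoc, show (1 : ZMod 2) + 1 = 0 from rfl, add_zero]
  · have := x.2.pos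
    omega

theorem normalForm_mem (hG : ∀ i j : ℕ+, G i j ∈ normalFiltered ν ((i : ℕ) + j, 0) 0) (I : List ℕ+)
    (hI : 2 ≤ I.length) :
    normalForm G I ∈ normalFiltered ν (I.map opWeight).sum (I.length - 2) := by
  match I with
  | [] => simp at hI
  | [_] => simp at hI
  | [i, j] =>
    refine filtered_congr (Prod.ext ?_ ?_) (hG i j)
    · simp [opWeight]
    · simp [opWeight]; rfl
  | i :: j :: k :: I =>
    have h := normalFlow_mem hG i (normalForm_mem hG (j :: k :: I) (by simp))
    refine filtered_congr ?_ h
    rw [List.map_cons (l := j :: k :: I), List.sum_cons, add_comm]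

theorem normalize_mem (hG : ∀ i j : ℕ+, G i j ∈ normalFiltered ν ((i : ℕ) + j, 0) 0)
    {N : ℕ} {p : Jets} (hp : p ∈ jetsFiltered (remainderJets N) m) :
    normalize G p ∈ normalFiltered ν m 0 := by
  refine aeval_mem_filtered (fun s hs => ?_) hp
  have h := normalForm_mem hG s.toList (by rw [Multiset.length_toList]; exact hs.1)
  refine filtered_congr ?_ (filtered_mono subset_rfl (Nat.zero_le _) h)
  rw [jetWeight, ← Multiset.sum_coe, ← Multiset.map_coe, Multiset.coe_toList]

end Admissibility

/-- The normal form of `∂_{r + 1} ∂ v`, in terms of the normal forms `G` of lower degree, under the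
constraint `∂_{ν + 1} ∂_j v = 0`. -/
noncomputable def baseForm (ν : ℕ) (G : ℕ+ → ℕ+ → Normal) (r : ℕ) : Normal :=
  if r < ν then MvPolynomial.X (r.succPNat, 1)
  else if r = ν then 0
  else -((((ν : ℚ) + 1) * (r - ν + 1)) / (r + 1))⁻¹ • normalize G (jetRemainder ν (r - ν))

/-- The normal form of `∂_i ∂_j v`, in terms of the normal forms `G` of lower degree. -/
noncomputable def entryForm (ν : ℕ) (G : ℕ+ → ℕ+ → Normal) (i j : ℕ+) : Normal :=
  match j.natPred with
  | 0 => baseForm ν G i.natPred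
  | b + 1 => ((((i.natPred : ℚ) + 1) * (b + 2)) / (i.natPred + b + 2)) •
      baseForm ν G (i.natPred + b + 1) + normalize G (jetRemainder i.natPred (b + 1))

/-- The normal form of `∂_i ∂_j v` for the hierarchy of order `ν + 1`. -/
noncomputable def secondForm (ν : ℕ) (i j : ℕ+) : Normal :=
  entryForm ν (fun a b => if _h : (a : ℕ) + b < i + j then secondForm ν a b else 0) i j
termination_by (i : ℕ) + j

/-- The normal forms of degree less than `N`. -/
noncomputable def lowerForm (ν N : ℕ) (a b : ℕ+) : Normal :=
  if (a : ℕ) + b < N then secondForm ν a b else 0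

theorem secondForm_eq (ν : ℕ) (i j : ℕ+) :
    secondForm ν i j = entryForm ν (lowerForm ν ((i : ℕ) + j)) i j := by
  rw [secondForm]
  simp only [dite_eq_ite]
  rfl

theorem secondForm_one (ν r : ℕ) :
    secondForm ν r.succPNat 1 = baseForm ν (lowerForm ν (r + 2)) r := by
  rw [secondForm_eq, entryForm]
  simp
  rfl

theorem secondForm_succ (ν a b : ℕ) : secondForm ν a.succPNat (b + 1).succPNat =
    ((((a : ℚ) + 1) * (b + 2)) / (a + b + 2)) • secondForm ν (a + b + 1).succPNat 1 +
      normalize (lowerForm ν (a + b + 3)) (jetRemainder a (b + 1)) := by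
  rw [secondForm_eq, entryForm, secondForm_one]
  have : ((a.succPNat : ℕ+) : ℕ) + ((b + 1).succPNat : ℕ+) = a + b + 3 := by
    simp; omega
  simp only [this, Nat.natPred_succPNat]

theorem secondForm_mem (ν : ℕ) (i j : ℕ+) :
    secondForm ν i j ∈ normalFiltered ν ((i : ℕ) + j, 0) 0 := by
  induction h : (i : ℕ) + j using Nat.strong_induction_on generalizing i j with
  | _ N ih =>
    have hG : ∀ a b : ℕ+, lowerForm ν N a b ∈ normalFiltered ν ((a : ℕ) + b, 0) 0 := fun a b => by
      rw [lowerForm]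
      split_ifs with hab
      · exact ih _ hab a b rfl
      · exact Submodule.zero_mem _
    have hbase : ∀ r, baseForm ν (lowerForm ν N) r ∈ normalFiltered ν (r + 2, 0) 0 := fun r => by
      rw [baseForm]
      split_ifs with h1 h2
      · have h3 := X_mem_filtered (S := {p : ℕ+ × ℕ+ | (p.1 : ℕ) ≤ ν}) (w := normalWeight)
          (u := fun p => (p.2 : ℕ) - 1) (x := (r.succPNat, 1)) h1
        exact filtered_congr (Prod.ext (by simp [normalWeight]) (by simp [normalWeight]; rfl)) h3
      · exact Submodule.zero_mem _
      · have h3 := normalize_mem hG (jetRemainder_mem ν (r - ν))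
        rw [show ν + (r - ν) + 2 = r + 2 by omega] at h3
        exact Submodule.smul_mem _ _ h3
    obtain ⟨a, rfl⟩ : ∃ a : ℕ, i = a.succPNat := ⟨i.natPred, (PNat.succPNat_natPred i).symm⟩
    obtain ⟨b, rfl⟩ : ∃ b : ℕ, j = b.succPNat := ⟨j.natPred, (PNat.succPNat_natPred j).symm⟩
    rw [secondForm_eq, h, entryForm]
    rw [Nat.succPNat_coe, Nat.succPNat_coe] at h
    simp only [Nat.natPred_succPNat]
    rcases b with _ | b
    · have h1 := hbase a
      rwa [show a + 2 = N by omega] at h1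
    · have h1 := hbase (a + b + 1)
      have h2 := normalize_mem hG (jetRemainder_mem a (b + 1))
      rw [show a + b + 1 + 2 = N by omega] at h1
      rw [show a + (b + 1) + 2 = N by omega] at h2
      exact Submodule.add_mem _ (Submodule.smul_mem _ _ h1) h2

theorem lowerForm_mem (ν N : ℕ) (a b : ℕ+) :
    lowerForm ν N a b ∈ normalFiltered ν ((a : ℕ) + b, 0) 0 := by
  rw [lowerForm]
  split_ifs
  · exact secondForm_mem ν a b
  · exact Submodule.zero_mem _

variable {A : Type u} [CommRing A] [Algebra ℚ A]
variable {D : ℕ+ → Derivation ℚ A A} (hD : ∀ i j a, D i (D j a) = D j (D i a))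

/-- The evaluation of normal forms at `v`. -/
noncomputable def evalNormal (D : ℕ+ → Derivation ℚ A A) (v : A) : Normal →ₐ[ℚ] A :=
  MvPolynomial.aeval fun p => D p.1 ((D 1)^[(p.2 : ℕ)] v)

theorem evalNormal_X (v : A) (p : ℕ+ × ℕ+) :
    evalNormal D v (MvPolynomial.X p) = D p.1 ((D 1)^[(p.2 : ℕ)] v) :=
  MvPolynomial.aeval_X _ p

/-- A derivation of polynomials is intertwined with a derivation of `A` on a monomial as soon as
this holds for the variables of the monomial. -/
theorem evalNormal_prod (v : A) {δ : Derivation ℚ Normal Normal} {d : Derivation ℚ A A}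
    (s : Multiset (ℕ+ × ℕ+)) (h : ∀ x ∈ s, d (evalNormal D v (MvPolynomial.X x)) =
      evalNormal D v (δ (MvPolynomial.X x))) :
    d (evalNormal D v (s.map MvPolynomial.X).prod) =
      evalNormal D v (δ (s.map MvPolynomial.X).prod) := by
  induction s using Multiset.induction_on with
  | empty => simp
  | cons x s ih =>
    rw [Multiset.map_cons, Multiset.prod_cons, map_mul, Derivation.leibniz, Derivation.leibniz,
      h x (Multiset.mem_cons_self x s), ih fun y hy => h y (Multiset.mem_cons_of_mem hy)]
    simp only [smul_eq_mul, map_add, map_mul]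

theorem evalNormal_filtered {ν : ℕ} {m : ℕ × ZMod 2} {o : ℕ} (v : A)
    {δ : Derivation ℚ Normal Normal} {d : Derivation ℚ A A}
    (h : ∀ x : ℕ+ × ℕ+, (x.1 : ℕ) + x.2 ≤ m.1 → d (evalNormal D v (MvPolynomial.X x)) =
      evalNormal D v (δ (MvPolynomial.X x))) {p : Normal} (hp : p ∈ normalFiltered ν m o) :
    d (evalNormal D v p) = evalNormal D v (δ p) := by
  refine Submodule.span_induction ?_ ?_ ?_ ?_ hp
  · rintro _ ⟨s, ⟨_, rfl, _⟩, rfl⟩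
    refine evalNormal_prod v s fun x hx => h x ?_
    obtain ⟨t, rfl⟩ := Multiset.exists_cons_of_mem hx
    rw [Multiset.map_cons, Multiset.sum_cons, Prod.fst_add]
    exact Nat.le_add_right _ _
  · simp only [map_zero]
  · intro x y _ _ hx hy
    simp only [map_add, hx, hy]
  · intro a x _ hx
    simp only [map_smul, Derivation.map_smul, hx]

theorem evalNormal_normalD_iterate (hD : ∀ i j a, D i (D j a) = D j (D i a)) (v : A) (t : ℕ)
    (p : Normal) :
    (D 1)^[t] (evalNormal D v p) = evalNormal D v (normalD^[t] p) := by
  have h : ∀ p : Normal, D 1 (evalNormal D v p) = evalNormal D v (normalD p) := fun p => by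
    induction p using MvPolynomial.induction_on with
    | C a =>
      rw [← MvPolynomial.algebraMap_eq, AlgHom.commutes, Derivation.map_algebraMap,
        Derivation.map_algebraMap, map_zero]
    | add p q hp hq => simp only [map_add, hp, hq]
    | mul_X p x hp =>
      have hx : D 1 (evalNormal D v (MvPolynomial.X x)) =
          evalNormal D v (normalD (MvPolynomial.X x)) := by
        rw [evalNormal_X, normalD, MvPolynomial.mkDerivation_X, evalNormal_X, hD 1, PNat.add_coe,
          PNat.one_coe, Function.iterate_succ_apply']
      rw [map_mul, Derivation.leibniz, Derivation.leibniz, hx, hp]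
      simp only [smul_eq_mul, map_add, map_mul]
  induction t with
  | zero => rfl
  | succ t ih => rw [Function.iterate_succ_apply', Function.iterate_succ_apply', ih, h]

/-- If `∂_a ∂_b v` has the normal form `G a b` for `a + b < N`, then higher derivatives of degree
at most `N` have the normal forms computed from `G`. -/
theorem iterD_eq_of_lt (hD : ∀ i j a, D i (D j a) = D j (D i a)) {ν N : ℕ} {G : ℕ+ → ℕ+ → Normal}
    (hG : ∀ i j : ℕ+, G i j ∈ normalFiltered ν ((i : ℕ) + j, 0) 0) {v : A}
    (h : ∀ a b : ℕ+, (a : ℕ) + b < N → D a (D b v) = evalNormal D v (G a b)) (I : List ℕ+)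
    (hI : 2 ≤ I.length) (hN : (I.map fun i : ℕ+ => (i : ℕ)).sum ≤ N)
    (hN' : (I.map fun i : ℕ+ => (i : ℕ)).sum < N ∨ 3 ≤ I.length) :
    iterD D I v = evalNormal D v (normalForm G I) := by
  match I with
  | [] => simp at hI
  | [_] => simp at hI
  | [i, j] =>
    refine h i j ?_
    simpa using hN'
  | i :: j :: k :: I =>
    rw [List.map_cons, List.sum_cons] at hN
    have hi := i.pos
    have ih := iterD_eq_of_lt hD hG h (j :: k :: I) (by simp) (by omega) (Or.inl (by omega))
    change D i (iterD D (j :: k :: I) v) = _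
    rw [ih, normalForm]
    refine evalNormal_filtered v (fun x hx => ?_) (normalForm_mem hG (j :: k :: I) (by simp))
    have hw : ((j :: k :: I).map opWeight).sum.1 =
        ((j :: k :: I).map fun i : ℕ+ => (i : ℕ)).sum := by
      generalize j :: k :: I = J
      induction J with
      | nil => rfl
      | cons a J ih =>
        rw [List.map_cons, List.sum_cons, List.map_cons, List.sum_cons, Prod.fst_add, ih]
        rfl
    rw [hw] at hx
    have hx2 := x.2.pos
    have hc : D i ((D 1)^[(x.2 : ℕ)] (D x.1 v)) = (D 1)^[(x.2 : ℕ)] (D i (D x.1 v)) :=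
      Psi.iterate_comm (hD i 1) (x.2 : ℕ) (D x.1 v)
    rw [evalNormal_X, normalFlow, MvPolynomial.mkDerivation_X,
      Psi.iterate_comm (hD x.1 1), hc, h _ _ (by omega), evalNormal_normalD_iterate hD]

theorem jetWeight_coe (I : List ℕ+) :
    (jetWeight (I : Multiset ℕ+)).1 = (I.map fun i : ℕ+ => (i : ℕ)).sum := by
  induction I with
  | nil => rfl
  | cons a I ih =>
    rw [List.map_cons, List.sum_cons, ← ih, ← Multiset.cons_coe, jetWeight, Multiset.map_cons,
      Multiset.sum_cons, Prod.fst_add]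
    rfl

/-- Under the hypotheses of `iterD_eq_of_lt`, the substitution of normal forms is compatible with
evaluation. -/
theorem evalJets_eq_of_lt (hD : ∀ i j a, D i (D j a) = D j (D i a)) {ν N : ℕ}
    {G : ℕ+ → ℕ+ → Normal} (hG : ∀ i j : ℕ+, G i j ∈ normalFiltered ν ((i : ℕ) + j, 0) 0) {v : A}
    (h : ∀ a b : ℕ+, (a : ℕ) + b < N → D a (D b v) = evalNormal D v (G a b)) {e : ZMod 2}
    {p : Jets} (hp : p ∈ jetsFiltered (remainderJets N) (N, e)) :
    evalJets D v p = evalNormal D v (normalize G p) := by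
  refine Submodule.span_induction ?_ ?_ ?_ ?_ hp
  · rintro _ ⟨s, ⟨h1, h2, h3⟩, rfl⟩
    dsimp only
    have hx : ∀ x ∈ s, evalJets D v (MvPolynomial.X x) =
        evalNormal D v (normalize G (MvPolynomial.X x)) := fun x hx => by
      have hxN : (jetWeight x).1 ≤ N := by
        obtain ⟨t, rfl⟩ := Multiset.exists_cons_of_mem hx
        have := congrArg Prod.fst h2
        rw [Multiset.map_cons, Multiset.sum_cons, Prod.fst_add] at this
        dsimp only at this
        omega
      have hxS := h1 x hx
      rw [← Multiset.coe_toList x] at hxN hxS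
      obtain ⟨h3, h4⟩ := hxS
      rw [jetWeight_coe] at hxN h4
      rw [Multiset.coe_card] at h3 h4
      rw [evalJets, MvPolynomial.aeval_X, normalize, MvPolynomial.aeval_X]
      exact iterD_eq_of_lt hD hG h _ h3 hxN h4
    clear h1 h2 h3 hp
    induction s using Multiset.induction_on with
    | empty => simp
    | cons x s ih =>
      rw [Multiset.map_cons, Multiset.prod_cons, map_mul, map_mul, map_mul,
        hx x (Multiset.mem_cons_self x s), ih fun y hy => hx y (Multiset.mem_cons_of_mem hy)]
  · simp only [map_zero]
  · intro x y _ _ hx hy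
    simp only [map_add, hx, hy]
  · intro a x _ hx
    simp only [map_smul, hx]

/-- The second derivatives of `v` have their normal forms if and only if `v` satisfies the Fay
identity and the constraint `∂_n ∂_j v = 0`. -/
theorem secondForm_iff (ν : ℕ) (v : A) :
    (∀ i j, D i (D j v) = evalNormal D v (secondForm ν i j)) ↔
      Fay hD (etaSeries D v) ∧ ∀ j, D ν.succPNat (D j v) = 0 := by
  have hpnat : ∀ i : ℕ+, ∃ a : ℕ, i = a.succPNat := fun i =>
    ⟨i.natPred, (PNat.succPNat_natPred i).symm⟩
  have hrem : ∀ N, (∀ a b : ℕ+, (a : ℕ) + b < N → D a (D b v) = evalNormal D v (secondForm ν a b)) →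
      ∀ a b, a + b + 2 = N → evalNormal D v (normalize (lowerForm ν N) (jetRemainder a b)) =
        evalJets D v (jetRemainder a b) := by
    rintro N h a b rfl
    refine (evalJets_eq_of_lt hD (lowerForm_mem ν _) (fun c e hce => ?_)
      (jetRemainder_mem a b)).symm
    rw [lowerForm, if_pos hce, h c e hce]
  have hcoef : ∀ b : ℕ, ((((ν : ℚ) + 1) * (b + 2)) / (ν + b + 2)) ≠ 0 := fun b => by positivity
  -- The normal form of `∂_r ∂ v` for `r > n` is chosen such that that of `∂_n ∂_j v` vanishes.
  have hbase : ∀ b : ℕ, secondForm ν (ν + b + 1).succPNat 1 =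
      -((((ν : ℚ) + 1) * (b + 2)) / (ν + b + 2))⁻¹ •
        normalize (lowerForm ν (ν + b + 3)) (jetRemainder ν (b + 1)) := fun b => by
    rw [secondForm_one, baseForm, if_neg (by omega), if_neg (by omega),
      show ν + b + 1 - ν = b + 1 by omega]
    push_cast
    rw [show (ν : ℚ) + b + 1 - ν + 1 = b + 2 by ring, show (ν : ℚ) + b + 1 + 1 = ν + b + 2 by ring]
  constructor
  · intro h
    refine ⟨(fay_iff_jets hD v).mpr fun a b => ?_, fun j => ?_⟩
    · rw [h, secondForm_succ, map_add, map_smul, ← h, hD _ 1,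
        hrem _ (fun a b _ => h a b) _ _ (by omega)]
    · obtain ⟨b, rfl⟩ := hpnat j
      rw [h]
      rcases b with _ | b
      · change evalNormal D v (secondForm ν ν.succPNat 1) = 0
        rw [secondForm_one, baseForm, if_neg (lt_irrefl _), if_pos rfl, map_zero]
      · rw [secondForm_succ, hbase, smul_smul, mul_neg, mul_inv_cancel₀ (hcoef b), neg_one_smul,
          neg_add_cancel, map_zero]
  · rintro ⟨hF, hc⟩ i j
    have hF := (fay_iff_jets hD v).mp hF
    induction hN : (i : ℕ) + j using Nat.strong_induction_on generalizing i j with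
    | _ N ih =>
      have hlow : ∀ a b : ℕ+, (a : ℕ) + b < N → D a (D b v) = evalNormal D v (secondForm ν a b) :=
        fun a b hab => ih _ hab a b rfl
      have hone : ∀ r : ℕ, r + 2 = N →
          D r.succPNat (D 1 v) = evalNormal D v (secondForm ν r.succPNat 1) := by
        intro r hr
        rcases lt_trichotomy r ν with h | h | h
        · rw [secondForm_one, baseForm, if_pos h, evalNormal_X]
          rfl
        · subst h
          rw [hc, secondForm_one, baseForm, if_neg (lt_irrefl _), if_pos rfl, map_zero]
        · obtain ⟨b, rfl⟩ : ∃ b, r = ν + b + 1 := ⟨r - ν - 1, by omega⟩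
          have h1 := hF ν b
          rw [hc, ← hrem N hlow _ _ (by omega)] at h1
          rw [hbase, map_smul, ← hD 1, show ν + b + 3 = N by omega]
          rw [neg_smul, ← smul_neg, eq_inv_smul_iff₀ (hcoef b)]
          exact (eq_neg_of_add_eq_zero_left h1.symm)
      obtain ⟨a, rfl⟩ := hpnat i
      obtain ⟨b, rfl⟩ := hpnat j
      rw [Nat.succPNat_coe, Nat.succPNat_coe] at hN
      rcases b with _ | b
      · exact hone a (by omega)
      · rw [hF, secondForm_succ, map_add, map_smul, ← hone _ (by omega), hD _ 1,
          show a + b + 3 = N by omega, hrem N hlow _ _ (by omega)]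

end

section

/-! ### The coefficients of the system -/

/-- The coefficients of the monomials in the normal forms of `∂_{i_1} ⋯ ∂_{i_k} v`. -/
noncomputable def systemCoeff (ν : ℕ) : Coefficients := fun I =>
  if 2 ≤ I.length then
    ∑ d ∈ (normalForm (secondForm ν) I).support, Finsupp.single (Finsupp.toMultiset d).toList
      ((normalForm (secondForm ν) I).coeff d)
  else 0

theorem list_map_fst_normalWeight (M : List (ℕ+ × ℕ+)) : (M.map normalWeight).sum.1 =
    (M.map fun p => (p.1 : ℕ) + (p.2 : ℕ)).sum := by
  induction M with
  | nil => rfl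
  | cons p M ih => simp only [List.map_cons, List.sum_cons, Prod.fst_add, ih]; rfl

theorem list_map_snd_normalWeight (M : List (ℕ+ × ℕ+)) : (M.map normalWeight).sum.2 =
    ((M.length + (M.map fun p => (p.2 : ℕ)).sum : ℕ) : ZMod 2) := by
  induction M with
  | nil => rfl
  | cons p M ih =>
    simp only [List.map_cons, List.sum_cons, Prod.snd_add, ih, List.length_cons, normalWeight]
    push_cast
    ring

theorem list_map_snd_sub_one (M : List (ℕ+ × ℕ+)) :
    (M.map fun p => (p.2 : ℕ) - 1).sum + M.length = (M.map fun p => (p.2 : ℕ)).sum := by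
  induction M with
  | nil => rfl
  | cons p M ih =>
    have := p.2.pos
    simp only [List.map_cons, List.sum_cons, List.length_cons, ← ih]
    omega

theorem list_map_opWeight (I : List ℕ+) : (I.map opWeight).sum =
    ((I.map fun i : ℕ+ => (i : ℕ)).sum, (I.length : ZMod 2)) := by
  induction I with
  | nil => rfl
  | cons i I ih =>
    simp only [List.map_cons, List.sum_cons, ih, List.length_cons, opWeight]
    exact Prod.ext rfl (by push_cast; rw [Prod.snd_add, add_comm])

theorem systemCoeff_admissible (ν : ℕ) : (systemCoeff ν).Admissible (ν + 1) := by
  intro I hI M hM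
  rw [systemCoeff, if_pos hI, Finsupp.finsetSum_apply] at hM
  obtain ⟨d, hd, hdM⟩ := Finset.exists_ne_zero_of_sum_ne_zero hM
  rw [Finsupp.single_apply] at hdM
  obtain rfl : (Finsupp.toMultiset d).toList = M := by
    by_contra h
    rw [if_neg h] at hdM
    exact hdM rfl
  obtain ⟨h1, h2, h3⟩ := mem_support_of_mem_filtered
    (normalForm_mem (secondForm_mem ν) I hI) hd
  rw [← Multiset.coe_toList (Finsupp.toMultiset d)] at h1 h2 h3
  generalize (Finsupp.toMultiset d).toList = M at *
  rw [Multiset.map_coe, Multiset.sum_coe, list_map_opWeight] at h2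
  rw [Multiset.map_coe, Multiset.sum_coe] at h3
  have hw := congrArg Prod.fst h2
  have hp := congrArg Prod.snd h2
  rw [list_map_fst_normalWeight] at hw
  rw [list_map_snd_normalWeight] at hp
  have ht := list_map_snd_sub_one M
  dsimp only at hw hp
  refine ⟨?_, fun p hp => ?_, ?_, ?_, ?_⟩
  · rcases M with _ | ⟨p, M⟩
    · rcases I with _ | ⟨i, I⟩
      · simp at hI
      · rw [List.map_cons, List.sum_cons] at hw
        have := i.pos
        simp only [List.map_nil, List.sum_nil] at hw
        omega
    · simp
  · exact Nat.lt_succ_of_le (h1 p (Multiset.mem_coe.mpr hp))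
  · rw [hw]
    simp only [List.map_id', List.bind_eq_flatMap, List.pure_def]
    rw [← List.map_eq_flatMap]
  · omega
  · rw [add_assoc, ← ZMod.natCast_eq_natCast_iff, Nat.cast_add, hp, Nat.cast_zero]
    exact CharTwo.add_self_eq_zero _

variable {A : Type u} [CommRing A] [Algebra ℚ A]
variable {D : ℕ+ → Derivation ℚ A A} (hD : ∀ i j a, D i (D j a) = D j (D i a))

theorem evalNormal_eq_sum (v : A) (p : Normal) : evalNormal D v p =
    ∑ d ∈ p.support, p.coeff d •
      ((Finsupp.toMultiset d).toList.map fun p => D p.1 ((D 1)^[(p.2 : ℕ)] v)).prod := by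
  conv_lhs => rw [← MvPolynomial.support_sum_monomial_coeff p, map_sum]
  refine Finset.sum_congr rfl fun d _ => ?_
  have h : (MvPolynomial.monomial d (p.coeff d) : Normal) =
      p.coeff d • ((Finsupp.toMultiset d).map MvPolynomial.X).prod := by
    rw [prod_X_eq_monomial, Finsupp.toMultiset_toFinsupp, MvPolynomial.smul_monomial, smul_eq_mul,
      mul_one]
  rw [h, map_smul, map_multiset_prod, Multiset.map_map, ← Multiset.prod_coe, ← Multiset.map_coe,
    Multiset.coe_toList]
  congr 3
  exact funext fun x => evalNormal_X v x

theorem satisfiesSystem_iff (hD : ∀ i j a, D i (D j a) = D j (D i a)) (ν : ℕ) (v : A) :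
    SatisfiesSystem D (systemCoeff ν) v ↔
      ∀ i j, D i (D j v) = evalNormal D v (secondForm ν i j) := by
  have h1 : ∀ I : List ℕ+, 2 ≤ I.length → ((systemCoeff ν I).sum fun M c =>
      c • (M.map fun p => D p.1 ((D 1)^[(p.2 : ℕ)] v)).prod) =
        evalNormal D v (normalForm (secondForm ν) I) := fun I hI => by
    rw [systemCoeff, if_pos hI, evalNormal_eq_sum, ← Finsupp.sum_finsetSum_index]
    · exact Finset.sum_congr rfl fun d _ => Finsupp.sum_single_index (zero_smul _ _)
    · exact fun _ => zero_smul _ _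
    · exact fun _ _ _ => add_smul _ _ _
  constructor
  · intro h i j
    have := h [i, j] le_rfl
    rwa [h1 _ le_rfl] at this
  · intro h I hI
    rw [h1 I hI]
    exact iterD_eq_of_lt hD (secondForm_mem ν) (fun a b _ => h a b) I hI (Nat.le_succ _)
      (Or.inl (Nat.lt_succ_self _))

theorem satisfiesSystem_iff_exists (hD : ∀ i j a, D i (D j a) = D j (D i a)) (ν : ℕ) (v : A) :
    SatisfiesSystem D (systemCoeff ν) v ↔
      ∃ L : PsiDO A, IsGDSolution D (ν + 1) L ∧ IsGeneratedBy D (ν + 1) L v := by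
  rw [satisfiesSystem_iff hD, secondForm_iff hD, ← sato_wave_iff hD]
  constructor
  · rintro ⟨hS, hc⟩
    exact exists_solution_of_sato hD (Nat.succPNat_coe ν) hS fun j => by rw [hD, hc]
  · rintro ⟨L, hL, hv⟩
    refine ⟨sato_of_isGeneratedBy hv, fun j => ?_⟩
    rw [hD]
    exact der_eq_zero_of_isGeneratedBy hD (Nat.succPNat_coe ν) hL.1 hv j

/-- The derivatives `∂_i ∂ v`, which are determined by `L`, determine all second derivatives. -/
theorem der_der_unique (hD : ∀ i j a, D i (D j a) = D j (D i a)) {ν : ℕ} {L : PsiDO A} {v v' : A}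
    (hL : IsGDSolution D (ν + 1) L) (h : IsGeneratedBy D (ν + 1) L v)
    (h' : IsGeneratedBy D (ν + 1) L v') (i j : ℕ+) : D i (D j v') = D i (D j v) := by
  have hv := (satisfiesSystem_iff hD ν v).mp ((satisfiesSystem_iff_exists hD ν v).mpr ⟨L, hL, h⟩)
  have hv' := (satisfiesSystem_iff hD ν v').mp
    ((satisfiesSystem_iff_exists hD ν v').mpr ⟨L, hL, h'⟩)
  have he : evalNormal D v' = evalNormal D v := by
    refine MvPolynomial.algHom_ext fun p => ?_
    obtain ⟨t, ht⟩ : ∃ t, (p.2 : ℕ) = t + 1 := ⟨p.2.natPred, (PNat.natPred_add_one p.2).symm⟩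
    rw [evalNormal_X, evalNormal_X, ht, Function.iterate_succ_apply, Function.iterate_succ_apply,
      Psi.iterate_comm (hD p.1 1), Psi.iterate_comm (hD p.1 1),
      der_der_one_unique hD (Nat.succ_ne_zero ν) h h']
  rw [hv, hv', he]

/-! ### Formal power series -/

theorem partialD_comm (K : Type u) [Field K] [CharZero K] (i j : ℕ+) (f : MvPowerSeries ℕ+ K) :
    partialD K i (partialD K j f) = partialD K j (partialD K i f) := by
  ext m
  change MvPowerSeries.coeff m (MvPowerSeries.pderiv K i (MvPowerSeries.pderiv K j f)) =
    MvPowerSeries.coeff m (MvPowerSeries.pderiv K j (MvPowerSeries.pderiv K i f))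
  simp only [MvPowerSeries.coeff_pderiv]
  by_cases h : i = j
  · rw [h]
  · rw [Finsupp.add_apply, Finsupp.add_apply, Finsupp.single_eq_of_ne (Ne.symm h),
      Finsupp.single_eq_of_ne h, add_right_comm,
      add_zero, add_zero]
    ring

theorem closedFormsExact_partialD (K : Type u) [Field K] [CharZero K] :
    ClosedFormsExact (partialD K) := by
  intro w hw
  have hcl : ∀ i j m, MvPowerSeries.coeff m (MvPowerSeries.pderiv K i (w j)) =
      MvPowerSeries.coeff m (MvPowerSeries.pderiv K j (w i)) := fun i j m =>
    congrArg (MvPowerSeries.coeff m) (hw i j)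
  simp only [MvPowerSeries.coeff_pderiv] at hcl
  -- The coefficient of `x^M` in a primitive can be computed from any `w k` with `M k ≠ 0`.
  have hex : ∀ M : ℕ+ →₀ ℕ, ∃ c : K, ∀ k, M k ≠ 0 →
      (M k : K) * c = MvPowerSeries.coeff (M - Finsupp.single k 1) (w k) := by
    intro M
    rcases eq_or_ne M 0 with rfl | hM
    · exact ⟨0, fun k hk => absurd rfl hk⟩
    obtain ⟨l, hl⟩ := Finsupp.ne_iff.mp hM
    rw [Finsupp.zero_apply] at hl
    have hl' : (M l : K) ≠ 0 := Nat.cast_ne_zero.mpr hl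
    refine ⟨(M l : K)⁻¹ * MvPowerSeries.coeff (M - Finsupp.single l 1) (w l), fun k hk => ?_⟩
    by_cases hkl : k = l
    · rw [hkl, mul_inv_cancel_left₀ hl']
    obtain ⟨m, rfl⟩ : ∃ m, M = m + Finsupp.single k 1 + Finsupp.single l 1 :=
      ⟨M - Finsupp.single l 1 - Finsupp.single k 1, by
        ext a
        simp only [Finsupp.add_apply, Finsupp.tsub_apply, Finsupp.single_apply]
        split_ifs with h1 h2 h2
        · exact absurd (h2.trans h1.symm) hkl
        · rw [← h1]; omega
        · rw [← h2]; omega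
        · omega⟩
    have h := hcl k l m
    simp only [Finsupp.add_apply, Finsupp.single_eq_same, Finsupp.single_eq_of_ne hkl,
      Finsupp.single_eq_of_ne (Ne.symm hkl), add_zero] at hl' ⊢
    rw [add_tsub_cancel_right, add_right_comm, add_tsub_cancel_right]
    push_cast at hl' ⊢
    rw [mul_left_comm, inv_mul_eq_iff_eq_mul₀ hl', mul_comm, h, mul_comm]
  choose c hc using hex
  obtain ⟨v, hv⟩ : ∃ v : MvPowerSeries ℕ+ K, ∀ M, MvPowerSeries.coeff M v = c M :=
    ⟨c, fun _ => rfl⟩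
  refine ⟨v, fun i => ?_⟩
  ext m
  change MvPowerSeries.coeff m (MvPowerSeries.pderiv K i v) = _
  rw [MvPowerSeries.coeff_pderiv, hv]
  have := hc (m + Finsupp.single i 1) i (by simp)
  rw [add_tsub_cancel_right] at this
  rw [← this, Finsupp.add_apply, Finsupp.single_eq_same, mul_comm]
  push_cast
  rfl

end

end GelfandDikii

open GelfandDikii in
theorem theorem5p1 (n : ℕ) (hn : 2 ≤ n) :
    ∃ N : Coefficients, N.Admissible n ∧
      (∀ (A : Type u) [CommRing A] [Algebra ℚ A] (D : ℕ+ → Derivation ℚ A A),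
        (∀ (i j : ℕ+) (a : A), D i (D j a) = D j (D i a)) →
          (∀ v : A, SatisfiesSystem D N v ↔
            ∃ L : PsiDO A, IsGDSolution D n L ∧ IsGeneratedBy D n L v) ∧
          (∀ (L L' : PsiDO A) (v : A),
            IsGeneratedBy D n L v → IsGeneratedBy D n L' v → L = L') ∧
          (∀ (L : PsiDO A) (v v' : A), IsGDSolution D n L → IsGeneratedBy D n L v →
            (IsGeneratedBy D n L v' ↔ ∀ i j : ℕ+, D i (D j v') = D i (D j v))) ∧
          (ClosedFormsExact D → ∀ L : PsiDO A, IsGDSolution D n L →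
            ∃ v : A, D (Nat.toPNat' n) v = 0 ∧ IsGeneratedBy D n L v)) ∧
      (∀ (K : Type u) [Field K] [CharZero K] (L : PsiDO (MvPowerSeries ℕ+ K)),
        IsGDSolution (partialD K) n L →
          ∃ v : MvPowerSeries ℕ+ K,
            partialD K (Nat.toPNat' n) v = 0 ∧ IsGeneratedBy (partialD K) n L v) := by
  obtain ⟨ν, rfl⟩ : ∃ ν, n = ν + 1 := ⟨n - 1, by omega⟩
  have hm : ((Nat.toPNat' (ν + 1) : ℕ+) : ℕ) = ν + 1 := Nat.succPNat_coe ν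
  refine ⟨systemCoeff ν, systemCoeff_admissible ν, fun A _ _ D hD => ⟨?_, ?_, ?_, ?_⟩, ?_⟩
  · exact satisfiesSystem_iff_exists hD ν
  · exact fun L L' v => operator_unique
  · exact fun L v v' hL h => ⟨fun h' => der_der_unique hD hL h h', isGeneratedBy_of_der_eq hD h⟩
  · exact fun hex L hL => exists_isGeneratedBy hD hex hm hL
  · exact fun K _ _ L hL => exists_isGeneratedBy (partialD_comm K)
      (closedFormsExact_partialD K) hm hL
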